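/- A (real) composition algebra is a nonzero unital, not necessarily associative, real algebra $K$ with a non-degenerate quadratic form $x\mapsto|x|^2$ such that $|xy|^2=|x|^2|y|^2$; let $\langle x,y\rangle$ be the bilinear form with $\langle x,x\rangle=|x|^2$, $\operatorname{Re}x=\langle x,1\rangle$, $\bar x=2\langle x,1\rangle1-x$, and $K'=1^\perp$. Let $L_x,R_x$ be the left and right multiplications and $D_{x,y}=[L_x,L_y]+[L_x,R_y]+[R_x,R_y]$. For an algebra $A$, let $\operatorname{Der}A$ be its Lie algebra of derivations. Let $$\operatorname{Tri}K=\{(A,B,C)\in\mathfrak{so}(K)^3: A(xy)=x(By)+(Cx)y\ \ \forall x,y\in K\},$$ where $\mathfrak{so}(K)$ is the set of linear maps skew-symmetric for $\langle\,,\rangle$; it is a Lie algebra under componentwise commutators. For a linear map $A$ put $\overline A(x)=\overline{A(\bar x)}$. Let $\theta(A,B,C)=(\overline B,C,\overline A)$, an automorphism of $\operatorname{Tri}K$, and for $x,y\in K$ let $$T_{x,y}=(4S_{x,y},\;R_yR_{\bar x}-R_xR_{\bar y},\;L_yL_{\bar x}-L_xL_{\bar y})\in\operatorname{Tri}K,\qquad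 S_{x,y}(z)=\langle x,z\rangle y-\langle y,z\rangle x.$$ Let $K_1,K_2$ be composition algebras. Let $J=H_3(K_2)$ be the space of hermitian $3\times3$ matrices over $K_2$ with product $X\cdot Y=XY+YX$, identity $E=\frac12\mathbf 1$ and inner product $\langle X,Y\rangle=\frac12\operatorname{tr}(X\cdot Y)$; let $J'=E^\perp$, $A*B=A\cdot B-\frac43\langle A,B\rangle E$, and let $L_A$ be multiplication by $A$ in $J$. The Tits algebra is $$L_3(K_1,K_2)=\operatorname{Der}K_1\dotplus\operatorname{Der}J\dotplus K_1'\otimes J',$$ with commutators on $\operatorname{Der}K_1\oplus\operatorname{Der}J$, the natural action of these derivations on $K_1'\otimes J'$, and $$[a\otimes A,b\otimes B]=\tfrac13\langle A,B\rangle D_{a,b}-\langle a,b\rangle[L_A,L_B]+\tfrac12[a,b]\otimes(A*B).$$ **Theorem 4.4.** These brackets take values in $L_3(K_1,K_2)$ and make it a Lie algebra, and there is a linear isomorphism $$L_3(K_1,K_2)\cong\operatorname{Tri}K_1\oplus\operatorname{Tri}K_2\dotplus 3(K_1\otimes K_2)$$ under which $\operatorname{Tri}K_1\oplus\operatorname{Tri}K_2$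 is a Lie subalgebra (the direct sum of the Lie algebras $\operatorname{Tri}K_1$ and $\operatorname{Tri}K_2$) and the other brackets are as follows. Let $F_1,F_2,F_3$ be the three embeddings of $K_1\otimes K_2$ in $3(K_1\otimes K_2)$. For $T_\alpha=(T_{\alpha1},\overline{T}_{\alpha2},\overline{T}_{\alpha3})\in\operatorname{Tri}K_\alpha$, $x_\alpha,y_\alpha\in K_\alpha$ $(\alpha=1,2)$, $i\in\{1,2,3\}$: $$[T_1,F_i(x_1\otimes x_2)]=F_i(T_{1i}x_1\otimes x_2),\qquad [T_2,F_i(x_1\otimes x_2)]=F_i(x_1\otimes T_{2i}x_2),$$ $$[F_i(x_1\otimes x_2),F_j(y_1\otimes y_2)]=F_k(\bar y_1\bar x_1\otimes\bar y_2\bar x_2)$$ if $(i,j,k)$ is a cyclic permutation of $(1,2,3)$, and $$[F_i(x_1\otimes x_2),F_i(y_1\otimes y_2)]=\langle x_2,y_2\rangle\,\theta^{1-i}T_{x_1,y_1}+\langle x_1,y_1\rangle\,\theta^{1-i}T_{x_2,y_2}\in\operatorname{Tri}K_1\oplus\operatorname{Tri}K_2.$$ The construction is symmetric in $K_1$ and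 $K_2$: whenever $L_3(K_1,K_2)$ and $L_3(K_2,K_1)$ are identified in this way with $\operatorname{Tri}K_1\oplus\operatorname{Tri}K_2\dotplus3(K_1\otimes K_2)$ and $\operatorname{Tri}K_2\oplus\operatorname{Tri}K_1\dotplus3(K_2\otimes K_1)$, the interchange $(T_1,T_2,F_i(x_1\otimes x_2))\mapsto(T_2,T_1,F_i(x_2\otimes x_1))$ respects the brackets. -/

import Mathlib

open scoped TensorProduct

noncomputable section

attribute [local instance 100] LieRing.ofAssociativeRing

namespace MagicSquare

/-! ### Composition algebras over `ℝ` -/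

/-- A real composition algebra: a nonzero unital, not necessarily associative, `ℝ`-algebra
with a non-degenerate quadratic form `x ↦ |x|²` such that `|xy|² = |x|²|y|²`. -/
class CompositionAlgebra (K : Type*) [NonAssocRing K] [Module ℝ K]
    extends IsScalarTower ℝ K K, SMulCommClass ℝ K K, Nontrivial K where
  normSq : QuadraticForm ℝ K
  nondegenerate : (QuadraticMap.associated normSq).Nondegenerate
  normSq_mul : ∀ x y : K, normSq (x * y) = normSq x * normSq y

section Algebra

variable (K : Type*) [NonAssocRing K] [Module ℝ K] [CompositionAlgebra K]

/-- The bilinear form `⟨x, y⟩` associated with the quadratic form, normalised by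
`⟨x, x⟩ = |x|²`. -/
def ip : LinearMap.BilinForm ℝ K :=
  QuadraticMap.associated (CompositionAlgebra.normSq (K := K))

variable {K}

/-- The real part: `x - Re x` is orthogonal to `1`, since `|1|² = 1`. -/
def re : K →ₗ[ℝ] ℝ := (ip K).flip 1

/-- The conjugation, equal to `1` on the scalars and to `-1` on their orthogonal complement. -/
def conj : K →ₗ[ℝ] K := (2 : ℝ) • re.smulRight (1 : K) - LinearMap.id

theorem ip_comm (x y : K) : ip K x y = ip K y x :=
  QuadraticMap.associated_isSymm ℝ _ x y

theorem ip_mul_self (x y z : K) : ip K (x * y) (x * z) = ip K x x * ip K y z := by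
  simp only [ip, QuadraticMap.associated_apply, ← mul_add, CompositionAlgebra.normSq_mul,
    smul_eq_mul, Module.End.smul_def, ← two_smul ℝ x, QuadraticMap.map_smul]
  simp [invOf_eq_inv]
  ring

theorem ip_mul_mul (x y z w : K) :
    ip K (x * y) (z * w) + ip K (z * y) (x * w) = 2 * (ip K x z * ip K y w) := by
  have h := ip_mul_self (x + z) y w
  have h1 := ip_mul_self x y w
  have h2 := ip_mul_self z y w
  simp only [add_mul, map_add, LinearMap.add_apply] at h
  rw [ip_comm z x] at h
  linarith

theorem eq_of_ip {x y : K} (h : ∀ z, ip K x z = ip K y z) : x = y := by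
  have := (CompositionAlgebra.nondegenerate (K := K)).1 (x - y) fun z => by
    have := h z
    simp only [ip] at this
    simp [this]
  exact sub_eq_zero.mp this

theorem ip_one : ip K 1 1 = 1 := by
  by_contra h
  have h0 : ∀ y z : K, ip K y z = 0 := fun y z => by
    have := ip_mul_self (1 : K) y z
    simp only [one_mul] at this
    by_contra hne
    exact h (mul_right_cancel₀ hne (by linarith))
  exact zero_ne_one (α := K) (eq_of_ip fun z => by rw [h0, h0])

theorem conj_apply (x : K) : conj x = (2 * ip K x 1) • (1 : K) - x := by
  simp [conj, re, mul_smul]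

theorem conj_conj (x : K) : conj (conj x) = x := by
  have h : conj (1 : K) = 1 := by
    rw [conj_apply, ip_one]
    module
  rw [conj_apply x, map_sub, map_smul, h, conj_apply x]
  abel

theorem ip_mul_left (x y z : K) : ip K (x * y) z = ip K y (conj x * z) := by
  have h := ip_mul_mul x y 1 z
  simp only [one_mul] at h
  simp only [conj_apply, sub_mul, smul_mul_assoc, one_mul, map_sub, map_smul, smul_eq_mul]
  linarith

theorem ip_mul_right (x y z : K) : ip K (x * y) z = ip K x (z * conj y) := by
  have h := ip_mul_mul x y z 1
  simp only [mul_one] at h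
  have h2 := ip_comm (z * y) x
  simp only [conj_apply, mul_sub, mul_smul_comm, mul_one, map_sub, map_smul, smul_eq_mul]
  linarith

theorem ip_conj (x y : K) : ip K (conj x) (conj y) = ip K x y := by
  simp only [conj_apply, map_sub, map_smul, LinearMap.sub_apply, LinearMap.smul_apply, ip_one,
    smul_eq_mul]
  rw [ip_comm 1 y]
  ring

theorem ip_conj_left (x y : K) : ip K (conj x) y = ip K x (conj y) := by
  rw [← ip_conj, conj_conj]

theorem conj_mul (x y : K) : conj (x * y) = conj y * conj x := by
  refine eq_of_ip fun z => ?_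
  rw [ip_conj_left, ip_mul_left, ← ip_mul_right, ip_mul_left, ip_comm]

theorem conj_mul_add (x y z : K) :
    x * (conj y * z) + y * (conj x * z) = (2 * ip K x y) • z := by
  refine eq_of_ip fun w => ?_
  have h := ip_mul_mul (conj y) z (conj x) w
  rw [ip_conj, ip_comm y x] at h
  simp only [map_add, map_smul, LinearMap.add_apply, LinearMap.smul_apply, smul_eq_mul]
  rw [ip_mul_left x, ip_mul_left y]
  linarith

theorem mul_conj_add (x y z : K) :
    (z * conj x) * y + (z * conj y) * x = (2 * ip K x y) • z := by
  have h := congrArg conj (conj_mul_add (conj x) (conj y) (conj z))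
  simpa [conj_mul, conj_conj, ip_conj, add_comm] using h

/-! ### Triality -/

/-- `A ↦ Ā`, where `Ā x` is the conjugate of `A x̄`. -/
def bar : Module.End ℝ K →ₗ[ℝ] Module.End ℝ K :=
  LinearMap.mk₂ ℝ (fun A x => conj (A (conj x))) (by simp) (by simp) (by simp) (by simp)

@[simp] theorem bar_apply (A : Module.End ℝ K) (x : K) : bar A x = conj (A (conj x)) := rfl

@[simp] theorem bar_bar (A : Module.End ℝ K) : bar (bar A) = A := by
  ext x; simp [conj_conj]

variable (K) in
/-- `so(K)`: the endomorphisms `A` with `⟨Ax, y⟩ = -⟨x, Ay⟩`. -/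
abbrev so : LieSubalgebra ℝ (Module.End ℝ K) := skewAdjointLieSubalgebra (ip K)

theorem mem_so {A : Module.End ℝ K} : A ∈ so K ↔ ∀ x y, ip K (A x) y = -ip K x (A y) := by
  refine forall₂_congr fun x y => ?_
  simp

variable (K) in
/-- The triality algebra: the triples `(A, B, C)` in `so(K)³` such that
`A (x y) = x (B y) + (C x) y`. -/
def Tri : LieSubalgebra ℝ (Module.End ℝ K × Module.End ℝ K × Module.End ℝ K) where
  carrier := {T | T.1 ∈ so K ∧ T.2.1 ∈ so K ∧ T.2.2 ∈ so K ∧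
    ∀ x y : K, T.1 (x * y) = x * T.2.1 y + T.2.2 x * y}
  zero_mem' := ⟨zero_mem _, zero_mem _, zero_mem _, by simp⟩
  add_mem' := by
    rintro S T ⟨h1, h2, h3, h⟩ ⟨k1, k2, k3, k⟩
    refine ⟨add_mem h1 k1, add_mem h2 k2, add_mem h3 k3, fun x y => ?_⟩
    simp only [Prod.fst_add, Prod.snd_add, LinearMap.add_apply, h, k, mul_add, add_mul]
    abel
  smul_mem' := by
    rintro r S ⟨h1, h2, h3, h⟩
    refine ⟨(so K).smul_mem r h1, (so K).smul_mem r h2, (so K).smul_mem r h3, fun x y => ?_⟩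
    simp [h, mul_smul_comm, smul_mul_assoc]
  lie_mem' := by
    rintro S T ⟨h1, h2, h3, h⟩ ⟨k1, k2, k3, k⟩
    refine ⟨(so K).lie_mem h1 k1, (so K).lie_mem h2 k2, (so K).lie_mem h3 k3, fun x y => ?_⟩
    change (S.1 * T.1 - T.1 * S.1) (x * y) = x * (S.2.1 * T.2.1 - T.2.1 * S.2.1) y
      + (S.2.2 * T.2.2 - T.2.2 * S.2.2) x * y
    simp only [LinearMap.sub_apply, Module.End.mul_apply, h, k, map_add, mul_sub, sub_mul]
    abel

/-- The components `T₁, T₂, T₃` in the notation `T = (T₁, T̄₂, T̄₃)`; the index set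
`{1, 2, 3}` is `Fin 3 = {0, 1, 2}`. -/
def Tri.comp (T : Tri K) : Fin 3 → Module.End ℝ K :=
  ![T.1.1, bar T.1.2.1, bar T.1.2.2]

/-- The operator `S_{x,y}(z) = ⟨x, z⟩ y - ⟨y, z⟩ x`. -/
def S (x y : K) : Module.End ℝ K := (ip K x).smulRight y - (ip K y).smulRight x

/-- The triple `T_{x,y} = (4 S_{x,y}, R_y R_x̄ - R_x R_ȳ, L_y L_x̄ - L_x L_ȳ)`. -/
def tripleT (x y : K) : Module.End ℝ K × Module.End ℝ K × Module.End ℝ K :=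
  ((4 : ℝ) • S x y,
    LinearMap.mulRight ℝ y * LinearMap.mulRight ℝ (conj x)
      - LinearMap.mulRight ℝ x * LinearMap.mulRight ℝ (conj y),
    LinearMap.mulLeft ℝ y * LinearMap.mulLeft ℝ (conj x)
      - LinearMap.mulLeft ℝ x * LinearMap.mulLeft ℝ (conj y))

theorem tripleT_mem (x y : K) : tripleT x y ∈ Tri K := by
  refine ⟨?_, ?_, ?_, fun u v => ?_⟩
  · refine mem_so.2 fun u v => ?_
    simp only [tripleT, S, LinearMap.smul_apply, LinearMap.sub_apply, LinearMap.smulRight_apply,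
      map_sub, map_smul, smul_eq_mul, ip_comm _ v, ip_comm u]
    ring
  · refine mem_so.2 fun u v => ?_
    simp only [tripleT, LinearMap.sub_apply, Module.End.mul_apply, LinearMap.mulRight_apply,
      map_sub, ip_mul_right, conj_conj]
    ring
  · refine mem_so.2 fun u v => ?_
    simp only [tripleT, LinearMap.sub_apply, Module.End.mul_apply, LinearMap.mulLeft_apply,
      map_sub, ip_mul_left, conj_conj]
    ring
  · have a1 := conj_mul_add u (x * conj v) y
    have a2 := conj_mul_add u (y * conj v) x
    have b1 := mul_conj_add (conj u * x) v y
    have b2 := mul_conj_add (conj u * y) v x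
    have e1 : ip K u (x * conj v) = ip K x (u * v) := by rw [← ip_mul_right, ip_comm]
    have e2 : ip K u (y * conj v) = ip K y (u * v) := by rw [← ip_mul_right, ip_comm]
    have e3 : ip K (conj u * x) v = ip K x (u * v) := by rw [ip_mul_left, conj_conj]
    have e4 : ip K (conj u * y) v = ip K y (u * v) := by rw [ip_mul_left, conj_conj]
    simp only [conj_mul, conj_conj, e1, e2, e3, e4] at a1 a2 b1 b2
    simp only [tripleT, S, LinearMap.sub_apply, Module.End.mul_apply, LinearMap.mulLeft_apply,
      LinearMap.mulRight_apply, LinearMap.smul_apply, LinearMap.smulRight_apply, mul_sub, sub_mul]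
    have key : (4 : ℝ) • (ip K x (u * v) • y - ip K y (u * v) • x)
        = (2 * ip K x (u * v)) • y + (2 * ip K x (u * v)) • y
          - ((2 * ip K y (u * v)) • x + (2 * ip K y (u * v)) • x) := by
      module
    rw [key]
    nth_rewrite 1 [← a1]
    rw [← b1]
    nth_rewrite 1 [← a2]
    rw [← b2]
    abel

/-- `T_{x,y}` as an element of the triality algebra. -/
def triT (x y : K) : Tri K := ⟨tripleT x y, tripleT_mem x y⟩

theorem bar_mem_so {A : Module.End ℝ K} (hA : A ∈ so K) : bar A ∈ so K :=
  mem_so.2 fun x y => by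
    rw [bar_apply, bar_apply, ip_conj_left, mem_so.1 hA, ← ip_conj_left]

theorem theta_mem {T : Module.End ℝ K × Module.End ℝ K × Module.End ℝ K} (hT : T ∈ Tri K) :
    (bar T.2.1, T.2.2, bar T.1) ∈ Tri K := by
  obtain ⟨hA, hB, hC, h⟩ := hT
  refine ⟨bar_mem_so hB, hC, bar_mem_so hA, fun x y => ?_⟩
  have key : ∀ u z : K, T.2.1 (u * z) = u * T.1 z + bar T.2.2 u * z := fun u z => by
    refine eq_of_ip fun w => ?_
    have h1 := h (conj u) w
    have h2 := mem_so.1 hA (conj u * w) z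
    rw [h1, map_add, LinearMap.add_apply, ip_mul_left, ip_mul_left, ip_mul_left, conj_conj] at h2
    rw [ip_comm, ← neg_eq_iff_eq_neg.2 (mem_so.1 hB w (u * z)), ip_comm _ w, map_add, bar_apply]
    linarith
  simp only [bar_apply, conj_mul, key, map_add, conj_conj]
  exact add_comm _ _

variable (K) in
/-- The automorphism `θ (A, B, C) = (B̄, C, Ā)` of the triality algebra (its inverse is
`(A, B, C) ↦ (C̄, Ā, B)`). -/
def theta : Tri K ≃ₗ[ℝ] Tri K where
  toFun T := ⟨(bar T.1.2.1, T.1.2.2, bar T.1.1), theta_mem T.2⟩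
  invFun T := ⟨(bar T.1.2.2, bar T.1.1, T.1.2.1), by
    simpa using theta_mem (theta_mem T.2)⟩
  map_add' S T := by ext : 1; simp
  map_smul' r T := by ext : 1; simp
  left_inv T := by ext : 1; simp
  right_inv T := by ext : 1; simp

/-! ### Derivations and hermitian matrices -/

/-- The derivation algebra of the algebra with underlying space `A` and product `μ`. -/
def Der {A : Type*} [AddCommGroup A] [Module ℝ A] (μ : A →ₗ[ℝ] A →ₗ[ℝ] A) :
    LieSubalgebra ℝ (Module.End ℝ A) where
  carrier := {D | ∀ x y, D (μ x y) = μ (D x) y + μ x (D y)}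
  zero_mem' := by simp
  add_mem' {D E} hD hE x y := by
    simp only [LinearMap.add_apply, hD x y, hE x y, map_add]
    abel
  smul_mem' r D hD x y := by simp [hD x y]
  lie_mem' {D E} hD hE x y := by
    have hD' : ∀ x y, D (μ x y) = μ (D x) y + μ x (D y) := hD
    have hE' : ∀ x y, E (μ x y) = μ (E x) y + μ x (E y) := hE
    simp only [Ring.lie_def, LinearMap.sub_apply, Module.End.mul_apply, hD', hE', map_add, map_sub]
    abel

/-- The derivation `D_{x,y} = [L_x, L_y] + [L_x, R_y] + [R_x, R_y]` of a composition algebra. -/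
def derivD : K →ₗ[ℝ] K →ₗ[ℝ] Module.End ℝ K :=
  LinearMap.mk₂ ℝ
    (fun x y => ⁅LinearMap.mulLeft ℝ x, LinearMap.mulLeft ℝ y⁆
      + ⁅LinearMap.mulLeft ℝ x, LinearMap.mulRight ℝ y⁆
      + ⁅LinearMap.mulRight ℝ x, LinearMap.mulRight ℝ y⁆)
    (by intros; ext; simp [Ring.lie_def, add_mul, mul_add]; abel)
    (by intros; ext; simp [Ring.lie_def, smul_add, smul_sub, mul_smul_comm, smul_mul_assoc])
    (by intros; ext; simp [Ring.lie_def, add_mul, mul_add]; abel)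
    (by intros; ext; simp [Ring.lie_def, smul_add, smul_sub, mul_smul_comm, smul_mul_assoc])

/-- The commutator `[x, y] = xy - yx` as a bilinear map. -/
def comm : K →ₗ[ℝ] K →ₗ[ℝ] K := LinearMap.mul ℝ K - (LinearMap.mul ℝ K).flip

variable (K)

/-- `K'`: the orthogonal complement of the scalars. -/
def im : Submodule ℝ K := LinearMap.ker (re (K := K))

/-- The subspace of hermitian `3 × 3` matrices over `K`. -/
def hermitian : Submodule ℝ (Matrix (Fin 3) (Fin 3) K) where
  carrier := {X | ∀ i j, X i j = conj (X j i)}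
  zero_mem' := by simp
  add_mem' {X Y} hX hY i j := by
    rw [Matrix.add_apply, Matrix.add_apply, map_add, ← hX i j, ← hY i j]
  smul_mem' r X hX i j := by
    rw [Matrix.smul_apply, Matrix.smul_apply, map_smul, ← hX i j]

/-- `H₃(K)`: the type of hermitian `3 × 3` matrices over `K`. -/
def H3 (K : Type*) [NonAssocRing K] [Module ℝ K] [CompositionAlgebra K] : Type _ := hermitian K

instance : AddCommGroup (H3 K) := inferInstanceAs (AddCommGroup (hermitian K))

instance : Module ℝ (H3 K) := inferInstanceAs (Module ℝ (hermitian K))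

variable {K}

@[simp] theorem H3.val_add (X Y : H3 K) : (X + Y).1 = X.1 + Y.1 := rfl

@[simp] theorem H3.val_smul (r : ℝ) (X : H3 K) : (r • X).1 = r • X.1 := rfl

theorem jordan_mem (X Y : H3 K) : X.1 * Y.1 + Y.1 * X.1 ∈ hermitian K := fun i j => by
  have h : ∀ X Y : H3 K, (X.1 * Y.1) i j = conj ((Y.1 * X.1) j i) := fun X Y => by
    rw [Matrix.mul_apply, Matrix.mul_apply, map_sum]
    refine Finset.sum_congr rfl fun k _ => ?_
    rw [conj_mul, ← X.2 i k, ← Y.2 k j]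
  rw [Matrix.add_apply, Matrix.add_apply, map_add, h X Y, h Y X, add_comm]

/-- The Jordan product `X · Y = XY + YX` on `H₃(K)`. -/
def jordan : H3 K →ₗ[ℝ] H3 K →ₗ[ℝ] H3 K :=
  LinearMap.mk₂ ℝ (fun X Y => ⟨X.1 * Y.1 + Y.1 * X.1, jordan_mem X Y⟩)
    (fun X Y Z => Subtype.ext <| by
      change (X.1 + Y.1) * Z.1 + Z.1 * (X.1 + Y.1)
        = (X.1 * Z.1 + Z.1 * X.1) + (Y.1 * Z.1 + Z.1 * Y.1)
      rw [add_mul, mul_add]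
      abel)
    (fun r X Y => Subtype.ext <| by
      change (r • X.1) * Y.1 + Y.1 * (r • X.1) = r • (X.1 * Y.1 + Y.1 * X.1)
      simp)
    (fun X Y Z => Subtype.ext <| by
      change X.1 * (Y.1 + Z.1) + (Y.1 + Z.1) * X.1
        = (X.1 * Y.1 + Y.1 * X.1) + (X.1 * Z.1 + Z.1 * X.1)
      rw [add_mul, mul_add]
      abel)
    (fun r X Y => Subtype.ext <| by
      change X.1 * (r • Y.1) + (r • Y.1) * X.1 = r • (X.1 * Y.1 + Y.1 * X.1)
      simp)

variable (K) in
/-- The identity `E = ½ 𝟏` of the Jordan algebra `H₃(K)`. -/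
def jordanOne : H3 K := ⟨(1 / 2 : ℝ) • (1 : Matrix (Fin 3) (Fin 3) K), (hermitian K).smul_mem _ fun i j => by
  have h : conj (1 : K) = 1 := by
    rw [conj_apply, ip_one]
    module
  by_cases hij : i = j
  · subst hij
    simp [h]
  · simp [Matrix.one_apply_ne hij, Matrix.one_apply_ne (Ne.symm hij)]⟩

/-- The inner product `⟨X, Y⟩ = ½ tr (X · Y)` on `H₃(K)` (the trace of a hermitian matrix
is a real multiple of `1`). -/
def ipH : H3 K →ₗ[ℝ] H3 K →ₗ[ℝ] ℝ :=
  LinearMap.mk₂ ℝ (fun X Y => 1 / 2 * re (Matrix.trace (jordan X Y).1))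
    (by intros; simp; ring) (by intros; simp; ring)
    (by intros; simp; ring) (by intros; simp; ring)

variable (K) in
/-- `H₃'(K)`: the orthogonal complement of the identity in `H₃(K)`. -/
def H3' : Submodule ℝ (H3 K) := LinearMap.ker (ipH (jordanOne K))

/-- The product `A * B = A · B - (4/3) ⟨A, B⟩ E`, the orthogonal projection of the Jordan product
to `H₃'(K)`, as `⟨A · B, E⟩ = ⟨A, B⟩` and `⟨E, E⟩ = 3/4`. -/
def star : H3 K →ₗ[ℝ] H3 K →ₗ[ℝ] H3 K :=
  LinearMap.mk₂ ℝ (fun A B => jordan A B - (4 / 3 * ipH A B) • jordanOne K)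
    (by intros; simp; module) (by intros; simp; module)
    (by intros; simp; module) (by intros; simp; module)

/-- The commutator `[L_A, L_B]` of Jordan multiplication operators. -/
def commL : H3 K →ₗ[ℝ] H3 K →ₗ[ℝ] Module.End ℝ (H3 K) :=
  LinearMap.mk₂ ℝ (fun A B => ⁅(jordan A : Module.End ℝ (H3 K)), (jordan B : Module.End ℝ (H3 K))⁆)
    (by intros; simp) (by intros; simp) (by intros; simp) (by intros; simp)

end Algebra

section Magic

variable (K₁ K₂ : Type*) [NonAssocRing K₁] [Module ℝ K₁] [CompositionAlgebra K₁]
  [NonAssocRing K₂] [Module ℝ K₂] [CompositionAlgebra K₂]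

/-! ### The Tits construction -/

/-- The space `End K₁ ⊕ End H₃(K₂) ⊕ K₁ ⊗ H₃(K₂)` in which the Tits algebra lives. -/
abbrev TitsAmbient : Type _ :=
  Module.End ℝ K₁ × Module.End ℝ (H3 K₂) × (K₁ ⊗[ℝ] H3 K₂)

/-- The vector space `L₃(K₁, K₂) = Der K₁ ∔ Der H₃(K₂) ∔ K₁' ⊗ H₃'(K₂)`. -/
def L₃ : Submodule ℝ (TitsAmbient K₁ K₂) :=
  (Der (LinearMap.mul ℝ K₁)).toSubmodule.prod
    ((Der (jordan (K := K₂))).toSubmodule.prod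
      (LinearMap.range (TensorProduct.mapIncl (im K₁) (H3' K₂))))

variable {K₁ K₂}

/-- The bilinear map with `(a ⊗ A, b ⊗ B) ↦ ⅓ ⟨A, B⟩ D_{a,b}`. -/
def titsDer : (K₁ ⊗[ℝ] H3 K₂) →ₗ[ℝ] (K₁ ⊗[ℝ] H3 K₂) →ₗ[ℝ] Module.End ℝ K₁ :=
  (1 / 3 : ℝ) • (TensorProduct.map₂ derivD ipH).compr₂
    (TensorProduct.rid ℝ (Module.End ℝ K₁)).toLinearMap

/-- The bilinear map with `(a ⊗ A, b ⊗ B) ↦ -⟨a, b⟩ [L_A, L_B]`. -/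
def titsJordan : (K₁ ⊗[ℝ] H3 K₂) →ₗ[ℝ] (K₁ ⊗[ℝ] H3 K₂) →ₗ[ℝ] Module.End ℝ (H3 K₂) :=
  -(TensorProduct.map₂ (ip K₁) commL).compr₂
    (TensorProduct.lid ℝ (Module.End ℝ (H3 K₂))).toLinearMap

/-- The bilinear map with `(a ⊗ A, b ⊗ B) ↦ ½ [a, b] ⊗ (A * B)`. -/
def titsTensor : (K₁ ⊗[ℝ] H3 K₂) →ₗ[ℝ] (K₁ ⊗[ℝ] H3 K₂) →ₗ[ℝ] (K₁ ⊗[ℝ] H3 K₂) :=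
  (1 / 2 : ℝ) • TensorProduct.map₂ comm star

theorem titsDer_tmul (a b : K₁) (A B : H3 K₂) :
    titsDer (a ⊗ₜ[ℝ] A) (b ⊗ₜ[ℝ] B) = (1 / 3 * ipH A B) • derivD a b := by
  simp [titsDer, mul_smul]

theorem titsJordan_tmul (a b : K₁) (A B : H3 K₂) :
    titsJordan (a ⊗ₜ[ℝ] A) (b ⊗ₜ[ℝ] B) = -(ip K₁ a b • ⁅jordan A, jordan B⁆) := by
  simp [titsJordan, commL]

theorem titsTensor_tmul (a b : K₁) (A B : H3 K₂) :
    titsTensor (a ⊗ₜ[ℝ] A) (b ⊗ₜ[ℝ] B) = (1 / 2 : ℝ) • ((a * b - b * a) ⊗ₜ[ℝ] star A B) := by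
  simp [titsTensor, comm]

/-- The Tits bracket: commutators on `Der K₁ ⊕ Der H₃(K₂)`, the natural action of derivations on
`K₁ ⊗ H₃(K₂)`, and
`[a ⊗ A, b ⊗ B] = ⅓ ⟨A, B⟩ D_{a,b} - ⟨a, b⟩ [L_A, L_B] + ½ [a, b] ⊗ (A * B)`. -/
def titsBracket : TitsAmbient K₁ K₂ →ₗ[ℝ] TitsAmbient K₁ K₂ →ₗ[ℝ] TitsAmbient K₁ K₂ :=
  LinearMap.mk₂ ℝ
    (fun u v =>
      (⁅u.1, v.1⁆ + titsDer u.2.2 v.2.2,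
        ⁅u.2.1, v.2.1⁆ + titsJordan u.2.2 v.2.2,
        (u.1.rTensor (H3 K₂) v.2.2 + u.2.1.lTensor K₁ v.2.2)
          - (v.1.rTensor (H3 K₂) u.2.2 + v.2.1.lTensor K₁ u.2.2) + titsTensor u.2.2 v.2.2))
    (by
      intros
      refine Prod.ext ?_ (Prod.ext ?_ ?_) <;>
        simp [LinearMap.rTensor_add, LinearMap.lTensor_add] <;> abel)
    (by
      intros
      refine Prod.ext ?_ (Prod.ext ?_ ?_) <;>
        simp [LinearMap.rTensor_smul, LinearMap.lTensor_smul, smul_sub])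
    (by
      intros
      refine Prod.ext ?_ (Prod.ext ?_ ?_) <;>
        simp [LinearMap.rTensor_add, LinearMap.lTensor_add] <;> abel)
    (by
      intros
      refine Prod.ext ?_ (Prod.ext ?_ ?_) <;>
        simp [LinearMap.rTensor_smul, LinearMap.lTensor_smul, smul_sub])

/-- A bilinear operation on `V` restricts to a Lie bracket on the subspace `L`. -/
structure IsLieBracketOn {V : Type*} [AddCommGroup V] [Module ℝ V]
    (β : V →ₗ[ℝ] V →ₗ[ℝ] V) (L : Submodule ℝ V) : Prop where
  closed : ∀ u ∈ L, ∀ v ∈ L, β u v ∈ L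
  alternating : ∀ u ∈ L, β u u = 0
  jacobi : ∀ u ∈ L, ∀ v ∈ L, ∀ w ∈ L, β (β u v) w + β (β v w) u + β (β w u) v = 0

/-! ### The triality construction -/

variable (K₁ K₂) in
/-- The vector space `Tri K₁ ⊕ Tri K₂ ∔ 3 (K₁ ⊗ K₂)`. -/
abbrev TrialitySpace : Type _ := Tri K₁ × Tri K₂ × (Fin 3 → K₁ ⊗[ℝ] K₂)

/-- The embeddings `F₁, F₂, F₃` of `K₁ ⊗ K₂` as the three summands of `3 (K₁ ⊗ K₂)`,
indexed by `Fin 3 = {0, 1, 2}`. -/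
def F (i : Fin 3) (w : K₁ ⊗[ℝ] K₂) : TrialitySpace K₁ K₂ := (0, 0, Pi.single i w)

/-- A linear bijection `Φ` of `Tri K₁ ⊕ Tri K₂ ∔ 3 (K₁ ⊗ K₂)` onto `L₃(K₁, K₂)` under which the
Tits bracket takes the stated form. As the indices `1, 2, 3` are shifted to `0, 1, 2`, the exponent
`1 - i` of `θ` becomes `-i`; the cyclic permutations `(i, j, k)` are `(i, i + 1, i + 2)`
modulo 3. -/
structure IsTrialityDecomposition (Φ : TrialitySpace K₁ K₂ ≃ₗ[ℝ] L₃ K₁ K₂) : Prop where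
  tri_tri : ∀ (S₁ T₁ : Tri K₁) (S₂ T₂ : Tri K₂),
    titsBracket (Φ (S₁, S₂, 0)).1 (Φ (T₁, T₂, 0)).1 = (Φ (⁅S₁, T₁⁆, ⁅S₂, T₂⁆, 0)).1
  tri₁_F : ∀ (T : Tri K₁) (i : Fin 3) (x₁ : K₁) (x₂ : K₂),
    titsBracket (Φ (T, 0, 0)).1 (Φ (F i (x₁ ⊗ₜ x₂))).1 = (Φ (F i (Tri.comp T i x₁ ⊗ₜ x₂))).1
  tri₂_F : ∀ (T : Tri K₂) (i : Fin 3) (x₁ : K₁) (x₂ : K₂),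
    titsBracket (Φ (0, T, 0)).1 (Φ (F i (x₁ ⊗ₜ x₂))).1 = (Φ (F i (x₁ ⊗ₜ Tri.comp T i x₂))).1
  F_F : ∀ (i j k : Fin 3), j = i + 1 → k = i + 2 → ∀ (x₁ y₁ : K₁) (x₂ y₂ : K₂),
    titsBracket (Φ (F i (x₁ ⊗ₜ x₂))).1 (Φ (F j (y₁ ⊗ₜ y₂))).1
      = (Φ (F k ((conj y₁ * conj x₁) ⊗ₜ (conj y₂ * conj x₂)))).1
  F_F_self : ∀ (i : Fin 3) (x₁ y₁ : K₁) (x₂ y₂ : K₂),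
    titsBracket (Φ (F i (x₁ ⊗ₜ x₂))).1 (Φ (F i (y₁ ⊗ₜ y₂))).1
      = (Φ (ip K₂ x₂ y₂ • (theta K₁ ^ (-(i.val : ℤ))) (triT x₁ y₁),
          ip K₁ x₁ y₁ • (theta K₂ ^ (-(i.val : ℤ))) (triT x₂ y₂), 0)).1

variable (K₁ K₂) in
/-- The interchange of `K₁` and `K₂` in `Tri K₁ ⊕ Tri K₂ ∔ 3 (K₁ ⊗ K₂)`. -/
def interchange : TrialitySpace K₁ K₂ ≃ₗ[ℝ] TrialitySpace K₂ K₁ where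
  toFun u := (u.2.1, u.1, fun i => TensorProduct.comm ℝ K₁ K₂ (u.2.2 i))
  invFun u := (u.2.1, u.1, fun i => TensorProduct.comm ℝ K₂ K₁ (u.2.2 i))
  map_add' u v := by ext <;> simp
  map_smul' r u := by ext <;> simp
  left_inv u := by ext <;> simp
  right_inv u := by ext <;> simp

end Magic

end MagicSquare

end

open scoped TensorProduct

noncomputable section

attribute [local instance 100] LieRing.ofAssociativeRing

namespace MagicSquare

/-! ### Alternativity and the symmetric composition product -/

section Composition

variable {K : Type*} [NonAssocRing K] [Module ℝ K] [CompositionAlgebra K]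

/-! Write x∘y for the conjugate of xy (`para`). The composition law makes ∘ a symmetric composition:
(x∘z)∘y + (y∘z)∘x = 2⟨x,y⟩z, the mirror identity, and ⟨x∘y,z⟩ = ⟨x,y∘z⟩. In the components T_0, T_1,
T_2 of `Tri.comp` the triality relation reads T_i(x∘y) = T_{i+1}x∘y + x∘T_{i+2}y for every i modulo
3, θ is a shift of the index, and the third bracket of the theorem is [F_i(u), F_{i+1}(v)] =
F_{i+2}(u∘v), with ∘ taken factorwise. Everything is thus cyclic in i.

The stated brackets define a Lie algebra by themselves. Jacobi splits into homogeneous cases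
(`gradedBracket_jacobi`), and each case is an identity for ∘; the decisive ones are
`triTL_para_cyclic`, `act_selfT_cyclic` and `act_selfT_one`.

The Tits algebra is matched with it by an explicit map `titsMap`. An element T of Tri K₁ is the same
as a derivation D and imaginary b_0, b_1, b_2 of sum zero, through T_i = D + L_{b_{i+1}} -
R_{b_{i+2}} (`triDer_aux`); it goes to D + Σ b_j ⊗ e_j, where e_j are the diagonal idempotents. Tri
K₂ goes to the derivations of H₃(K₂) that kill all e_j (`exists_triDerH_eq`). F_i(x₁ ⊗ x₂) goes to
-(Re x₁ [L_{e_{i+1}}, L_{P_i(x₂)}] + Im x₁ ⊗ P_i(x₂)), where P_i(x₂) is the off-diagonal hermitian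
matrix. Every derivation of H₃(K₂) is a sum of the two kinds occurring here
(`exists_offDer_add_triDerH`), which gives bijectivity. The brackets are compared on generators.

Skewness and the listed brackets determine the whole bracket (`bilin_ext`), so any decomposition
carries the Tits bracket to the triality bracket. Jacobi for the Tits bracket is transported back
from the triality side, and the symmetry in K₁ and K₂ holds because the triality bracket treats the
two factors alike. Neither the classification of composition algebras nor the Jordan identity for
H₃(K₂) is used. -/

theorem re_apply (x : K) : re x = ip K x 1 := rfl

theorem conj_one : conj (1 : K) = 1 := by
  rw [conj_apply, ip_one]
  module

theorem re_one : re (1 : K) = 1 := ip_one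

theorem re_conj (x : K) : re (conj x) = re x := by
  rw [re_apply, ip_conj_left, conj_one, re_apply]

theorem conj_eq_neg {x : K} (hx : re x = 0) : conj x = -x := by
  rw [conj_apply, ← re_apply, hx]
  simp

/-- Linearised left alternative law: expand x̄ and ȳ in `conj_mul_add` and subtract its case z = 1
multiplied by z. -/
theorem mul_add_mul_comm_mul (x y z : K) :
    x * (y * z) + y * (x * z) = (x * y + y * x) * z := by
  have h := conj_mul_add x y z
  have h1 := conj_mul_add x y 1
  simp only [mul_one, conj_apply, sub_mul, mul_sub, smul_mul_assoc, mul_smul_comm, one_mul]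
    at h h1
  have h2 := congrArg (· * z) h1
  simp only [sub_mul, add_mul, smul_mul_assoc, one_mul] at h2
  rw [add_mul]
  linear_combination (norm := module) h2 - h

theorem mul_mul_add_mul_mul (x y z : K) :
    (z * x) * y + (z * y) * x = z * (x * y + y * x) := by
  have h := congrArg conj (mul_add_mul_comm_mul (conj x) (conj y) (conj z))
  simpa [conj_mul, conj_conj, add_comm] using h

/-- Polarised form of the quadratic equation x² - 2(Re x)x + |x|² = 0. -/
theorem mul_add_mul_swap (x y : K) :
    x * y + y * x = (2 * re x) • y + (2 * re y) • x - (2 * ip K x y) • 1 := by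
  have h := conj_mul_add x y 1
  simp only [mul_one, conj_apply, mul_sub, mul_smul_comm] at h
  rw [re_apply, re_apply]
  linear_combination (norm := module) -h

variable (K) in
/-- The symmetric composition (para-Hurwitz) product, the conjugate of `x y`. -/
def para : K →ₗ[ℝ] K →ₗ[ℝ] K := (LinearMap.mul ℝ K).compr₂ conj

theorem para_apply (x y : K) : para K x y = conj (x * y) := rfl

/-- Together with its mirror image and `ip_para`, this is all that the Jacobi identity of the
triality bracket uses about the product. -/
theorem para_para_left (x y z : K) :
    para K (para K x z) y + para K (para K y z) x = (2 * ip K x y) • z := by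
  have h := conj_mul_add (conj y) (conj x) z
  rw [ip_conj, ip_comm] at h
  simpa only [para_apply, conj_mul _ y, conj_mul _ x, conj_conj] using h

theorem para_para_right (x y z : K) :
    para K x (para K z y) + para K y (para K z x) = (2 * ip K x y) • z := by
  have h := mul_conj_add (conj y) (conj x) z
  rw [ip_conj, ip_comm] at h
  simpa only [para_apply, conj_mul y, conj_mul x, conj_conj] using h

theorem ip_para (x y z : K) : ip K (para K x y) z = ip K x (para K y z) := by
  rw [para_apply, para_apply, ip_conj_left, ip_mul_right, conj_mul]

theorem ip_para_cyclic (x y z : K) : ip K (para K x y) z = ip K (para K y z) x := by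
  rw [ip_para, ip_comm]

theorem para_one_left (x : K) : para K 1 x = conj x := by rw [para_apply, one_mul]

theorem para_one_right (x : K) : para K x 1 = conj x := by rw [para_apply, mul_one]

/-! ### Components of elements of the triality algebra -/

/-! Shortcut instances, which keep instance search on the triality algebra fast. -/

abbrev triLieRing : LieRing (Tri K) := inferInstance

attribute [local instance] triLieRing

abbrev triAddCommGroup : AddCommGroup (Tri K) := inferInstance

attribute [local instance] triAddCommGroup

abbrev triAddCommMonoid : AddCommMonoid (Tri K) := inferInstance

attribute [local instance] triAddCommMonoid

abbrev triModule : Module ℝ (Tri K) := inferInstance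

attribute [local instance] triModule

abbrev triLieAlgebra : LieAlgebra ℝ (Tri K) := inferInstance

attribute [local instance] triLieAlgebra

abbrev triSMul : SMul ℝ (Tri K) := Module.toDistribMulAction.toSMul

attribute [local instance] triSMul

/-! ### Index arithmetic modulo 3, and components of triality elements -/

theorem fin3_cases (i j : Fin 3) : j = i ∨ j = i + 1 ∨ j = i + 2 := by
  revert i j; decide

theorem fin3_one_one (i : Fin 3) : i + 1 + 1 = i + 2 := by revert i; decide
theorem fin3_one_two (i : Fin 3) : i + 1 + 2 = i := by revert i; decide
theorem fin3_two_one (i : Fin 3) : i + 2 + 1 = i := by revert i; decide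
theorem fin3_two_two (i : Fin 3) : i + 2 + 2 = i + 1 := by revert i; decide
theorem fin3_add_one_ne (i : Fin 3) : i + 1 ≠ i := by revert i; decide
theorem fin3_add_two_ne (i : Fin 3) : i + 2 ≠ i := by revert i; decide
theorem fin3_one_ne_two (i : Fin 3) : i + 1 ≠ i + 2 := by revert i; decide

theorem fin3_sum {M : Type*} [AddCommMonoid M] (f : Fin 3 → M) (i : Fin 3) :
    ∑ j, f j = f i + f (i + 1) + f (i + 2) := by
  fin_cases i <;> simp only [Fin.sum_univ_three]
  · rfl
  · change f 0 + f 1 + f 2 = f 1 + f 2 + f 0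
    abel
  · change f 0 + f 1 + f 2 = f 2 + f 0 + f 1
    abel

theorem Tri.ext_comp {S T : Tri K} (h : ∀ i, Tri.comp S i = Tri.comp T i) : S = T := by
  have h1 : bar S.1.2.1 = bar T.1.2.1 := h 1
  have h2 : bar S.1.2.2 = bar T.1.2.2 := h 2
  refine Subtype.ext (Prod.ext (h 0) (Prod.ext ?_ ?_))
  · rw [← bar_bar S.1.2.1, h1, bar_bar]
  · rw [← bar_bar S.1.2.2, h2, bar_bar]

theorem bar_mul (A B : Module.End ℝ K) : bar (A * B) = bar A * bar B := by
  ext x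
  simp [conj_conj]

theorem bar_lie (A B : Module.End ℝ K) : bar ⁅A, B⁆ = ⁅bar A, bar B⁆ := by
  rw [Ring.lie_def, Ring.lie_def, map_sub, bar_mul, bar_mul]

theorem Tri.comp_add (S T : Tri K) (i : Fin 3) :
    Tri.comp (S + T) i = Tri.comp S i + Tri.comp T i := by
  fin_cases i <;> simp [Tri.comp]

theorem Tri.comp_smul (r : ℝ) (T : Tri K) (i : Fin 3) :
    Tri.comp (r • T) i = r • Tri.comp T i := by
  fin_cases i <;> simp [Tri.comp]

theorem Tri.comp_lie (S T : Tri K) (i : Fin 3) :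
    Tri.comp ⁅S, T⁆ i = ⁅Tri.comp S i, Tri.comp T i⁆ := by
  fin_cases i
  · rfl
  · exact bar_lie _ _
  · exact bar_lie _ _

variable (K) in
/-- The `i`-th component of an element of the triality algebra, as a linear map. -/
def compL (i : Fin 3) : Tri K →ₗ[ℝ] Module.End ℝ K where
  toFun T := Tri.comp T i
  map_add' S T := Tri.comp_add S T i
  map_smul' r T := Tri.comp_smul r T i

theorem compL_apply (T : Tri K) (i : Fin 3) : compL K i T = Tri.comp T i := rfl

/-- The bars in T = (T₁, T̄₂, T̄₃) are chosen so that θ becomes the cyclic shift of the components.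
-/
theorem Tri.comp_theta (T : Tri K) (i : Fin 3) : Tri.comp (theta K T) i = Tri.comp T (i + 1) := by
  fin_cases i
  · rfl
  · rfl
  · exact bar_bar _

theorem Tri.comp_theta_symm (T : Tri K) (i : Fin 3) :
    Tri.comp ((theta K).symm T) (i + 1) = Tri.comp T i := by
  rw [← Tri.comp_theta, LinearEquiv.apply_symm_apply]

/-- `θ^{-i}` as it occurs in the brackets of the triality construction. -/
theorem Tri.comp_theta_zpow (T : Tri K) (i j : Fin 3) :
    Tri.comp ((theta K ^ (-(i.val : ℤ))) T) (j + i) = Tri.comp T j := by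
  have h : ∀ (n : ℕ) (j : Fin 3),
      Tri.comp ((theta K ^ (-(n : ℤ))) T) (j + Fin.ofNat 3 n) = Tri.comp T j := by
    intro n
    induction n with
    | zero => intro j; simp [Fin.ofNat]
    | succ n ih =>
      intro j
      have e : theta K ^ (-((n + 1 : ℕ) : ℤ)) = (theta K)⁻¹ * theta K ^ (-(n : ℤ)) := by
        rw [← zpow_neg_one, ← zpow_add]
        congr 1
        push_cast
        ring
      have e' : j + Fin.ofNat 3 (n + 1) = j + Fin.ofNat 3 n + 1 := by
        ext
        simp [Fin.val_add, Fin.ofNat]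
        omega
      rw [e, ← ih j, e']
      exact Tri.comp_theta_symm _ _
  have := h i.val j
  rwa [Fin.ofNat_val_eq_self] at this

theorem Tri.comp_mem_so (T : Tri K) (i : Fin 3) : Tri.comp T i ∈ so K := by
  obtain ⟨h1, h2, h3, -⟩ := T.2
  fin_cases i
  · exact h1
  · exact bar_mem_so h2
  · exact bar_mem_so h3

theorem Tri.ip_comp (T : Tri K) (i : Fin 3) (x y : K) :
    ip K (Tri.comp T i x) y = -ip K x (Tri.comp T i y) :=
  mem_so.1 (Tri.comp_mem_so T i) x y

/-- The defining relation of the triality algebra at the pair (ȳ, x̄). -/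
theorem Tri.comp_zero_para (T : Tri K) (x y : K) :
    Tri.comp T 0 (para K x y) = para K (Tri.comp T 1 x) y + para K x (Tri.comp T 2 y) := by
  obtain ⟨-, -, -, h⟩ := T.2
  change T.1.1 (conj (x * y)) = conj (conj (T.1.2.1 (conj x)) * y)
    + conj (x * conj (T.1.2.2 (conj y)))
  rw [conj_mul, h, conj_mul, conj_mul, conj_conj, conj_conj]

/-- The case i = 0 applied to T, θT and θ²T: stability of the triality algebra under θ supplies the
other two relations. -/
theorem Tri.comp_para (T : Tri K) (i : Fin 3) (x y : K) :
    Tri.comp T i (para K x y)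
      = para K (Tri.comp T (i + 1) x) y + para K x (Tri.comp T (i + 2) y) := by
  fin_cases i
  · exact Tri.comp_zero_para T x y
  · have := Tri.comp_zero_para (theta K T) x y
    rw [Tri.comp_theta, Tri.comp_theta, Tri.comp_theta] at this
    exact this
  · have := Tri.comp_zero_para (theta K (theta K T)) x y
    simp only [Tri.comp_theta] at this
    exact this

/-- A triple of skew maps satisfying the triality relation for the product `para` determines an
element of the triality algebra. -/
def Tri.ofComp (t : Fin 3 → Module.End ℝ K) (hs : ∀ i, t i ∈ so K)
    (h : ∀ x y, t 0 (para K x y) = para K (t 1 x) y + para K x (t 2 y)) : Tri K :=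
  ⟨(t 0, bar (t 1), bar (t 2)), hs 0, bar_mem_so (hs 1), bar_mem_so (hs 2), fun x y => by
    have := h (conj y) (conj x)
    simp only [para_apply, conj_mul, conj_conj] at this
    exact this⟩

theorem Tri.comp_ofComp (t : Fin 3 → Module.End ℝ K) (hs : ∀ i, t i ∈ so K)
    (h : ∀ x y, t 0 (para K x y) = para K (t 1 x) y + para K x (t 2 y)) (i : Fin 3) :
    Tri.comp (Tri.ofComp t hs h) i = t i := by
  fin_cases i
  · rfl
  · exact bar_bar _
  · exact bar_bar _

/-! ### The elements `θ^{-i} T_{x,y}` -/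

variable (K) in
/-- The bilinear map `(x, y) ↦ θ^{-i} T_{x,y}`. -/
def triTL (i : Fin 3) : K →ₗ[ℝ] K →ₗ[ℝ] Tri K :=
  LinearMap.mk₂ ℝ (fun x y => (theta K ^ (-(i.val : ℤ))) (triT x y))
    (fun x x' y => by
      rw [← map_add]
      congr 1
      refine Subtype.ext (Prod.ext ?_ (Prod.ext ?_ ?_)) <;> ext z <;>
        simp [triT, tripleT, S, add_mul, mul_add, add_smul, smul_sub, smul_add] <;> abel)
    (fun r x y => by
      rw [← map_smul]
      congr 1
      refine Subtype.ext (Prod.ext ?_ (Prod.ext ?_ ?_)) <;> ext z <;>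
        simp [triT, tripleT, S, smul_sub, smul_smul, mul_smul_comm, smul_mul_assoc, mul_left_comm,
          mul_comm, mul_assoc])
    (fun x x' y => by
      rw [← map_add]
      congr 1
      refine Subtype.ext (Prod.ext ?_ (Prod.ext ?_ ?_)) <;> ext z <;>
        simp [triT, tripleT, S, add_mul, mul_add, add_smul, smul_sub, smul_add] <;> abel)
    (fun r x y => by
      rw [← map_smul]
      congr 1
      refine Subtype.ext (Prod.ext ?_ (Prod.ext ?_ ?_)) <;> ext z <;>
        simp [triT, tripleT, S, smul_sub, smul_smul, mul_smul_comm, smul_mul_assoc, mul_left_comm,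
          mul_comm, mul_assoc])

theorem triTL_apply (i : Fin 3) (x y : K) :
    triTL K i x y = (theta K ^ (-(i.val : ℤ))) (triT x y) := rfl

theorem comp_triTL_self (i : Fin 3) (x y z : K) :
    Tri.comp (triTL K i x y) i z = (4 * ip K x z) • y - (4 * ip K y z) • x := by
  have h := Tri.comp_theta_zpow (triT x y) i 0
  rw [zero_add] at h
  rw [triTL_apply, h]
  change (4 : ℝ) • (ip K x z • y - ip K y z • x) = _
  module

theorem comp_triTL_one (i : Fin 3) (x y z : K) :
    Tri.comp (triTL K i x y) (i + 1) z
      = para K (para K x z) y - para K (para K y z) x := by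
  have h := Tri.comp_theta_zpow (triT x y) i 1
  rw [add_comm] at h
  rw [triTL_apply, h]
  change conj ((conj z * conj x) * y - (conj z * conj y) * x) = _
  simp only [map_sub, para_apply, conj_mul, conj_conj]

theorem comp_triTL_two (i : Fin 3) (x y z : K) :
    Tri.comp (triTL K i x y) (i + 2) z
      = para K y (para K z x) - para K x (para K z y) := by
  have h := Tri.comp_theta_zpow (triT x y) i 2
  rw [add_comm] at h
  rw [triTL_apply, h]
  change conj (y * (conj x * conj z) - x * (conj y * conj z)) = _
  simp only [map_sub, para_apply, conj_mul, conj_conj]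

theorem triTL_self (i : Fin 3) (x : K) : triTL K i x x = 0 := by
  refine Tri.ext_comp fun j => LinearMap.ext fun z => ?_
  have h0 : Tri.comp (0 : Tri K) j = 0 := (compL K j).map_zero
  rw [h0, LinearMap.zero_apply]
  obtain rfl | rfl | rfl := fin3_cases i j
  · rw [comp_triTL_self, sub_self]
  · rw [comp_triTL_one, sub_self]
  · rw [comp_triTL_two, sub_self]

theorem triTL_swap (i : Fin 3) (x y : K) : triTL K i x y = -triTL K i y x := by
  have h := triTL_self i (x + y)
  simp only [map_add, LinearMap.add_apply, triTL_self, zero_add, add_zero] at h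
  exact eq_neg_of_add_eq_zero_right h

/-- Each component of θ^{-i}T_{x,y} is built from the form and the product ∘, and T preserves both
infinitesimally. -/
theorem lie_triTL (T : Tri K) (i : Fin 3) (x y : K) :
    ⁅T, triTL K i x y⁆ = triTL K i (Tri.comp T i x) y + triTL K i x (Tri.comp T i y) := by
  refine Tri.ext_comp fun j => LinearMap.ext fun z => ?_
  rw [Tri.comp_lie, Tri.comp_add, Ring.lie_def, LinearMap.sub_apply, LinearMap.add_apply,
    Module.End.mul_apply, Module.End.mul_apply]
  obtain rfl | rfl | rfl := fin3_cases i j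
  · simp only [comp_triTL_self, map_sub, map_smul, Tri.ip_comp]
    module
  · have h : ∀ u v, Tri.comp T (i + 1) (para K u v) = para K (Tri.comp T (i + 2) u) v
        + para K u (Tri.comp T i v) := fun u v => by
      rw [Tri.comp_para, fin3_one_one, fin3_one_two]
    have h' : ∀ u v, Tri.comp T (i + 2) (para K u v) = para K (Tri.comp T i u) v
        + para K u (Tri.comp T (i + 1) v) := fun u v => by
      rw [Tri.comp_para, fin3_two_one, fin3_two_two]
    simp only [comp_triTL_one, map_sub, map_add, LinearMap.add_apply, h, h']
    abel
  · have h : ∀ u v, Tri.comp T (i + 1) (para K u v) = para K (Tri.comp T (i + 2) u) v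
        + para K u (Tri.comp T i v) := fun u v => by
      rw [Tri.comp_para, fin3_one_one, fin3_one_two]
    have h' : ∀ u v, Tri.comp T (i + 2) (para K u v) = para K (Tri.comp T i u) v
        + para K u (Tri.comp T (i + 1) v) := fun u v => by
      rw [Tri.comp_para, fin3_two_one, fin3_two_two]
    simp only [comp_triTL_two, map_sub, map_add, h, h']
    abel

/-- This becomes the Jacobi identity for one element from each of the three copies of K₁ ⊗ K₂. The
sum is unchanged by the shift (i, x, y, z) ↦ (i+1, y, z, x), so only its i-th component has to be
computed. -/
theorem triTL_para_cyclic (i : Fin 3) (x y z : K) :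
    triTL K i (para K x y) z + triTL K (i + 1) (para K y z) x + triTL K (i + 2) (para K z x) y
      = 0 := by
  have key : ∀ (i : Fin 3) (x y z w : K), Tri.comp (triTL K i (para K x y) z
      + triTL K (i + 1) (para K y z) x + triTL K (i + 2) (para K z x) y) i w = 0 := by
    intro i x y z w
    have h1 := comp_triTL_two (i + 1) (para K y z) x w
    have h2 := comp_triTL_one (i + 2) (para K z x) y w
    rw [fin3_one_two] at h1
    rw [fin3_two_one] at h2
    rw [Tri.comp_add, Tri.comp_add, LinearMap.add_apply, LinearMap.add_apply, comp_triTL_self,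
      h1, h2]
    -- The right sides of `a1` and `a2` are equal because ⟨y∘z,x⟩ = ⟨y,z∘x⟩. Their difference turns
    -- the non-scalar terms into twice ((z∘x)∘w)∘y - (y∘z)∘(w∘x), and `a3`, `a4` evaluate this by
    -- passing through ((w∘x)∘z)∘y.
    have a1 := para_para_right (para K y z) x w
    have a2 := para_para_left y (para K z x) w
    have a3 := para_para_left y (para K w x) z
    have a4 := congrArg (para K · y) (para_para_left w z x)
    simp only [map_add, map_smul, LinearMap.add_apply, LinearMap.smul_apply] at a4
    rw [ip_para] at a1
    rw [ip_para_cyclic x y w, ip_para, ip_comm z w]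
    linear_combination (norm := module) a1 - a2 - (2 : ℝ) • a3 + (2 : ℝ) • a4
  refine Tri.ext_comp fun j => LinearMap.ext fun w => ?_
  have h0 : Tri.comp (0 : Tri K) j = 0 := (compL K j).map_zero
  rw [h0, LinearMap.zero_apply]
  obtain rfl | rfl | rfl := fin3_cases i j
  · exact key _ _ _ _ _
  · have := key (i + 1) y z x w
    rw [fin3_one_one, fin3_one_two] at this
    rwa [add_assoc, add_comm]
  · have := key (i + 2) z x y w
    rw [fin3_two_one, fin3_two_two] at this
    rwa [add_comm, ← add_assoc]

end Composition

attribute [local instance] triLieRing triAddCommGroup triAddCommMonoid triModule triLieAlgebra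
  triSMul

/-! ### A bracket on the sum of a Lie algebra and three copies of a module -/

section GradedBracket

variable {𝔤 M : Type*} [LieRing 𝔤] [LieAlgebra ℝ 𝔤] [AddCommGroup M] [Module ℝ M]
  (ρ : Fin 3 → 𝔤 →ₗ[ℝ] Module.End ℝ M) (m : M →ₗ[ℝ] M →ₗ[ℝ] M)
  (b : Fin 3 → M →ₗ[ℝ] M →ₗ[ℝ] 𝔤)

/-- The bracket on `𝔤 ∔ 3 M` determined by actions `ρ i` of `𝔤` on the copies of `M`, products `m`
of different copies and products `b i` of the copies with themselves. -/
def gradedBracket : (𝔤 × (Fin 3 → M)) →ₗ[ℝ] (𝔤 × (Fin 3 → M)) →ₗ[ℝ] (𝔤 × (Fin 3 → M)) :=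
  LinearMap.mk₂ ℝ
    (fun u v => (⁅u.1, v.1⁆ + ∑ i, b i (u.2 i) (v.2 i), fun i => ρ i u.1 (v.2 i) - ρ i v.1 (u.2 i)
      + (m (u.2 (i + 1)) (v.2 (i + 2)) - m (v.2 (i + 1)) (u.2 (i + 2)))))
    (by
      intro u u' v
      refine Prod.ext ?_ (funext fun i => ?_)
      · simp only [add_lie, Prod.snd_add, Pi.add_apply, map_add,
          LinearMap.add_apply, Finset.sum_add_distrib, Prod.fst_add]
        abel
      · simp only [Prod.snd_add, Pi.add_apply, map_add, LinearMap.add_apply, Prod.fst_add]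
        abel)
    (by
      intro r u v
      refine Prod.ext ?_ (funext fun i => ?_)
      · simp [Finset.smul_sum]
      · simp [smul_sub])
    (by
      intro v u u'
      refine Prod.ext ?_ (funext fun i => ?_)
      · simp only [lie_add, Prod.snd_add, Pi.add_apply, map_add,
          Finset.sum_add_distrib, Prod.fst_add]
        abel
      · simp only [Prod.snd_add, Pi.add_apply, map_add, LinearMap.add_apply, Prod.fst_add]
        abel)
    (by
      intro r v u
      refine Prod.ext ?_ (funext fun i => ?_)
      · simp [Finset.smul_sum]
      · simp [smul_sub])

theorem gradedBracket_apply (u v : 𝔤 × (Fin 3 → M)) :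
    gradedBracket ρ m b u v
      = (⁅u.1, v.1⁆ + ∑ i, b i (u.2 i) (v.2 i), fun i => ρ i u.1 (v.2 i) - ρ i v.1 (u.2 i)
      + (m (u.2 (i + 1)) (v.2 (i + 2)) - m (v.2 (i + 1)) (u.2 (i + 2)))) := rfl

variable {b} in
theorem gradedBracket_self (hb : ∀ i u, b i u u = 0) (u : 𝔤 × (Fin 3 → M)) :
    gradedBracket ρ m b u u = 0 := by
  refine Prod.ext ?_ (funext fun i => ?_)
  · simp [gradedBracket_apply, hb]
  · simp [gradedBracket_apply]

variable {ρ m b}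

/-- The hypotheses are the homogeneous cases of the Jacobi identity outside 𝔤 itself: `hρ` and `hm`,
`hρb` for at least one entry in 𝔤, `hb0` for three entries in one copy of M, `hb1` and `hb2` for two
in one copy and one in another, `hmb` for one in each copy. -/
theorem gradedBracket_jacobi
    (hρ : ∀ i g h u, ρ i ⁅g, h⁆ u = ρ i g (ρ i h u) - ρ i h (ρ i g u))
    (hm : ∀ i g u v, ρ i g (m u v) = m (ρ (i + 1) g u) v + m u (ρ (i + 2) g v))
    (hρb : ∀ i g u v, ⁅g, b i u v⁆ = b i (ρ i g u) v + b i u (ρ i g v))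
    (hb : ∀ i u v, b i u v = -b i v u)
    (hb0 : ∀ i u v w, ρ i (b i u v) w + ρ i (b i v w) u + ρ i (b i w u) v = 0)
    (hb1 : ∀ i u v w, ρ (i + 1) (b i u v) w = m (m u w) v - m (m v w) u)
    (hb2 : ∀ i u v w, ρ (i + 2) (b i u v) w = m v (m w u) - m u (m w v))
    (hmb : ∀ i u v w, b i (m u v) w + b (i + 1) (m v w) u + b (i + 2) (m w u) v = 0)
    (u v w : 𝔤 × (Fin 3 → M)) :
    gradedBracket ρ m b (gradedBracket ρ m b u v) w
      + gradedBracket ρ m b (gradedBracket ρ m b v w) u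
      + gradedBracket ρ m b (gradedBracket ρ m b w u) v = 0 := by
  obtain ⟨g, u⟩ := u
  obtain ⟨h, v⟩ := v
  obtain ⟨k, w⟩ := w
  refine Prod.ext ?_ (funext fun i => ?_)
  · have hl : ∀ (g : 𝔤) (i : Fin 3) (u v : M), ⁅b i u v, g⁆
        = -(b i (ρ i g u) v + b i u (ρ i g v)) := fun g i u v => by
      rw [← hρb, lie_skew]
    have hJ : ⁅⁅g, h⁆, k⁆ + ⁅⁅h, k⁆, g⁆ + ⁅⁅k, g⁆, h⁆ = 0 := by
      rw [← lie_skew ⁅g, h⁆ k, ← lie_skew ⁅h, k⁆ g, ← lie_skew ⁅k, g⁆ h, ← neg_add, ← neg_add,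
        neg_eq_zero, ← lie_jacobi g h k]
      abel
    -- The nine terms group into three instances of `hmb`. The 𝔤-component of Jacobi contains both
    -- orientations of the triple, hence the two uses of `hc` with opposite signs.
    have hc : ∀ u v w : Fin 3 → M,
        ∑ i, b i (m (u (i + 1)) (v (i + 2))) (w i)
          + ∑ i, b i (m (v (i + 1)) (w (i + 2))) (u i)
          + ∑ i, b i (m (w (i + 1)) (u (i + 2))) (v i) = 0 := by
      intro u v w
      have h0 := hmb 0 (u 1) (v 2) (w 0)
      have h1 := hmb 0 (v 1) (w 2) (u 0)
      have h2 := hmb 0 (w 1) (u 2) (v 0)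
      simp only [Fin.sum_univ_three]
      have e1 : (0 : Fin 3) + 1 = 1 := rfl
      have e2 : (0 : Fin 3) + 2 = 2 := rfl
      have e3 : (1 : Fin 3) + 1 = 2 := rfl
      have e4 : (1 : Fin 3) + 2 = 0 := rfl
      have e5 : (2 : Fin 3) + 1 = 0 := rfl
      have e6 : (2 : Fin 3) + 2 = 1 := rfl
      simp only [e1, e2, e3, e4, e5, e6] at h0 h1 h2 ⊢
      linear_combination (norm := abel) h0 + h1 + h2
    have hs : ∀ (g : 𝔤) (u v : Fin 3 → M),
        ∑ i, b i (ρ i g (u i)) (v i) = -∑ i, b i (v i) (ρ i g (u i)) := by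
      intro g u v
      rw [← Finset.sum_neg_distrib]
      exact Finset.sum_congr rfl fun i _ => hb _ _ _
    have h1 := hc u v w
    have h2 := hc v u w
    simp only [gradedBracket_apply, Prod.fst_add, Prod.fst_zero, add_lie, sum_lie, hl, map_add,
      map_sub, LinearMap.add_apply, LinearMap.sub_apply, Finset.sum_add_distrib,
      Finset.sum_sub_distrib, Finset.sum_neg_distrib, hs]
    linear_combination (norm := abel) hJ + h1 - h2
  · have h5 := hb0 i (u i) (v i) (w i)
    have h6 : ∀ x y z, ρ i (b (i + 2) x y) z
        = (m (m x z) y - m (m y z) x : M) := fun x y z => by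
      have := hb1 (i + 2) x y z
      rwa [fin3_two_one] at this
    have h7 : ∀ x y z, ρ i (b (i + 1) x y) z
        = (m y (m z x) - m x (m z y) : M) := fun x y z => by
      have := hb2 (i + 1) x y z
      rwa [fin3_one_two] at this
    simp only [gradedBracket_apply, Prod.snd_add, Prod.snd_zero, Pi.add_apply, Pi.zero_apply,
      map_add, map_sub, LinearMap.add_apply, LinearMap.sub_apply, hρ, hm,
      fin3_sum _ i, h6, h7, fin3_one_one, fin3_one_two, fin3_two_one, fin3_two_two]
    linear_combination (norm := abel) h5

theorem eq_zero_of_eq_neg_self {V : Type*} [AddCommGroup V] [Module ℝ V] {x : V} (h : x = -x) :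
    x = 0 := by
  rw [eq_neg_iff_add_eq_zero, ← two_smul ℝ] at h
  exact (smul_eq_zero.mp h).resolve_left two_ne_zero

theorem self_of_conj {V W : Type*} [AddCommMonoid V] [Module ℝ V] [AddCommMonoid W] [Module ℝ W]
    {β : V →ₗ[ℝ] V →ₗ[ℝ] V} (h : ∀ u, β u u = 0) (e : V ≃ₗ[ℝ] W) {γ : W →ₗ[ℝ] W →ₗ[ℝ] W}
    (hγ : γ = (β.compl₁₂ e.symm.toLinearMap e.symm.toLinearMap).compr₂ e.toLinearMap) (u : W) :
    γ u u = 0 := by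
  simp [hγ, h]

theorem jacobi_of_conj {V W : Type*} [AddCommMonoid V] [Module ℝ V] [AddCommMonoid W]
    [Module ℝ W] {β : V →ₗ[ℝ] V →ₗ[ℝ] V}
    (h : ∀ u v w, β (β u v) w + β (β v w) u + β (β w u) v = 0)
    (e : V ≃ₗ[ℝ] W) {γ : W →ₗ[ℝ] W →ₗ[ℝ] W}
    (hγ : γ = (β.compl₁₂ e.symm.toLinearMap e.symm.toLinearMap).compr₂ e.toLinearMap)
    (u v w : W) : γ (γ u v) w + γ (γ v w) u + γ (γ w u) v = 0 := by
  simp [hγ, ← map_add, h]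

end GradedBracket

/-! ### The graded bracket for a direct sum of two Lie algebras -/

section BiGradedBracket

variable {𝔤₁ 𝔤₂ M : Type*} [LieRing 𝔤₁] [LieAlgebra ℝ 𝔤₁] [LieRing 𝔤₂] [LieAlgebra ℝ 𝔤₂]
  [AddCommMonoid M] [Module ℝ M]

/-- The bracket `gradedBracket` on `𝔤₁ ∔ 𝔤₂ ∔ 3 M`, for the direct sum of two Lie algebras. The
module `M` is only given as an additive monoid, since this is how tensor products occur. -/
def biGradedBracket (ρ : Fin 3 → (𝔤₁ × 𝔤₂) →ₗ[ℝ] Module.End ℝ M) (m : M →ₗ[ℝ] M →ₗ[ℝ] M)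
    (b : Fin 3 → M →ₗ[ℝ] M →ₗ[ℝ] (𝔤₁ × 𝔤₂)) :
    (𝔤₁ × 𝔤₂ × (Fin 3 → M)) →ₗ[ℝ] (𝔤₁ × 𝔤₂ × (Fin 3 → M)) →ₗ[ℝ] (𝔤₁ × 𝔤₂ × (Fin 3 → M)) :=
  letI : AddCommGroup M := Module.addCommMonoidToAddCommGroup ℝ
  ((gradedBracket ρ m b).compl₁₂
    (LinearEquiv.prodAssoc ℝ 𝔤₁ 𝔤₂ (Fin 3 → M)).symm.toLinearMap
    (LinearEquiv.prodAssoc ℝ 𝔤₁ 𝔤₂ (Fin 3 → M)).symm.toLinearMap).compr₂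
    (LinearEquiv.prodAssoc ℝ 𝔤₁ 𝔤₂ (Fin 3 → M)).toLinearMap

variable {ρ : Fin 3 → (𝔤₁ × 𝔤₂) →ₗ[ℝ] Module.End ℝ M} {m : M →ₗ[ℝ] M →ₗ[ℝ] M}
    {b : Fin 3 → M →ₗ[ℝ] M →ₗ[ℝ] (𝔤₁ × 𝔤₂)}

theorem biGradedBracket_apply (u v : 𝔤₁ × 𝔤₂ × (Fin 3 → M)) :
    biGradedBracket ρ m b u v
      = (⁅u.1, v.1⁆ + ∑ i, (b i (u.2.2 i) (v.2.2 i)).1,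
        ⁅u.2.1, v.2.1⁆ + ∑ i, (b i (u.2.2 i) (v.2.2 i)).2,
        fun i => (ρ i (u.1, u.2.1) (v.2.2 i) + (-1 : ℝ) • ρ i (v.1, v.2.1) (u.2.2 i))
          + (m (u.2.2 (i + 1)) (v.2.2 (i + 2))
            + (-1 : ℝ) • m (v.2.2 (i + 1)) (u.2.2 (i + 2)))) := by
  rw [← Prod.fst_sum, ← Prod.snd_sum]
  let _ : AddCommGroup M := Module.addCommMonoidToAddCommGroup ℝ
  simp only [neg_smul, one_smul, ← sub_eq_add_neg]
  rfl

theorem biGradedBracket_self (hb : ∀ i u, b i u u = 0) (u : 𝔤₁ × 𝔤₂ × (Fin 3 → M)) :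
    biGradedBracket ρ m b u u = 0 :=
  letI : AddCommGroup M := Module.addCommMonoidToAddCommGroup ℝ
  self_of_conj (gradedBracket_self ρ m hb) _ rfl u

/-- The hypotheses of `gradedBracket_jacobi` with each difference in M moved across the equation,
since M carries no chosen subtraction here. -/
theorem biGradedBracket_jacobi
    (hρ : ∀ i (g h : 𝔤₁ × 𝔤₂) u,
      ρ i (⁅g.1, h.1⁆, ⁅g.2, h.2⁆) u + ρ i h (ρ i g u) = ρ i g (ρ i h u))
    (hm : ∀ i g u v, ρ i g (m u v) = m (ρ (i + 1) g u) v + m u (ρ (i + 2) g v))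
    (hρb : ∀ i (g : 𝔤₁ × 𝔤₂) u v, (⁅g.1, (b i u v).1⁆, ⁅g.2, (b i u v).2⁆)
      = b i (ρ i g u) v + b i u (ρ i g v))
    (hb : ∀ i u v, b i u v = -b i v u)
    (hb0 : ∀ i u v w, ρ i (b i u v) w + ρ i (b i v w) u + ρ i (b i w u) v = 0)
    (hb1 : ∀ i u v w, ρ (i + 1) (b i u v) w + m (m v w) u = m (m u w) v)
    (hb2 : ∀ i u v w, ρ (i + 2) (b i u v) w + m u (m w v) = m v (m w u))
    (hmb : ∀ i u v w, b i (m u v) w + b (i + 1) (m v w) u + b (i + 2) (m w u) v = 0)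
    (u v w : 𝔤₁ × 𝔤₂ × (Fin 3 → M)) :
    biGradedBracket ρ m b (biGradedBracket ρ m b u v) w
      + biGradedBracket ρ m b (biGradedBracket ρ m b v w) u
      + biGradedBracket ρ m b (biGradedBracket ρ m b w u) v = 0 :=
  letI : AddCommGroup M := Module.addCommMonoidToAddCommGroup ℝ
  jacobi_of_conj (gradedBracket_jacobi (ρ := ρ) (m := m) (b := b)
    (fun i g h u => eq_sub_of_add_eq (hρ i g h u)) hm hρb hb hb0
    (fun i u v w => eq_sub_of_add_eq (hb1 i u v w))
    (fun i u v w => eq_sub_of_add_eq (hb2 i u v w)) hmb)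
    _ rfl u v w

end BiGradedBracket

/-! ### The Lie algebra structure of the triality construction -/

section TrialityBracket

variable {K₁ K₂ : Type*} [NonAssocRing K₁] [Module ℝ K₁] [CompositionAlgebra K₁]
  [NonAssocRing K₂] [Module ℝ K₂] [CompositionAlgebra K₂]

/-- The action of `Tri K₁ ⊕ Tri K₂` on the `i`-th copy of `K₁ ⊗ K₂`. -/
def act (i : Fin 3) : (Tri K₁ × Tri K₂) →ₗ[ℝ] Module.End ℝ (K₁ ⊗[ℝ] K₂) :=
  (LinearMap.rTensorHom K₂ ∘ₗ compL K₁ i).coprod (LinearMap.lTensorHom K₁ ∘ₗ compL K₂ i)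

theorem act_tmul (i : Fin 3) (g : Tri K₁ × Tri K₂) (x₁ : K₁) (x₂ : K₂) :
    act i g (x₁ ⊗ₜ x₂) = Tri.comp g.1 i x₁ ⊗ₜ x₂ + x₁ ⊗ₜ Tri.comp g.2 i x₂ := by
  simp [act, compL_apply]

/-- The product of two different copies of `K₁ ⊗ K₂`. -/
def paraT : (K₁ ⊗[ℝ] K₂) →ₗ[ℝ] (K₁ ⊗[ℝ] K₂) →ₗ[ℝ] (K₁ ⊗[ℝ] K₂) :=
  TensorProduct.map₂ (para K₁) (para K₂)

theorem paraT_tmul (x₁ y₁ : K₁) (x₂ y₂ : K₂) :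
    paraT (x₁ ⊗ₜ[ℝ] x₂) (y₁ ⊗ₜ[ℝ] y₂) = para K₁ x₁ y₁ ⊗ₜ para K₂ x₂ y₂ := rfl

/-- The product of the `i`-th copy of `K₁ ⊗ K₂` with itself. -/
def selfT (i : Fin 3) : (K₁ ⊗[ℝ] K₂) →ₗ[ℝ] (K₁ ⊗[ℝ] K₂) →ₗ[ℝ] (Tri K₁ × Tri K₂) :=
  ((TensorProduct.map₂ (triTL K₁ i) (ip K₂)).compr₂
      (TensorProduct.rid ℝ (Tri K₁)).toLinearMap).compr₂ (LinearMap.inl ℝ (Tri K₁) (Tri K₂))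
    + ((TensorProduct.map₂ (ip K₁) (triTL K₂ i)).compr₂
      (TensorProduct.lid ℝ (Tri K₂)).toLinearMap).compr₂ (LinearMap.inr ℝ (Tri K₁) (Tri K₂))

theorem selfT_tmul (i : Fin 3) (x₁ y₁ : K₁) (x₂ y₂ : K₂) :
    selfT i (x₁ ⊗ₜ[ℝ] x₂) (y₁ ⊗ₜ[ℝ] y₂)
      = (ip K₂ x₂ y₂ • triTL K₁ i x₁ y₁, ip K₁ x₁ y₁ • triTL K₂ i x₂ y₂) := by
  simp [selfT]

theorem act_lie (i : Fin 3) (g h : Tri K₁ × Tri K₂) (u : K₁ ⊗[ℝ] K₂) :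
    act i (⁅g.1, h.1⁆, ⁅g.2, h.2⁆) u + act i h (act i g u) = act i g (act i h u) := by
  induction u with
  | zero => simp
  | tmul x₁ x₂ =>
    simp only [act_tmul, map_add]
    simp only [Tri.comp_lie, Ring.lie_def, LinearMap.sub_apply, Module.End.mul_apply,
      TensorProduct.sub_tmul, TensorProduct.tmul_sub]
    abel
  | add u v hu hv =>
    simp only [map_add, ← hu, ← hv]
    abel

theorem act_paraT (i : Fin 3) (g : Tri K₁ × Tri K₂) (u v : K₁ ⊗[ℝ] K₂) :
    act i g (paraT u v) = paraT (act (i + 1) g u) v + paraT u (act (i + 2) g v) := by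
  induction u with
  | zero => simp
  | add u u' hu hu' =>
    simp only [map_add, LinearMap.add_apply, hu, hu']
    abel
  | tmul x₁ x₂ =>
    induction v with
    | zero => simp
    | add v v' hv hv' =>
      simp only [map_add, hv, hv']
      abel
    | tmul y₁ y₂ =>
      simp only [act_tmul, paraT_tmul, map_add, LinearMap.add_apply, Tri.comp_para,
        TensorProduct.tmul_add, TensorProduct.add_tmul]
      abel

theorem lie_selfT (i : Fin 3) (g : Tri K₁ × Tri K₂) (u v : K₁ ⊗[ℝ] K₂) :
    (⁅g.1, (selfT i u v).1⁆, ⁅g.2, (selfT i u v).2⁆) = selfT i (act i g u) v + selfT i u (act i g v) := by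
  induction u with
  | zero => simp
  | add u u' hu hu' =>
    have e := congrArg₂ (· + ·) hu hu'
    simp only [map_add, LinearMap.add_apply, Prod.fst_add, Prod.snd_add, lie_add,
      ← Prod.mk_add_mk] at e ⊢
    rw [e]
    abel
  | tmul x₁ x₂ =>
    induction v with
    | zero => simp
    | add v v' hv hv' =>
      have e := congrArg₂ (· + ·) hv hv'
      simp only [map_add, Prod.fst_add, Prod.snd_add, lie_add,
        ← Prod.mk_add_mk] at e ⊢
      rw [e]
      abel
    | tmul y₁ y₂ =>
      simp only [act_tmul, selfT_tmul, map_add, LinearMap.add_apply, Tri.ip_comp]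
      refine Prod.ext ?_ ?_
      · change ⁅g.1, ip K₂ x₂ y₂ • triTL K₁ i x₁ y₁⁆ = _
        rw [lie_smul, lie_triTL]
        simp only [Prod.fst_add]
        module
      · change ⁅g.2, ip K₁ x₁ y₁ • triTL K₂ i x₂ y₂⁆ = _
        rw [lie_smul, lie_triTL]
        simp only [Prod.snd_add]
        module

theorem selfT_swap (i : Fin 3) (u v : K₁ ⊗[ℝ] K₂) : selfT i u v = -selfT i v u := by
  induction u with
  | zero => simp
  | add u u' hu hu' =>
    simp only [map_add, LinearMap.add_apply, hu, hu']
    abel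
  | tmul x₁ x₂ =>
    induction v with
    | zero => simp
    | add v v' hv hv' =>
      simp only [map_add, LinearMap.add_apply, hv, hv']
      abel
    | tmul y₁ y₂ =>
      rw [selfT_tmul, selfT_tmul, triTL_swap i x₁, triTL_swap i x₂, ip_comm y₁, ip_comm y₂]
      simp

theorem selfT_self (i : Fin 3) (u : K₁ ⊗[ℝ] K₂) : selfT i u u = 0 :=
  eq_zero_of_eq_neg_self (selfT_swap i u u)

/-- Neither factor satisfies this alone: the terms from 4S_{x₁,y₁} cancel against those from
4S_{x₂,y₂} at another place of the cycle. -/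
theorem act_selfT_cyclic (i : Fin 3) (u v w : K₁ ⊗[ℝ] K₂) :
    act i (selfT i u v) w + act i (selfT i v w) u + act i (selfT i w u) v = 0 := by
  induction u with
  | zero => simp
  | add u u' hu hu' =>
    simp only [map_add, LinearMap.add_apply]
    linear_combination (norm := abel) hu + hu'
  | tmul x₁ x₂ =>
    induction v with
    | zero => simp
    | add v v' hv hv' =>
      simp only [map_add, LinearMap.add_apply]
      linear_combination (norm := abel) hv + hv'
    | tmul y₁ y₂ =>
      induction w with
      | zero => simp
      | add w w' hw hw' =>
        simp only [map_add, LinearMap.add_apply]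
        linear_combination (norm := abel) hw + hw'
      | tmul z₁ z₂ =>
        simp only [act_tmul, selfT_tmul, Tri.comp_smul, LinearMap.smul_apply, comp_triTL_self,
          TensorProduct.tmul_sub, TensorProduct.sub_tmul, ← TensorProduct.smul_tmul',
          TensorProduct.tmul_smul, smul_sub, ip_comm z₁, ip_comm z₂, ip_comm y₁ x₁,
          ip_comm y₂ x₂]
        module

/-- In each factor put P = (x∘z)∘y and Q = (y∘z)∘x. Then P - Q is the action of T_{x,y} and P + Q =
2⟨x,y⟩z, so the claim is ½(P₁-Q₁)⊗(P₂+Q₂) + ½(P₁+Q₁)⊗(P₂-Q₂) = P₁⊗P₂ - Q₁⊗Q₂. The next lemma is the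
mirror image. -/
theorem act_selfT_one (i : Fin 3) (u v w : K₁ ⊗[ℝ] K₂) :
    act (i + 1) (selfT i u v) w + paraT (paraT v w) u = paraT (paraT u w) v := by
  induction u with
  | zero => simp
  | add u u' hu hu' =>
    simp only [map_add, LinearMap.add_apply, ← hu, ← hu']
    abel
  | tmul x₁ x₂ =>
    induction v with
    | zero => simp
    | add v v' hv hv' =>
      simp only [map_add, LinearMap.add_apply, ← hv, ← hv']
      abel
    | tmul y₁ y₂ =>
      induction w with
      | zero => simp
      | add w w' hw hw' =>
        simp only [map_add, LinearMap.add_apply, ← hw, ← hw']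
        abel
      | tmul z₁ z₂ =>
        simp only [act_tmul, selfT_tmul, Tri.comp_smul, LinearMap.smul_apply, comp_triTL_one,
          paraT_tmul]
        have h₁ := para_para_left x₁ y₁ z₁
        have h₂ := para_para_left x₂ y₂ z₂
        have e₁ : ip K₁ x₁ y₁ • z₁ = (1 / 2 : ℝ) •
            (para K₁ (para K₁ x₁ z₁) y₁ + para K₁ (para K₁ y₁ z₁) x₁) := by
          rw [h₁]; module
        have e₂ : ip K₂ x₂ y₂ • z₂ = (1 / 2 : ℝ) •
            (para K₂ (para K₂ x₂ z₂) y₂ + para K₂ (para K₂ y₂ z₂) x₂) := by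
          rw [h₂]; module
        rw [TensorProduct.smul_tmul (ip K₂ x₂ y₂), ← TensorProduct.smul_tmul (ip K₁ x₁ y₁) z₁, e₁, e₂]
        simp only [TensorProduct.tmul_sub, TensorProduct.sub_tmul, TensorProduct.tmul_add,
          TensorProduct.add_tmul, ← TensorProduct.smul_tmul', TensorProduct.tmul_smul]
        module

theorem act_selfT_two (i : Fin 3) (u v w : K₁ ⊗[ℝ] K₂) :
    act (i + 2) (selfT i u v) w + paraT u (paraT w v) = paraT v (paraT w u) := by
  induction u with
  | zero => simp
  | add u u' hu hu' =>
    simp only [map_add, LinearMap.add_apply, ← hu, ← hu']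
    abel
  | tmul x₁ x₂ =>
    induction v with
    | zero => simp
    | add v v' hv hv' =>
      simp only [map_add, LinearMap.add_apply, ← hv, ← hv']
      abel
    | tmul y₁ y₂ =>
      induction w with
      | zero => simp
      | add w w' hw hw' =>
        simp only [map_add, LinearMap.add_apply, ← hw, ← hw']
        abel
      | tmul z₁ z₂ =>
        simp only [act_tmul, selfT_tmul, Tri.comp_smul, LinearMap.smul_apply, comp_triTL_two,
          paraT_tmul]
        have h₁ := para_para_right x₁ y₁ z₁
        have h₂ := para_para_right x₂ y₂ z₂
        have e₁ : ip K₁ x₁ y₁ • z₁ = (1 / 2 : ℝ) •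
            (para K₁ x₁ (para K₁ z₁ y₁) + para K₁ y₁ (para K₁ z₁ x₁)) := by
          rw [h₁]; module
        have e₂ : ip K₂ x₂ y₂ • z₂ = (1 / 2 : ℝ) •
            (para K₂ x₂ (para K₂ z₂ y₂) + para K₂ y₂ (para K₂ z₂ x₂)) := by
          rw [h₂]; module
        rw [TensorProduct.smul_tmul (ip K₂ x₂ y₂), ← TensorProduct.smul_tmul (ip K₁ x₁ y₁) z₁, e₁, e₂]
        simp only [TensorProduct.tmul_sub, TensorProduct.sub_tmul, TensorProduct.tmul_add,
          TensorProduct.add_tmul, ← TensorProduct.smul_tmul', TensorProduct.tmul_smul]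
        module

/-- The coefficient ⟨x∘y,z⟩ is invariant under cyclic permutation, so it factors out of the sum and
leaves `triTL_para_cyclic` in each algebra. -/
theorem selfT_paraT_cyclic (i : Fin 3) (u v w : K₁ ⊗[ℝ] K₂) :
    selfT i (paraT u v) w + selfT (i + 1) (paraT v w) u + selfT (i + 2) (paraT w u) v = 0 := by
  induction u with
  | zero => simp
  | add u u' hu hu' =>
    simp only [map_add, LinearMap.add_apply]
    linear_combination (norm := abel) hu + hu'
  | tmul x₁ x₂ =>
    induction v with
    | zero => simp
    | add v v' hv hv' =>
      simp only [map_add, LinearMap.add_apply]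
      linear_combination (norm := abel) hv + hv'
    | tmul y₁ y₂ =>
      induction w with
      | zero => simp
      | add w w' hw hw' =>
        simp only [map_add, LinearMap.add_apply]
        linear_combination (norm := abel) hw + hw'
      | tmul z₁ z₂ =>
        simp only [paraT_tmul, selfT_tmul, ← ip_para_cyclic _ z₁ x₁, ← ip_para_cyclic _ z₂ x₂,
          ← ip_para_cyclic x₁ y₁ z₁, ← ip_para_cyclic x₂ y₂ z₂, Prod.mk_add_mk, ← smul_add,
          triTL_para_cyclic, smul_zero]
        rfl

variable (K₁ K₂) in
/-- The bracket of the triality construction. -/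
def trialityBracket :
    TrialitySpace K₁ K₂ →ₗ[ℝ] TrialitySpace K₁ K₂ →ₗ[ℝ] TrialitySpace K₁ K₂ :=
  biGradedBracket act paraT selfT

theorem trialityBracket_apply (u v : TrialitySpace K₁ K₂) :
    trialityBracket K₁ K₂ u v
      = (⁅u.1, v.1⁆ + ∑ i, (selfT i (u.2.2 i) (v.2.2 i)).1,
        ⁅u.2.1, v.2.1⁆ + ∑ i, (selfT i (u.2.2 i) (v.2.2 i)).2,
        fun i => (act i (u.1, u.2.1) (v.2.2 i) + (-1 : ℝ) • act i (v.1, v.2.1) (u.2.2 i))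
          + (paraT (u.2.2 (i + 1)) (v.2.2 (i + 2))
            + (-1 : ℝ) • paraT (v.2.2 (i + 1)) (u.2.2 (i + 2)))) :=
  biGradedBracket_apply u v

theorem trialityBracket_self (u : TrialitySpace K₁ K₂) : trialityBracket K₁ K₂ u u = 0 :=
  biGradedBracket_self selfT_self u

theorem trialityBracket_jacobi (u v w : TrialitySpace K₁ K₂) :
    trialityBracket K₁ K₂ (trialityBracket K₁ K₂ u v) w
      + trialityBracket K₁ K₂ (trialityBracket K₁ K₂ v w) u
      + trialityBracket K₁ K₂ (trialityBracket K₁ K₂ w u) v = 0 := by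
  have h := biGradedBracket_jacobi (ρ := act) (m := paraT) (b := selfT) act_lie act_paraT lie_selfT
    selfT_swap act_selfT_cyclic act_selfT_one act_selfT_two selfT_paraT_cyclic u v w
  have e : trialityBracket K₁ K₂ = biGradedBracket act paraT selfT := rfl
  rw [e]
  convert h using 3

end TrialityBracket

/-! ### Skew symmetry of the Tits bracket -/

section TitsSkew

variable {K : Type*} [NonAssocRing K] [Module ℝ K] [CompositionAlgebra K]

/-- Linearisation of x(zx) = (xz)x; it is what makes `derivD` skew in its two arguments. -/
theorem flexible_linearised (x y z : K) :
    x * (z * y) + y * (z * x) = (x * z) * y + (y * z) * x := by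
  have h1 := mul_add_mul_comm_mul x z y
  have h2 := mul_mul_add_mul_mul x y z
  have h3 := mul_add_mul_comm_mul y z x
  simp only [mul_add, add_mul] at h1 h2 h3
  linear_combination (norm := abel) h1 + h2 + h3

theorem derivD_apply (x y z : K) :
    derivD x y z = x * (y * z) - y * (x * z) + (x * (z * y) - (x * z) * y)
      + ((z * y) * x - (z * x) * y) := by
  simp [derivD, Ring.lie_def]

theorem derivD_swap (x y : K) : derivD x y + derivD y x = 0 := by
  ext z
  have h := flexible_linearised x y z
  simp only [LinearMap.add_apply, LinearMap.zero_apply, derivD_apply]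
  linear_combination (norm := abel) h

theorem jordan_comm (X Y : H3 K) : jordan X Y = jordan Y X :=
  Subtype.ext (add_comm (X.1 * Y.1) (Y.1 * X.1))

theorem ipH_comm (X Y : H3 K) : ipH X Y = ipH Y X := by
  change 1 / 2 * re (Matrix.trace (jordan X Y).1) = 1 / 2 * re (Matrix.trace (jordan Y X).1)
  rw [jordan_comm]

theorem star_apply (X Y : H3 K) : star X Y = jordan X Y - (4 / 3 * ipH X Y) • jordanOne K := rfl

theorem star_comm (X Y : H3 K) : star X Y = star Y X := by
  rw [star_apply, star_apply, jordan_comm, ipH_comm]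

variable {K₁ K₂ : Type*} [NonAssocRing K₁] [Module ℝ K₁] [CompositionAlgebra K₁]
  [NonAssocRing K₂] [Module ℝ K₂] [CompositionAlgebra K₂]

theorem titsDer_swap (s t : K₁ ⊗[ℝ] H3 K₂) : titsDer s t + titsDer t s = 0 := by
  induction s with
  | zero => simp
  | add s s' hs hs' =>
    simp only [map_add, LinearMap.add_apply]
    linear_combination (norm := abel) hs + hs'
  | tmul a A =>
    induction t with
    | zero => simp
    | add t t' ht ht' =>
      simp only [map_add, LinearMap.add_apply]
      linear_combination (norm := abel) ht + ht'
    | tmul b B =>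
      rw [titsDer_tmul, titsDer_tmul, ipH_comm B A, ← smul_add, derivD_swap, smul_zero]

theorem titsJordan_swap (s t : K₁ ⊗[ℝ] H3 K₂) : titsJordan s t + titsJordan t s = 0 := by
  induction s with
  | zero => simp
  | add s s' hs hs' =>
    simp only [map_add, LinearMap.add_apply]
    linear_combination (norm := abel) hs + hs'
  | tmul a A =>
    induction t with
    | zero => simp
    | add t t' ht ht' =>
      simp only [map_add, LinearMap.add_apply]
      linear_combination (norm := abel) ht + ht'
    | tmul b B =>
      rw [titsJordan_tmul, titsJordan_tmul, ip_comm b a, ← neg_add, ← smul_add,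
        ← lie_skew (jordan A : Module.End ℝ (H3 K₂)), neg_add_cancel, smul_zero, neg_zero]

theorem titsTensor_swap (s t : K₁ ⊗[ℝ] H3 K₂) : titsTensor s t + titsTensor t s = 0 := by
  induction s with
  | zero => simp
  | add s s' hs hs' =>
    simp only [map_add, LinearMap.add_apply]
    linear_combination (norm := abel) hs + hs'
  | tmul a A =>
    induction t with
    | zero => simp
    | add t t' ht ht' =>
      simp only [map_add, LinearMap.add_apply]
      linear_combination (norm := abel) ht + ht'
    | tmul b B =>
      rw [titsTensor_tmul, titsTensor_tmul, star_comm B A, ← smul_add, ← TensorProduct.add_tmul]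
      simp

theorem titsBracket_apply (u v : TitsAmbient K₁ K₂) : titsBracket u v =
    (⁅u.1, v.1⁆ + titsDer u.2.2 v.2.2,
      ⁅u.2.1, v.2.1⁆ + titsJordan u.2.2 v.2.2,
      (u.1.rTensor (H3 K₂) v.2.2 + u.2.1.lTensor K₁ v.2.2)
        - (v.1.rTensor (H3 K₂) u.2.2 + v.2.1.lTensor K₁ u.2.2) + titsTensor u.2.2 v.2.2) := rfl

/-- Skewness holds on the whole ambient space, before it is known that the bracket preserves `L₃`.
-/
theorem titsBracket_swap (u v : TitsAmbient K₁ K₂) : titsBracket u v + titsBracket v u = 0 := by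
  obtain ⟨D, E, t⟩ := u
  obtain ⟨D', E', t'⟩ := v
  rw [titsBracket_apply, titsBracket_apply]
  refine Prod.ext ?_ (Prod.ext ?_ ?_)
  · have h := titsDer_swap t t'
    simp only [Prod.fst_add, Prod.fst_zero, Ring.lie_def]
    linear_combination (norm := abel) h
  · have h := titsJordan_swap t t'
    simp only [Prod.fst_add, Prod.fst_zero, Prod.snd_add, Prod.snd_zero, Ring.lie_def]
    linear_combination (norm := abel) h
  · have h := titsTensor_swap t t'
    simp only [Prod.snd_add, Prod.snd_zero]
    linear_combination (norm := abel) h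

end TitsSkew

/-! ### Any triality decomposition carries the Tits bracket to the triality bracket -/

section Decomposition

variable {K₁ K₂ : Type*} [NonAssocRing K₁] [Module ℝ K₁] [CompositionAlgebra K₁]
  [NonAssocRing K₂] [Module ℝ K₂] [CompositionAlgebra K₂]

variable (K₁ K₂) in
/-- The embeddings `F i` as linear maps. -/
def FL (i : Fin 3) : K₁ ⊗[ℝ] K₂ →ₗ[ℝ] TrialitySpace K₁ K₂ :=
  LinearMap.inr ℝ (Tri K₁) (Tri K₂ × (Fin 3 → K₁ ⊗[ℝ] K₂)) ∘ₗ
    LinearMap.inr ℝ (Tri K₂) (Fin 3 → K₁ ⊗[ℝ] K₂) ∘ₗ LinearMap.single ℝ (fun _ => K₁ ⊗[ℝ] K₂) i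

theorem FL_apply (i : Fin 3) (w : K₁ ⊗[ℝ] K₂) : FL K₁ K₂ i w = F i w := rfl

theorem trialitySpace_eq (u : TrialitySpace K₁ K₂) :
    u = (u.1, 0, 0) + (0, u.2.1, 0) + ∑ i, FL K₁ K₂ i (u.2.2 i) := by
  refine Prod.ext ?_ (Prod.ext ?_ ?_)
  · simp [FL_apply, F, Prod.fst_sum]
  · simp [FL_apply, F, Prod.fst_sum, Prod.snd_sum]
  · simp only [FL_apply, F, Prod.snd_add, Prod.snd_sum, zero_add]
    exact (Finset.univ_sum_single u.2.2).symm

/-- `h1` to `h5` are the pairs of generators for which a decomposition prescribes the bracket;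
skewness supplies the pairs in the opposite order. -/
theorem bilin_ext {W : Type*} [AddCommMonoid W] [Module ℝ W]
    {B C : TrialitySpace K₁ K₂ →ₗ[ℝ] TrialitySpace K₁ K₂ →ₗ[ℝ] W}
    (hB : ∀ u v, B u v + B v u = 0) (hC : ∀ u v, C u v + C v u = 0)
    (h1 : ∀ S₁ S₂ T₁ T₂, B (S₁, S₂, 0) (T₁, T₂, 0) = C (S₁, S₂, 0) (T₁, T₂, 0))
    (h2 : ∀ T i x₁ x₂, B (T, 0, 0) (F i (x₁ ⊗ₜ x₂)) = C (T, 0, 0) (F i (x₁ ⊗ₜ x₂)))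
    (h3 : ∀ T i x₁ x₂, B (0, T, 0) (F i (x₁ ⊗ₜ x₂)) = C (0, T, 0) (F i (x₁ ⊗ₜ x₂)))
    (h4 : ∀ i x₁ x₂ y₁ y₂, B (F i (x₁ ⊗ₜ x₂)) (F (i + 1) (y₁ ⊗ₜ y₂))
      = C (F i (x₁ ⊗ₜ x₂)) (F (i + 1) (y₁ ⊗ₜ y₂)))
    (h5 : ∀ i x₁ x₂ y₁ y₂, B (F i (x₁ ⊗ₜ x₂)) (F i (y₁ ⊗ₜ y₂))
      = C (F i (x₁ ⊗ₜ x₂)) (F i (y₁ ⊗ₜ y₂)))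
    (u v : TrialitySpace K₁ K₂) : B u v = C u v := by
  have swap : ∀ u v, B u v = C u v → B v u = C v u := fun u v h => by
    calc B v u = B v u + (C u v + C v u) := by rw [hC, add_zero]
      _ = (B v u + B u v) + C v u := by rw [h, add_assoc]
      _ = C v u := by rw [hB, zero_add]
  have e2 : ∀ T i w, B (T, 0, 0) (FL K₁ K₂ i w) = C (T, 0, 0) (FL K₁ K₂ i w) := fun T i w => by
    induction w with
    | zero => simp only [map_zero]
    | add w w' h h' => simp only [map_add, h, h']
    | tmul x₁ x₂ => exact h2 T i x₁ x₂
  have e3 : ∀ T i w, B (0, T, 0) (FL K₁ K₂ i w) = C (0, T, 0) (FL K₁ K₂ i w) := fun T i w => by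
    induction w with
    | zero => simp only [map_zero]
    | add w w' h h' => simp only [map_add, h, h']
    | tmul x₁ x₂ => exact h3 T i x₁ x₂
  have e4 : ∀ i w w', B (FL K₁ K₂ i w) (FL K₁ K₂ (i + 1) w')
      = C (FL K₁ K₂ i w) (FL K₁ K₂ (i + 1) w') := fun i w w' => by
    induction w with
    | zero => simp only [map_zero, LinearMap.zero_apply]
    | add w w' h h' => simp only [map_add, LinearMap.add_apply, h, h']
    | tmul x₁ x₂ =>
      induction w' with
      | zero => simp only [map_zero]
      | add w w' h h' => simp only [map_add, h, h']
      | tmul y₁ y₂ => exact h4 i x₁ x₂ y₁ y₂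
  have e5 : ∀ i w w', B (FL K₁ K₂ i w) (FL K₁ K₂ i w')
      = C (FL K₁ K₂ i w) (FL K₁ K₂ i w') := fun i w w' => by
    induction w with
    | zero => simp only [map_zero, LinearMap.zero_apply]
    | add w w' h h' => simp only [map_add, LinearMap.add_apply, h, h']
    | tmul x₁ x₂ =>
      induction w' with
      | zero => simp only [map_zero]
      | add w w' h h' => simp only [map_add, h, h']
      | tmul y₁ y₂ => exact h5 i x₁ x₂ y₁ y₂
  have e6 : ∀ i j w w', B (FL K₁ K₂ i w) (FL K₁ K₂ j w')
      = C (FL K₁ K₂ i w) (FL K₁ K₂ j w') := fun i j w w' => by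
    obtain rfl | rfl | rfl := fin3_cases i j
    · exact e5 _ w w'
    · exact e4 _ w w'
    · have := e4 (i + 2) w' w
      rw [fin3_two_one] at this
      exact swap _ _ this
  have e7 : ∀ v, (∀ T, B v (T, 0, 0) = C v (T, 0, 0)) → (∀ T, B v (0, T, 0) = C v (0, T, 0)) →
      (∀ i w, B v (FL K₁ K₂ i w) = C v (FL K₁ K₂ i w)) → ∀ u, B v u = C v u := by
    intro v k1 k2 k3 u
    rw [trialitySpace_eq u]
    simp only [map_add, map_sum, k1, k2, k3]
  -- `e7` extends agreement linearly in the second argument. It is applied first with a generator in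
  -- the first slot, then, after a swap, with an arbitrary element there.
  refine e7 u (fun T => swap _ _ (e7 _ (fun S => h1 _ _ _ _) (fun S => h1 _ _ _ _) (e2 T) u))
    (fun T => swap _ _ (e7 _ (fun S => h1 _ _ _ _) (fun S => h1 _ _ _ _) (e3 T) u))
    (fun i w => swap _ _ (e7 _ (fun T => swap _ _ (e2 T i w)) (fun T => swap _ _ (e3 T i w))
      (fun j w' => e6 i j w w') u)) v

theorem act_zero_right (T : Tri K₁) (i : Fin 3) (x₁ : K₁) (x₂ : K₂) :
    act i (T, (0 : Tri K₂)) (x₁ ⊗ₜ x₂) = Tri.comp T i x₁ ⊗ₜ[ℝ] x₂ := by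
  have h0 : Tri.comp (0 : Tri K₂) i = 0 := (compL K₂ i).map_zero
  simp [act_tmul, h0]

theorem act_zero_left (T : Tri K₂) (i : Fin 3) (x₁ : K₁) (x₂ : K₂) :
    act i ((0 : Tri K₁), T) (x₁ ⊗ₜ x₂) = x₁ ⊗ₜ[ℝ] Tri.comp T i x₂ := by
  have h0 : Tri.comp (0 : Tri K₁) i = 0 := (compL K₁ i).map_zero
  simp [act_tmul, h0]

theorem trialityBracket_tri_tri (S₁ T₁ : Tri K₁) (S₂ T₂ : Tri K₂) :
    trialityBracket K₁ K₂ (S₁, S₂, 0) (T₁, T₂, 0) = (⁅S₁, T₁⁆, ⁅S₂, T₂⁆, 0) := by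
  rw [trialityBracket_apply]
  refine Prod.ext ?_ (Prod.ext ?_ (funext fun l => ?_)) <;> simp

theorem trialityBracket_tri_F (S : Tri K₁) (T : Tri K₂) (i : Fin 3) (w : K₁ ⊗[ℝ] K₂) :
    trialityBracket K₁ K₂ (S, T, 0) (F i w) = F i (act i (S, T) w) := by
  rw [trialityBracket_apply]
  refine Prod.ext ?_ (Prod.ext ?_ (funext fun l => ?_))
  · simp [F]
  · simp [F]
  · by_cases h : l = i
    · subst h
      simp [F]
    · simp [F, h]

theorem trialityBracket_F_F_self (i : Fin 3) (w w' : K₁ ⊗[ℝ] K₂) :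
    trialityBracket K₁ K₂ (F i w) (F i w') = ((selfT i w w').1, (selfT i w w').2, 0) := by
  rw [trialityBracket_apply]
  refine Prod.ext ?_ (Prod.ext ?_ (funext fun l => ?_))
  · simp [F, fin3_sum _ i]
  · simp [F, fin3_sum _ i]
  · have h0 : act l ((0 : Tri K₁), (0 : Tri K₂)) = 0 := (act l).map_zero
    obtain rfl | rfl | rfl := fin3_cases i l <;>
      simp [F, h0, fin3_one_one, fin3_one_two, fin3_two_one, fin3_two_two]

theorem trialityBracket_F_F (i : Fin 3) (w w' : K₁ ⊗[ℝ] K₂) :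
    trialityBracket K₁ K₂ (F i w) (F (i + 1) w') = F (i + 2) (paraT w w') := by
  rw [trialityBracket_apply]
  refine Prod.ext ?_ (Prod.ext ?_ (funext fun l => ?_))
  · simp [F, fin3_sum _ i, (fin3_add_one_ne i).symm]
  · simp [F, fin3_sum _ i, (fin3_add_one_ne i).symm]
  · have h0 : act l ((0 : Tri K₁), (0 : Tri K₂)) = 0 := (act l).map_zero
    obtain rfl | rfl | rfl := fin3_cases i l <;>
      simp [F, h0, fin3_one_one, fin3_one_two, fin3_two_one, fin3_two_two, (fin3_one_ne_two _).symm, (fin3_add_one_ne _).symm,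
        (fin3_add_two_ne _).symm]

theorem trialityBracket_swap (u v : TrialitySpace K₁ K₂) :
    trialityBracket K₁ K₂ u v + trialityBracket K₁ K₂ v u = 0 := by
  have h := trialityBracket_self (u + v)
  simp only [map_add, LinearMap.add_apply, trialityBracket_self, zero_add, add_zero] at h
  rwa [add_comm]

/-- Every decomposition, not just the one constructed below, intertwines the two brackets. The
symmetry statement, which quantifies over all decompositions, rests on this. -/
theorem IsTrialityDecomposition.titsBracket_eq {Φ : TrialitySpace K₁ K₂ ≃ₗ[ℝ] L₃ K₁ K₂}
    (hΦ : IsTrialityDecomposition Φ) (u v : TrialitySpace K₁ K₂) :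
    titsBracket (Φ u).1 (Φ v).1 = (Φ (trialityBracket K₁ K₂ u v)).1 := by
  let ι : TrialitySpace K₁ K₂ →ₗ[ℝ] TitsAmbient K₁ K₂ := (L₃ K₁ K₂).subtype ∘ₗ Φ.toLinearMap
  have key := bilin_ext (B := titsBracket.compl₁₂ ι ι) (C := (trialityBracket K₁ K₂).compr₂ ι)
    (fun u v => titsBracket_swap _ _)
    (fun u v => by
      rw [LinearMap.compr₂_apply, LinearMap.compr₂_apply, ← map_add, trialityBracket_swap,
        map_zero])
    (fun S₁ S₂ T₁ T₂ => by
      rw [LinearMap.compr₂_apply, trialityBracket_tri_tri]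
      exact hΦ.tri_tri S₁ T₁ S₂ T₂)
    (fun T i x₁ x₂ => by
      rw [LinearMap.compr₂_apply, trialityBracket_tri_F, act_zero_right]
      exact hΦ.tri₁_F T i x₁ x₂)
    (fun T i x₁ x₂ => by
      rw [LinearMap.compr₂_apply, trialityBracket_tri_F, act_zero_left]
      exact hΦ.tri₂_F T i x₁ x₂)
    (fun i x₁ x₂ y₁ y₂ => by
      rw [LinearMap.compr₂_apply, trialityBracket_F_F, paraT_tmul, para_apply, para_apply,
        conj_mul, conj_mul]
      exact hΦ.F_F i _ _ rfl rfl x₁ y₁ x₂ y₂)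
    (fun i x₁ x₂ y₁ y₂ => by
      rw [LinearMap.compr₂_apply, trialityBracket_F_F_self, selfT_tmul]
      exact hΦ.F_F_self i x₁ y₁ x₂ y₂)
  exact key u v

/-! ### Symmetry in the two algebras -/

theorem act_comm (i : Fin 3) (g : Tri K₁) (h : Tri K₂) (w : K₁ ⊗[ℝ] K₂) :
    act i (h, g) (TensorProduct.comm ℝ K₁ K₂ w)
      = TensorProduct.comm ℝ K₁ K₂ (act i (g, h) w) := by
  induction w with
  | zero => simp only [map_zero]
  | add w w' hw hw' => simp only [map_add, hw, hw']
  | tmul x₁ x₂ => simp only [TensorProduct.comm_tmul, act_tmul, map_add, add_comm]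

theorem paraT_comm (w w' : K₁ ⊗[ℝ] K₂) :
    paraT (TensorProduct.comm ℝ K₁ K₂ w) (TensorProduct.comm ℝ K₁ K₂ w')
      = TensorProduct.comm ℝ K₁ K₂ (paraT w w') := by
  induction w with
  | zero => simp only [map_zero, LinearMap.zero_apply]
  | add w w' h h' => simp only [map_add, LinearMap.add_apply, h, h']
  | tmul x₁ x₂ =>
    induction w' with
    | zero => simp only [map_zero]
    | add w w' h h' => simp only [map_add, h, h']
    | tmul y₁ y₂ => simp only [TensorProduct.comm_tmul, paraT_tmul]

theorem selfT_comm (i : Fin 3) (w w' : K₁ ⊗[ℝ] K₂) :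
    selfT i (TensorProduct.comm ℝ K₁ K₂ w) (TensorProduct.comm ℝ K₁ K₂ w')
      = (selfT i w w').swap := by
  induction w with
  | zero => simp only [map_zero, LinearMap.zero_apply]; rfl
  | add w w' h h' => simp only [map_add, LinearMap.add_apply, h, h']; rfl
  | tmul x₁ x₂ =>
    induction w' with
    | zero => simp only [map_zero]; rfl
    | add w w' h h' => simp only [map_add, h, h']; rfl
    | tmul y₁ y₂ => simp only [TensorProduct.comm_tmul, selfT_tmul, Prod.swap]

theorem trialityBracket_interchange (u v : TrialitySpace K₁ K₂) :
    trialityBracket K₂ K₁ (interchange K₁ K₂ u) (interchange K₁ K₂ v)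
      = interchange K₁ K₂ (trialityBracket K₁ K₂ u v) := by
  rw [trialityBracket_apply, trialityBracket_apply]
  refine Prod.ext ?_ (Prod.ext ?_ (funext fun l => ?_))
  · simp [interchange, selfT_comm]
  · simp [interchange, selfT_comm]
  · simp [interchange, act_comm, paraT_comm]

end Decomposition

/-! ### The decomposition of the triality algebra by derivations -/

section TriDer

variable {K : Type*} [NonAssocRing K] [Module ℝ K] [CompositionAlgebra K]

/-- The associator is alternating, so one element t controls all six orders. Rewriting right-nested
products as left-nested ones plus or minus t reduces later identities to linear algebra. -/
theorem exists_associator (x y z : K) : ∃ t : K,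
    x * (y * z) = (x * y) * z - t ∧ y * (z * x) = (y * z) * x - t ∧ z * (x * y) = (z * x) * y - t ∧
    y * (x * z) = (y * x) * z + t ∧ x * (z * y) = (x * z) * y + t ∧
    z * (y * x) = (z * y) * x + t := by
  have l1 := mul_add_mul_comm_mul x y z
  have l2 := mul_add_mul_comm_mul y z x
  have l3 := mul_add_mul_comm_mul z x y
  have r1 := mul_mul_add_mul_mul x y z
  have r2 := mul_mul_add_mul_mul y z x
  have r3 := mul_mul_add_mul_mul z x y
  simp only [mul_add, add_mul] at l1 l2 l3 r1 r2 r3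
  refine ⟨(x * y) * z - x * (y * z), by abel, ?_, ?_, ?_, ?_, ?_⟩
  · linear_combination (norm := abel) -r3 - l1
  · linear_combination (norm := abel) l3 + r2
  · linear_combination (norm := abel) l1
  · linear_combination (norm := abel) -r2
  · linear_combination (norm := abel) l2 + r3 + l1

theorem mem_der_mul {D : Module.End ℝ K} :
    D ∈ Der (LinearMap.mul ℝ K) ↔ ∀ x y, D (x * y) = D x * y + x * D y := Iff.rfl

theorem der_one {D : Module.End ℝ K} (hD : D ∈ Der (LinearMap.mul ℝ K)) : D 1 = 0 := by
  have h := mem_der_mul.1 hD 1 1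
  rw [mul_one, mul_one, one_mul] at h
  exact left_eq_add.mp h

/-- Applying D to the quadratic equation of x and comparing with its polarisation at (x, Dx) gives
Re(Dx) x = ⟨x,Dx⟩1. A second application of D gives Re(Dx) Dx = 0, so Re(Dx) ≠ 0 would force Dx = 0.
No definiteness of the form is needed. -/
theorem re_der {D : Module.End ℝ K} (hD : D ∈ Der (LinearMap.mul ℝ K)) (x : K) :
    re (D x) = 0 := by
  by_contra hne
  have h := congrArg D (mul_add_mul_swap x x)
  have h' := mul_add_mul_swap x (D x)
  simp only [map_add, map_sub, map_smul, mem_der_mul.1 hD, der_one hD, smul_zero, sub_zero] at h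
  have e : (2 * re (D x)) • x = (2 * ip K x (D x)) • (1 : K) := by
    linear_combination (norm := module) (1 / 2 : ℝ) • h - h'
  have e' := congrArg D e
  rw [map_smul, map_smul, der_one hD, smul_zero] at e'
  have h0 : D x = 0 :=
    (smul_eq_zero.mp e').resolve_left (mul_ne_zero two_ne_zero hne)
  exact hne (by rw [h0, map_zero])

theorem conj_der {D : Module.End ℝ K} (hD : D ∈ Der (LinearMap.mul ℝ K)) (x : K) :
    D (conj x) = conj (D x) := by
  rw [conj_eq_neg (re_der hD x), conj_apply, map_sub, map_smul, der_one hD, smul_zero, zero_sub]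

/-- ⟨Dx,y⟩ + ⟨x,Dy⟩ is the real part of D(xȳ). -/
theorem der_mem_so {D : Module.End ℝ K} (hD : D ∈ Der (LinearMap.mul ℝ K)) : D ∈ so K := by
  refine mem_so.2 fun x y => ?_
  have h := re_der hD (x * conj y)
  rw [mem_der_mul.1 hD, map_add, conj_der hD, re_apply, re_apply, ip_mul_right, ip_mul_right,
    conj_conj, conj_conj, one_mul, one_mul] at h
  linarith

/-- The components of the triality element with derivation part `D` and imaginary parts `b`. -/
def derComp (D : Module.End ℝ K) (b : Fin 3 → K) (i : Fin 3) : Module.End ℝ K :=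
  D + LinearMap.mulLeft ℝ (b (i + 1)) - LinearMap.mulRight ℝ (b (i + 2))

theorem derComp_apply (D : Module.End ℝ K) (b : Fin 3 → K) (i : Fin 3) (x : K) :
    derComp D b i x = D x + b (i + 1) * x - x * b (i + 2) := rfl

theorem derComp_mem_so {D : Module.End ℝ K} (hD : D ∈ Der (LinearMap.mul ℝ K)) {b : Fin 3 → K}
    (hb : ∀ i, re (b i) = 0) (i : Fin 3) : derComp D b i ∈ so K := by
  refine mem_so.2 fun x y => ?_
  have h := mem_so.1 (der_mem_so hD) x y
  simp only [derComp_apply, map_add, map_sub, LinearMap.add_apply, LinearMap.sub_apply,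
    ip_mul_left (b _), ip_mul_right _ (b _), conj_eq_neg (hb _), neg_mul, mul_neg, map_neg, h]
  ring

theorem derComp_para {D : Module.End ℝ K} (hD : D ∈ Der (LinearMap.mul ℝ K)) {b : Fin 3 → K}
    (hb : ∀ i, re (b i) = 0) (hs : b 0 + b 1 + b 2 = 0) (x y : K) :
    derComp D b 0 (para K x y) = para K (derComp D b 1 x) y + para K x (derComp D b 2 y) := by
  have e1 : (0 : Fin 3) + 1 = 1 := rfl
  have e2 : (0 : Fin 3) + 2 = 2 := rfl
  have e3 : (1 : Fin 3) + 1 = 2 := rfl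
  have e4 : (1 : Fin 3) + 2 = 0 := rfl
  have e5 : (2 : Fin 3) + 1 = 0 := rfl
  have e6 : (2 : Fin 3) + 2 = 1 := rfl
  have h1 : ∀ i (x : K), b i * conj x = -conj (x * b i) := fun i x => by
    rw [conj_mul, conj_eq_neg (hb i), neg_mul, neg_neg]
  have h2 : ∀ i (x : K), conj x * b i = -conj (b i * x) := fun i x => by
    rw [conj_mul, conj_eq_neg (hb i), mul_neg, neg_neg]
  simp only [derComp_apply, para_apply, e1, e2, e3, e4, e5, e6, conj_der hD, h1, h2,
    mem_der_mul.1 hD]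
  simp only [← map_add, ← map_neg, ← map_sub]
  congr 1
  -- The obstruction to the triality relation is the sum of the associators of x, y with b_0, b_1,
  -- b_2, which vanishes because the b_j add up to zero.
  have hx := congrArg (fun c => (x * y) * c - x * (y * c)) hs
  obtain ⟨t0, a1, a2, a3, -, a5, -⟩ := exists_associator x y (b 0)
  obtain ⟨t1, c1, c2, c3, -, c5, -⟩ := exists_associator x y (b 1)
  obtain ⟨t2, d1, d2, d3, -, d5, -⟩ := exists_associator x y (b 2)
  simp only [mul_add, a1, c1, d1, mul_zero, sub_zero] at hx
  simp only [add_mul, sub_mul, mul_add, mul_sub, a5, c1, d3]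
  linear_combination (norm := abel) -hx

/-- The element of the triality algebra with derivation part `D` and imaginary parts `b`. -/
def triOfDer {D : Module.End ℝ K} (hD : D ∈ Der (LinearMap.mul ℝ K)) {b : Fin 3 → K}
    (hb : ∀ i, re (b i) = 0) (hs : b 0 + b 1 + b 2 = 0) : Tri K :=
  Tri.ofComp (derComp D b) (derComp_mem_so hD hb) (derComp_para hD hb hs)

theorem comp_triOfDer {D : Module.End ℝ K} (hD : D ∈ Der (LinearMap.mul ℝ K)) {b : Fin 3 → K}
    (hb : ∀ i, re (b i) = 0) (hs : b 0 + b 1 + b 2 = 0) (i : Fin 3) :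
    Tri.comp (triOfDer hD hb hs) i = derComp D b i := Tri.comp_ofComp _ _ _ i

theorem Tri.re_comp_one (T : Tri K) (i : Fin 3) : re (Tri.comp T i 1) = 0 := by
  have h := Tri.ip_comp T i 1 1
  rw [ip_comm 1] at h
  rw [re_apply]
  linarith

/-- The triality relation at 1∘1 = 1, where the values T_i(1) are imaginary. -/
theorem Tri.sum_comp_one (T : Tri K) :
    Tri.comp T 0 1 + Tri.comp T 1 1 + Tri.comp T 2 1 = 0 := by
  have h := Tri.comp_zero_para T 1 1
  rw [para_one_left, conj_one, para_one_left, para_one_right, conj_eq_neg (Tri.re_comp_one T 1),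
    conj_eq_neg (Tri.re_comp_one T 2)] at h
  rw [h]
  abel

variable (K) in
/-- The imaginary parts of an element of the triality algebra. -/
def triIm (i : Fin 3) : Tri K →ₗ[ℝ] K :=
  (1 / 3 : ℝ) • ((compL K (i + 2) - compL K (i + 1)).flip 1)

theorem triIm_apply (i : Fin 3) (T : Tri K) :
    triIm K i T = (1 / 3 : ℝ) • (Tri.comp T (i + 2) 1 - Tri.comp T (i + 1) 1) := rfl

theorem re_triIm (i : Fin 3) (T : Tri K) : re (triIm K i T) = 0 := by
  rw [triIm_apply, map_smul, map_sub, Tri.re_comp_one, Tri.re_comp_one, sub_zero, smul_zero]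

theorem sum_triIm (T : Tri K) : triIm K 0 T + triIm K 1 T + triIm K 2 T = 0 := by
  have e1 : (0 : Fin 3) + 1 = 1 := rfl
  have e2 : (0 : Fin 3) + 2 = 2 := rfl
  have e3 : (1 : Fin 3) + 1 = 2 := rfl
  have e4 : (1 : Fin 3) + 2 = 0 := rfl
  have e5 : (2 : Fin 3) + 1 = 0 := rfl
  have e6 : (2 : Fin 3) + 2 = 1 := rfl
  simp only [triIm_apply, e1, e2, e3, e4, e5, e6]
  module

theorem fin3_add_eq_zero {M : Type*} [AddCommMonoid M] {b : Fin 3 → M}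
    (hs : b 0 + b 1 + b 2 = 0) (i : Fin 3) : b i + b (i + 1) + b (i + 2) = 0 := by
  rw [← fin3_sum b i, Fin.sum_univ_three, hs]

/-- Explains the factor 1/3 in `triIm`: the equations T_i(1) = b_{i+1} - b_{i+2} and Σ b_j = 0 give
3b_i = T_{i+2}(1) - T_{i+1}(1). -/
theorem triIm_sub_triIm (T : Tri K) (i : Fin 3) :
    triIm K (i + 1) T - triIm K (i + 2) T = Tri.comp T i 1 := by
  have h := fin3_add_eq_zero (b := fun i => Tri.comp T i 1) (Tri.sum_comp_one T) i
  simp only [triIm_apply, fin3_one_one, fin3_one_two, fin3_two_one, fin3_two_two]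
  linear_combination (norm := module) (-1 / 3 : ℝ) • h

variable (K) in
/-- The derivation part of an element of the triality algebra. -/
def triDer : Tri K →ₗ[ℝ] Module.End ℝ K :=
  compL K 0 - (LinearMap.mul ℝ K) ∘ₗ triIm K 1 + (LinearMap.mul ℝ K).flip ∘ₗ triIm K 2

theorem triDer_apply (T : Tri K) (x : K) :
    triDer K T x = Tri.comp T 0 x - triIm K 1 T * x + x * triIm K 2 T := rfl

/-- If all components of `T` vanish at `1`, they coincide and are a derivation. -/
theorem Tri.comp_eq_of_one {T : Tri K} (h : ∀ i, Tri.comp T i 1 = 0) :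
    Tri.comp T 0 ∈ Der (LinearMap.mul ℝ K) ∧ ∀ i, Tri.comp T i = Tri.comp T 0 := by
  -- Since 1∘x = x̄ = x∘1, the triality relation at 1 compares T_i with each of the other two
  -- components.
  have h1 : ∀ i x, Tri.comp T i (conj x) = conj (Tri.comp T (i + 2) x) := fun i x => by
    rw [← para_one_left, Tri.comp_para, h, map_zero, LinearMap.zero_apply, zero_add,
      para_one_left]
  have h2 : ∀ i x, Tri.comp T i (conj x) = conj (Tri.comp T (i + 1) x) := fun i x => by
    rw [← para_one_right, Tri.comp_para, h, map_zero, add_zero, para_one_right]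
  have h3 : ∀ i, Tri.comp T (i + 1) = Tri.comp T (i + 2) := fun i => LinearMap.ext fun x => by
    rw [← conj_conj (Tri.comp T (i + 1) x), ← h2, h1, conj_conj]
  have e0 : Tri.comp T 0 = Tri.comp T 1 := h3 2
  have e1 : Tri.comp T 1 = Tri.comp T 2 := h3 0
  have h4 : ∀ i, Tri.comp T i = Tri.comp T 0 := fun i => by
    fin_cases i
    · rfl
    · exact e0.symm
    · exact (e0.trans e1).symm
  refine ⟨fun x y => ?_, h4⟩
  have h5 := h1 0 (x * y)
  have h6 := Tri.comp_zero_para T x y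
  rw [para_apply, h5, h4 (0 + 2), h4 1, h4 2, para_apply, para_apply, ← map_add] at h6
  have := congrArg conj h6
  rw [conj_conj, conj_conj] at this
  exact this

/-- Subtract from T the triality element with derivation part 0 and the same imaginary parts; the
remainder kills 1 in all components, hence is a single derivation. -/
theorem triDer_aux (T : Tri K) : triDer K T ∈ Der (LinearMap.mul ℝ K) ∧
    ∀ i, Tri.comp T i = derComp (triDer K T) (fun j => triIm K j T) i := by
  have h0 : (0 : Module.End ℝ K) ∈ Der (LinearMap.mul ℝ K) := zero_mem _
  let V : Tri K := triOfDer h0 (b := fun j => triIm K j T) (fun i => re_triIm i T) (sum_triIm T)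
  have hV : ∀ i x, Tri.comp (T - V) i x
      = Tri.comp T i x - (triIm K (i + 1) T * x - x * triIm K (i + 2) T) := fun i x => by
    rw [← compL_apply, map_sub, compL_apply, compL_apply, comp_triOfDer, LinearMap.sub_apply,
      derComp_apply, LinearMap.zero_apply, zero_add]
  have h1 : ∀ i, Tri.comp (T - V) i 1 = 0 := fun i => by
    rw [hV, mul_one, one_mul, triIm_sub_triIm, sub_self]
  obtain ⟨h2, h3⟩ := Tri.comp_eq_of_one h1
  have h4 : Tri.comp (T - V) 0 = triDer K T := LinearMap.ext fun x => by
    rw [hV, triDer_apply]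
    change Tri.comp T 0 x - (triIm K 1 T * x - x * triIm K 2 T) = _
    abel
  rw [h4] at h2 h3
  refine ⟨h2, fun i => LinearMap.ext fun x => ?_⟩
  rw [derComp_apply, ← h3 i, hV]
  abel

theorem triDer_mem (T : Tri K) : triDer K T ∈ Der (LinearMap.mul ℝ K) := (triDer_aux T).1

theorem comp_eq_derComp (T : Tri K) (i : Fin 3) (x : K) : Tri.comp T i x
    = triDer K T x + triIm K (i + 1) T * x - x * triIm K (i + 2) T := by
  rw [(triDer_aux T).2 i, derComp_apply]

/-- Uniqueness of the parts: with D(1) = 0 and Σ b_j = 0, the b_j are determined by the values at 1.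
Later computations only exhibit some D and b. -/
theorem triIm_eq {T : Tri K} {D : Module.End ℝ K} {b : Fin 3 → K} (hD : D 1 = 0)
    (hs : b 0 + b 1 + b 2 = 0) (h : ∀ i, Tri.comp T i = derComp D b i) (i : Fin 3) :
    triIm K i T = b i := by
  have h' := fin3_add_eq_zero hs i
  rw [triIm_apply, h, h, derComp_apply, derComp_apply]
  simp only [hD, mul_one, one_mul, fin3_one_one, fin3_one_two, fin3_two_one, fin3_two_two]
  linear_combination (norm := module) (-1 / 3 : ℝ) • h'

theorem triDer_eq {T : Tri K} {D : Module.End ℝ K} {b : Fin 3 → K} (hD : D 1 = 0)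
    (hs : b 0 + b 1 + b 2 = 0) (h : ∀ i, Tri.comp T i = derComp D b i) : triDer K T = D := by
  ext x
  rw [triDer_apply, triIm_eq hD hs h, triIm_eq hD hs h, h, derComp_apply]
  change D x + b 1 * x - x * b 2 - b 1 * x + x * b 2 = D x
  abel

/-! ### Brackets in terms of derivation and imaginary parts -/

theorem derivD_eq (x y z : K) : derivD x y z
    = (x * y - y * x) * z - z * (x * y - y * x) - (3 : ℝ) • (x * (z * y) - (x * z) * y) := by
  obtain ⟨t, h1, h2, h3, h4, h5, h6⟩ := exists_associator x y z
  simp only [derivD_apply, sub_mul, mul_sub, h1, h3, h4, h5, h6]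
  module

theorem derivD_one (x y : K) : derivD x y 1 = 0 := by
  rw [derivD_eq]
  simp

/-- The b_j are those forced by the values at 1: the i-th component of θ^{-i}T_{x,y} sends 1 to 4(Re
x y - Re y x), the next one to [x,y] - 2(Re x y - Re y x). -/
theorem triIm_triTL_aux (i : Fin 3) (x y : K) :
    ∃ b : Fin 3 → K, (b i = -(2 / 3 : ℝ) • (x * y - y * x) ∧
      b (i + 1) = (2 : ℝ) • (re x • y - re y • x) + (1 / 3 : ℝ) • (x * y - y * x) ∧
      b (i + 2) = -(2 : ℝ) • (re x • y - re y • x) + (1 / 3 : ℝ) • (x * y - y * x)) ∧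
      b 0 + b 1 + b 2 = 0 ∧
      ∀ j, Tri.comp (triTL K i x y) j = derComp ((2 / 3 : ℝ) • derivD x y) b j := by
  refine ⟨fun j => if j = i then -(2 / 3 : ℝ) • (x * y - y * x) else if j = i + 1 then
    (2 : ℝ) • (re x • y - re y • x) + (1 / 3 : ℝ) • (x * y - y * x) else
      -(2 : ℝ) • (re x • y - re y • x) + (1 / 3 : ℝ) • (x * y - y * x), ?_⟩
  generalize hb : (fun j => if j = i then -(2 / 3 : ℝ) • (x * y - y * x) else if j = i + 1 then
    (2 : ℝ) • (re x • y - re y • x) + (1 / 3 : ℝ) • (x * y - y * x) else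
      -(2 : ℝ) • (re x • y - re y • x) + (1 / 3 : ℝ) • (x * y - y * x)) = b
  have h0 : b i = -(2 / 3 : ℝ) • (x * y - y * x) := by simp [← hb]
  have h1 : b (i + 1) = (2 : ℝ) • (re x • y - re y • x) + (1 / 3 : ℝ) • (x * y - y * x) := by
    simp [← hb]
  have h2 : b (i + 2) = -(2 : ℝ) • (re x • y - re y • x) + (1 / 3 : ℝ) • (x * y - y * x) := by
    simp [← hb, (fin3_one_ne_two i).symm]
  refine ⟨⟨h0, h1, h2⟩, ?_, fun j => LinearMap.ext fun z => ?_⟩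
  · rw [← Fin.sum_univ_three, fin3_sum b i, h0, h1, h2]
    module
  · rw [derComp_apply, LinearMap.smul_apply, derivD_eq]
    obtain ⟨t, a1, a2, a3, a4, a5, a6⟩ := exists_associator x y z
    obtain rfl | rfl | rfl := fin3_cases i j
    · rw [comp_triTL_self, h1, h2]
      have c1 := conj_mul_add x z y
      have c2 := mul_conj_add x z y
      have c3 := conj_mul_add y z x
      have c4 := mul_conj_add y z x
      simp only [conj_apply, ← re_apply, sub_mul, mul_sub, smul_mul_assoc, mul_smul_comm, one_mul,
        mul_one, a2, a3, a5, a6] at c1 c2 c3 c4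
      simp only [sub_mul, mul_sub, add_mul, mul_add, smul_mul_assoc, mul_smul_comm, a3, a5, a6]
      linear_combination (norm := module) c3 + c4 - c1 - c2
    · rw [comp_triTL_one, fin3_one_one, fin3_one_two, h0, h2]
      simp only [para_apply, conj_mul _ x, conj_mul _ y, conj_conj]
      simp only [conj_apply, ← re_apply, sub_mul, mul_sub, add_mul, smul_mul_assoc,
        mul_smul_comm, one_mul, a1, a3, a4, a5, a6]
      module
    · rw [comp_triTL_two, fin3_two_one, fin3_two_two, h0, h1]
      simp only [para_apply, conj_mul x, conj_mul y, conj_conj]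
      simp only [conj_apply, ← re_apply, sub_mul, mul_sub, mul_add, smul_mul_assoc,
        mul_smul_comm, mul_one, a3, a5, a6]
      module

theorem triDer_triTL (i : Fin 3) (x y : K) :
    triDer K (triTL K i x y) = (2 / 3 : ℝ) • derivD x y := by
  obtain ⟨b, -, hs, h⟩ := triIm_triTL_aux i x y
  exact triDer_eq (by rw [LinearMap.smul_apply, derivD_one, smul_zero]) hs h

theorem triIm_triTL_self (i : Fin 3) (x y : K) :
    triIm K i (triTL K i x y) = -(2 / 3 : ℝ) • (x * y - y * x) := by
  obtain ⟨b, ⟨h0, -, -⟩, hs, h⟩ := triIm_triTL_aux i x y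
  rw [triIm_eq (by rw [LinearMap.smul_apply, derivD_one, smul_zero]) hs h, h0]

theorem triIm_triTL_one (i : Fin 3) (x y : K) : triIm K (i + 1) (triTL K i x y)
    = (2 : ℝ) • (re x • y - re y • x) + (1 / 3 : ℝ) • (x * y - y * x) := by
  obtain ⟨b, ⟨-, h1, -⟩, hs, h⟩ := triIm_triTL_aux i x y
  rw [triIm_eq (by rw [LinearMap.smul_apply, derivD_one, smul_zero]) hs h, h1]

theorem triIm_triTL_two (i : Fin 3) (x y : K) : triIm K (i + 2) (triTL K i x y)
    = -(2 : ℝ) • (re x • y - re y • x) + (1 / 3 : ℝ) • (x * y - y * x) := by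
  obtain ⟨b, ⟨-, -, h2⟩, hs, h⟩ := triIm_triTL_aux i x y
  rw [triIm_eq (by rw [LinearMap.smul_apply, derivD_one, smul_zero]) hs h, h2]

/-- The derivation part of a commutator of multiplications occurring in the triality algebra. -/
theorem lie_mulLeft_sub_mulRight {p q r p' q' r' : K} (h : p + q + r = 0)
    (h' : p' + q' + r' = 0) (z : K) :
    (p * (p' * z - z * q') - (p' * z - z * q') * q)
        - (p' * (p * z - z * q) - (p * z - z * q) * q')
      = (1 / 3 : ℝ) • (derivD p p' z + derivD q q' z + derivD r r' z)
        + ((p * p' - p' * p) - (1 / 3 : ℝ) • ((p * p' - p' * p) + (q * q' - q' * q)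
          + (r * r' - r' * r))) * z
        - z * ((q * q' - q' * q) - (1 / 3 : ℝ) • ((p * p' - p' * p) + (q * q' - q' * q)
          + (r * r' - r' * r))) := by
  obtain rfl : r = -(p + q) := (neg_eq_of_add_eq_zero_right h).symm
  obtain rfl : r' = -(p' + q') := (neg_eq_of_add_eq_zero_right h').symm
  obtain ⟨t1, a1, a2, a3, a4, a5, a6⟩ := exists_associator p p' z
  obtain ⟨t2, b1, b2, b3, b4, b5, b6⟩ := exists_associator q q' z
  obtain ⟨t3, c1, c2, c3, c4, c5, c6⟩ := exists_associator p q' z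
  obtain ⟨t4, d1, d2, d3, d4, d5, d6⟩ := exists_associator q p' z
  simp only [derivD_eq, neg_mul, mul_neg, mul_add, add_mul, mul_sub, sub_mul, smul_mul_assoc,
    mul_smul_comm, a1, a3, a4, a5, a6, b3, b5, b6, c3, c5,
    c6, d2, d3, d5, d6]
  module

/-- Subtracting the mean of the commutators keeps the sum of the imaginary parts zero. These are the
Tits brackets on diagonal elements: 1/3 is the coefficient of `derivD` there, and ½(e_j * e_j) = e_j
- (1/3)Σe_l produces the mean. -/
theorem tri_lie_aux (S T : Tri K) (i : Fin 3) : Tri.comp ⁅S, T⁆ i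
    = derComp (⁅triDer K S, triDer K T⁆
        + (1 / 3 : ℝ) • ∑ j, derivD (triIm K j S) (triIm K j T))
      (fun j => triDer K S (triIm K j T) - triDer K T (triIm K j S)
        + ((triIm K j S * triIm K j T - triIm K j T * triIm K j S)
        - (1 / 3 : ℝ) • ∑ l, (triIm K l S * triIm K l T - triIm K l T * triIm K l S))) i := by
  -- The shift by one makes (p, q, r) equal to (b_{i+1}, b_{i+2}, b_i), so that p acts on the left
  -- and q on the right.
  have hS := fin3_add_eq_zero (b := fun j => triIm K j S) (sum_triIm S) (i + 1)
  have hT := fin3_add_eq_zero (b := fun j => triIm K j T) (sum_triIm T) (i + 1)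
  ext z
  have h := lie_mulLeft_sub_mulRight hS hT z
  rw [Tri.comp_lie, Ring.lie_def, derComp_apply, fin3_sum _ (i + 1), fin3_sum _ (i + 1),
    Ring.lie_def]
  simp only [fin3_one_one, fin3_one_two, LinearMap.sub_apply, LinearMap.add_apply,
    LinearMap.smul_apply, Module.End.mul_apply, comp_eq_derComp, map_add, map_sub,
    mem_der_mul.1 (triDer_mem S), mem_der_mul.1 (triDer_mem T)] at h ⊢
  simp only [mul_add, add_mul, mul_sub, sub_mul, smul_mul_assoc, mul_smul_comm] at h ⊢
  linear_combination (norm := module) h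

theorem tri_lie_aux_one (S T : Tri K) : (⁅triDer K S, triDer K T⁆
    + (1 / 3 : ℝ) • ∑ j, derivD (triIm K j S) (triIm K j T)) 1 = 0 := by
  have h : (⁅triDer K S, triDer K T⁆ : Module.End ℝ K) 1 = 0 :=
    der_one ((Der (LinearMap.mul ℝ K)).lie_mem (triDer_mem S) (triDer_mem T))
  rw [LinearMap.add_apply, h, LinearMap.smul_apply, LinearMap.sum_apply,
    Finset.sum_eq_zero fun j _ => derivD_one _ _, smul_zero, add_zero]

theorem tri_lie_aux_sum (S T : Tri K) : ∀ b : Fin 3 → K,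
    b = (fun j => triDer K S (triIm K j T) - triDer K T (triIm K j S)
        + ((triIm K j S * triIm K j T - triIm K j T * triIm K j S)
        - (1 / 3 : ℝ) • ∑ l, (triIm K l S * triIm K l T - triIm K l T * triIm K l S))) →
    b 0 + b 1 + b 2 = 0 := by
  rintro b rfl
  have hS := congrArg (triDer K T) (sum_triIm S)
  have hT := congrArg (triDer K S) (sum_triIm T)
  simp only [map_add, map_zero] at hS hT
  simp only [Fin.sum_univ_three]
  linear_combination (norm := module) hT - hS

theorem triIm_lie (S T : Tri K) (j : Fin 3) : triIm K j ⁅S, T⁆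
    = triDer K S (triIm K j T) - triDer K T (triIm K j S)
        + ((triIm K j S * triIm K j T - triIm K j T * triIm K j S)
        - (1 / 3 : ℝ) • ∑ l, (triIm K l S * triIm K l T - triIm K l T * triIm K l S)) :=
  triIm_eq (tri_lie_aux_one S T) (tri_lie_aux_sum S T _ rfl) (tri_lie_aux S T) j

theorem triDer_lie (S T : Tri K) : triDer K ⁅S, T⁆
    = ⁅triDer K S, triDer K T⁆ + (1 / 3 : ℝ) • ∑ j, derivD (triIm K j S) (triIm K j T) :=
  triDer_eq (tri_lie_aux_one S T) (tri_lie_aux_sum S T _ rfl) (tri_lie_aux S T)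

end TriDer

/-! ### Coordinates on `H₃(K)` -/

section Jordan

variable {K : Type*} [NonAssocRing K] [Module ℝ K] [CompositionAlgebra K]

theorem fin3_ne (i : Fin 3) : i + 1 ≠ i ∧ i + 2 ≠ i ∧ i + 1 ≠ i + 2 ∧ i ≠ i + 1 ∧ i ≠ i + 2 ∧
    i + 2 ≠ i + 1 := by
  revert i; decide

theorem H3.ext {X Y : H3 K} (h : X.1 = Y.1) : X = Y := Subtype.ext h

theorem H3.val_zero : (0 : H3 K).1 = 0 := rfl

variable (K) in
/-- The diagonal idempotents. -/
def H3.e (i : Fin 3) : H3 K := ⟨Matrix.single i i 1, fun a b => by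
  rw [Matrix.single_apply, Matrix.single_apply, apply_ite conj, conj_one, map_zero]
  simp only [and_comm]⟩

variable (K) in
/-- The off-diagonal hermitian matrices. -/
def H3.P (i : Fin 3) : K →ₗ[ℝ] H3 K where
  toFun x := ⟨Matrix.single (i + 1) (i + 2) x + Matrix.single (i + 2) (i + 1) (conj x),
    fun a b => by
      simp only [Matrix.add_apply, Matrix.single_apply, map_add, apply_ite conj, map_zero,
        conj_conj]
      rw [add_comm]
      simp only [and_comm]⟩
  map_add' x y := H3.ext (by
    change Matrix.single _ _ _ + Matrix.single _ _ _
      = (Matrix.single _ _ _ + Matrix.single _ _ _) + (Matrix.single _ _ _ + Matrix.single _ _ _)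
    rw [map_add, Matrix.single_add, Matrix.single_add]
    abel)
  map_smul' r x := H3.ext (by
    change Matrix.single _ _ _ + Matrix.single _ _ _
      = r • (Matrix.single _ _ _ + Matrix.single _ _ _)
    rw [map_smul, smul_add, Matrix.smul_single, Matrix.smul_single])

theorem H3.val_e (i : Fin 3) : (H3.e K i).1 = Matrix.single i i 1 := rfl

theorem H3.val_P (i : Fin 3) (x : K) : (H3.P K i x).1
    = Matrix.single (i + 1) (i + 2) x + Matrix.single (i + 2) (i + 1) (conj x) := rfl

variable (K) in
/-- The diagonal coordinates. -/
def H3.diagCoord (i : Fin 3) : H3 K →ₗ[ℝ] ℝ where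
  toFun X := re (X.1 i i)
  map_add' X Y := by simp
  map_smul' r X := by simp

variable (K) in
/-- The off-diagonal coordinates. -/
def H3.offCoord (i : Fin 3) : H3 K →ₗ[ℝ] K where
  toFun X := X.1 (i + 1) (i + 2)
  map_add' X Y := by simp
  map_smul' r X := by simp

theorem H3.diagCoord_e (i j : Fin 3) : H3.diagCoord K i (H3.e K j) = if i = j then 1 else 0 := by
  change re ((Matrix.single j j (1 : K)) i i) = _
  by_cases h : i = j
  · subst h
    simp [re_one]
  · simp [h, Ne.symm h]

theorem H3.diagCoord_P (i j : Fin 3) (x : K) : H3.diagCoord K i (H3.P K j x) = 0 := by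
  change re ((H3.P K j x).1 i i) = _
  rw [H3.val_P]
  obtain ⟨h1, h2, h3, h4, h5, h6⟩ := fin3_ne j
  obtain rfl | rfl | rfl := fin3_cases j i <;>
    simp

theorem H3.offCoord_e (i j : Fin 3) : H3.offCoord K i (H3.e K j) = 0 := by
  change (Matrix.single j j (1 : K)) (i + 1) (i + 2) = _
  rw [Matrix.single_apply, if_neg]
  rintro ⟨rfl, h⟩
  exact fin3_one_ne_two i h

theorem H3.offCoord_P (i j : Fin 3) (x : K) :
    H3.offCoord K i (H3.P K j x) = if i = j then x else 0 := by
  change (H3.P K j x).1 (i + 1) (i + 2) = _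
  rw [H3.val_P]
  obtain ⟨h1, h2, h3, h4, h5, h6⟩ := fin3_ne j
  obtain rfl | rfl | rfl := fin3_cases j i <;>
    simp [fin3_one_one, fin3_one_two, fin3_two_one, fin3_two_two, h3, h6]

theorem eq_re_smul_one {x : K} (h : x = conj x) : x = re x • (1 : K) := by
  rw [conj_apply, ← re_apply] at h
  linear_combination (norm := module) (1 / 2 : ℝ) • h

theorem H3.eq_sum (X : H3 K) : X = ∑ i, (H3.diagCoord K i X • H3.e K i
    + H3.P K i (H3.offCoord K i X)) := by
  refine H3.ext (Matrix.ext fun a b => ?_)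
  have hv : ∀ X Y Z : H3 K, (X + Y + Z).1 = X.1 + Y.1 + Z.1 := fun _ _ _ => rfl
  have hd : ∀ i, X.1 i i = re (X.1 i i) • (1 : K) := fun i => eq_re_smul_one (X.2 i i)
  rw [fin3_sum _ a, hv]
  simp only [H3.val_add, H3.val_smul, H3.val_e, H3.val_P, Matrix.add_apply, Matrix.smul_apply]
  have h1 : ∀ i, H3.diagCoord K i X = re (X.1 i i) := fun _ => rfl
  have h2 : ∀ i, H3.offCoord K i X = X.1 (i + 1) (i + 2) := fun _ => rfl
  obtain ⟨n1, n2, n3, n4, n5, n6⟩ := fin3_ne a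
  simp only [h1, h2, fin3_one_one, fin3_one_two, fin3_two_one, fin3_two_two]
  obtain rfl | rfl | rfl := fin3_cases a b
  · rw [hd b]
    simp [n1, n2, re_one]
  · rw [X.2 a (a + 1)]
    simp [n1, n2, n4, n6]
  · rw [X.2 a (a + 2)]
    simp [n1, n2, n3, n5]

theorem H3.hom_ext {W : Type*} [AddCommMonoid W] [Module ℝ W] {f g : H3 K →ₗ[ℝ] W}
    (he : ∀ i, f (H3.e K i) = g (H3.e K i)) (hP : ∀ i x, f (H3.P K i x) = g (H3.P K i x)) :
    f = g := by
  ext X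
  rw [H3.eq_sum X]
  simp only [map_sum, map_add, map_smul, he, hP]

theorem jordan_val (X Y : H3 K) : (jordan X Y).1 = X.1 * Y.1 + Y.1 * X.1 := rfl

/-! ### Multiplication table and inner products of the generators of H₃(K) -/

theorem jordan_e_self (i : Fin 3) : jordan (H3.e K i) (H3.e K i) = (2 : ℝ) • H3.e K i := by
  refine H3.ext ?_
  rw [jordan_val, H3.val_smul, H3.val_e, Matrix.single_mul_single_same, mul_one, two_smul]

theorem jordan_e_ne {i j : Fin 3} (h : i ≠ j) : jordan (H3.e K i) (H3.e K j) = 0 := by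
  refine H3.ext ?_
  rw [jordan_val, H3.val_zero, H3.val_e, H3.val_e, Matrix.single_mul_single_of_ne (h := h),
    Matrix.single_mul_single_of_ne (h := h.symm), add_zero]

theorem jordan_e_P_self (i : Fin 3) (x : K) : jordan (H3.e K i) (H3.P K i x) = 0 := by
  obtain ⟨n1, n2, n3, n4, n5, n6⟩ := fin3_ne i
  refine H3.ext ?_
  rw [jordan_val, H3.val_zero, H3.val_e, H3.val_P]
  simp [mul_add, add_mul, n1, n2, n4, n5]

theorem jordan_e_P_one (i : Fin 3) (x : K) :
    jordan (H3.e K (i + 1)) (H3.P K i x) = H3.P K i x := by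
  obtain ⟨n1, n2, n3, n4, n5, n6⟩ := fin3_ne i
  refine H3.ext ?_
  rw [jordan_val, H3.val_e, H3.val_P]
  simp [mul_add, add_mul, n3, n6]

theorem jordan_e_P_two (i : Fin 3) (x : K) :
    jordan (H3.e K (i + 2)) (H3.P K i x) = H3.P K i x := by
  obtain ⟨n1, n2, n3, n4, n5, n6⟩ := fin3_ne i
  refine H3.ext ?_
  rw [jordan_val, H3.val_e, H3.val_P]
  simp [mul_add, add_mul, n3, n6]
  abel

theorem mul_conj_add_mul_conj (x y : K) : x * conj y + y * conj x = (2 * ip K x y) • (1 : K) := by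
  have := conj_mul_add x y 1
  rwa [mul_one, mul_one] at this

theorem conj_mul_add_conj_mul (x y : K) : conj x * y + conj y * x = (2 * ip K x y) • (1 : K) := by
  have := mul_conj_add_mul_conj (conj x) (conj y)
  rwa [conj_conj, conj_conj, ip_conj] at this

theorem jordan_P_self (i : Fin 3) (x y : K) : jordan (H3.P K i x) (H3.P K i y)
    = (2 * ip K x y) • (H3.e K (i + 1) + H3.e K (i + 2)) := by
  obtain ⟨n1, n2, n3, n4, n5, n6⟩ := fin3_ne i
  refine H3.ext ?_
  rw [jordan_val, H3.val_smul, H3.val_add, H3.val_P, H3.val_P, H3.val_e, H3.val_e, smul_add,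
    Matrix.smul_single, Matrix.smul_single]
  nth_rewrite 1 [← mul_conj_add_mul_conj]
  rw [← conj_mul_add_conj_mul]
  simp [mul_add, add_mul, n3, n6, Matrix.single_add]
  abel

/-- The entry xy lands in position (i+1, i), below the coordinate position of `H3.P K (i + 2)`; the
conjugation this costs is why ∘ appears. -/
theorem jordan_P_one (i : Fin 3) (x y : K) : jordan (H3.P K i x) (H3.P K (i + 1) y)
    = H3.P K (i + 2) (para K x y) := by
  obtain ⟨n1, n2, n3, n4, n5, n6⟩ := fin3_ne i
  refine H3.ext ?_
  rw [jordan_val, H3.val_P, H3.val_P, H3.val_P]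
  simp [mul_add, add_mul, n1, n2, n3, n4, n5, n6, fin3_one_one, fin3_one_two, fin3_two_one,
    fin3_two_two, para_apply, conj_conj, ← conj_mul]
  abel

theorem re_trace_e (i : Fin 3) : re (Matrix.trace (H3.e K i).1) = 1 := by
  rw [H3.val_e, Matrix.trace_single_eq_same, re_one]

theorem re_trace_P (i : Fin 3) (x : K) : re (Matrix.trace (H3.P K i x).1) = 0 := by
  obtain ⟨n1, n2, n3, n4, n5, n6⟩ := fin3_ne i
  rw [H3.val_P, Matrix.trace_add, Matrix.trace_single_eq_of_ne _ _ _ n3,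
    Matrix.trace_single_eq_of_ne _ _ _ n6, add_zero, map_zero]

theorem ipH_apply (X Y : H3 K) : ipH X Y = 1 / 2 * re (Matrix.trace (jordan X Y).1) := rfl

theorem ipH_e_self (i : Fin 3) : ipH (H3.e K i) (H3.e K i) = 1 := by
  rw [ipH_apply, jordan_e_self, H3.val_smul, Matrix.trace_smul, map_smul, re_trace_e]
  norm_num

theorem ipH_e_ne {i j : Fin 3} (h : i ≠ j) : ipH (H3.e K i) (H3.e K j) = 0 := by
  rw [ipH_apply, jordan_e_ne h, H3.val_zero, Matrix.trace_zero, map_zero, mul_zero]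

theorem ipH_e_P (i j : Fin 3) (x : K) : ipH (H3.e K i) (H3.P K j x) = 0 := by
  rw [ipH_apply]
  obtain rfl | rfl | rfl := fin3_cases j i
  · rw [jordan_e_P_self, H3.val_zero, Matrix.trace_zero, map_zero, mul_zero]
  · rw [jordan_e_P_one, re_trace_P, mul_zero]
  · rw [jordan_e_P_two, re_trace_P, mul_zero]

theorem ipH_P_self (i : Fin 3) (x y : K) : ipH (H3.P K i x) (H3.P K i y) = 2 * ip K x y := by
  rw [ipH_apply, jordan_P_self, H3.val_smul, H3.val_add, Matrix.trace_smul, Matrix.trace_add,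
    map_smul, map_add, re_trace_e, re_trace_e, smul_eq_mul]
  ring

theorem ipH_P_one (i : Fin 3) (x y : K) : ipH (H3.P K i x) (H3.P K (i + 1) y) = 0 := by
  rw [ipH_apply, jordan_P_one, re_trace_P, mul_zero]

theorem jordanOne_eq : jordanOne K = (1 / 2 : ℝ) • ∑ i, H3.e K i := by
  refine H3.ext ?_
  have h : (∑ i, H3.e K i).1 = ∑ i, Matrix.single i i (1 : K) := by
    rw [Fin.sum_univ_three, Fin.sum_univ_three]
    rfl
  rw [H3.val_smul, h, Matrix.sum_single_one]
  rfl

theorem mem_H3' {X : H3 K} : X ∈ H3' K ↔ ∑ i, H3.diagCoord K i X = 0 := by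
  have h : ipH (jordanOne K) = (1 / 2 : ℝ) • ∑ i, H3.diagCoord K i := by
    refine H3.hom_ext (fun i => ?_) fun i x => ?_
    · rw [jordanOne_eq]
      simp only [map_smul, map_sum, LinearMap.smul_apply, LinearMap.sum_apply, H3.diagCoord_e]
      rw [Finset.sum_eq_single i (fun j _ hj => ipH_e_ne hj) (by simp), ipH_e_self]
      simp
    · rw [jordanOne_eq]
      simp only [map_smul, map_sum, LinearMap.smul_apply, LinearMap.sum_apply, H3.diagCoord_P,
        ipH_e_P]
  rw [H3', LinearMap.mem_ker, h, LinearMap.smul_apply, LinearMap.sum_apply, smul_eq_zero]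
  simp

/-- The derivation property of an endomorphism of `H₃(K)` can be checked on the generators. -/
theorem mem_der_jordan {d : Module.End ℝ (H3 K)}
    (hes : ∀ i, d (jordan (H3.e K i) (H3.e K i))
      = jordan (d (H3.e K i)) (H3.e K i) + jordan (H3.e K i) (d (H3.e K i)))
    (hee : ∀ i, d (jordan (H3.e K i) (H3.e K (i + 1)))
      = jordan (d (H3.e K i)) (H3.e K (i + 1)) + jordan (H3.e K i) (d (H3.e K (i + 1))))
    (heP : ∀ i j x, d (jordan (H3.e K i) (H3.P K j x))
      = jordan (d (H3.e K i)) (H3.P K j x) + jordan (H3.e K i) (d (H3.P K j x)))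
    (hPs : ∀ i x y, d (jordan (H3.P K i x) (H3.P K i y))
      = jordan (d (H3.P K i x)) (H3.P K i y) + jordan (H3.P K i x) (d (H3.P K i y)))
    (hPP : ∀ i x y, d (jordan (H3.P K i x) (H3.P K (i + 1) y))
      = jordan (d (H3.P K i x)) (H3.P K (i + 1) y) + jordan (H3.P K i x) (d (H3.P K (i + 1) y))) :
    d ∈ Der (jordan (K := K)) := by
  have swap : ∀ X Y, d (jordan X Y) = jordan (d X) Y + jordan X (d Y) →
      d (jordan Y X) = jordan (d Y) X + jordan Y (d X) := fun X Y h => by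
    rw [jordan_comm Y X, h, jordan_comm (d Y) X, jordan_comm Y (d X), add_comm]
  have hext : ∀ X, (∀ i, d (jordan X (H3.e K i)) = jordan (d X) (H3.e K i) + jordan X (d (H3.e K i)))
      → (∀ i x, d (jordan X (H3.P K i x)) = jordan (d X) (H3.P K i x) + jordan X (d (H3.P K i x)))
      → ∀ Y, d (jordan X Y) = jordan (d X) Y + jordan X (d Y) := fun X h1 h2 Y => by
    have : d ∘ₗ jordan X = jordan (d X) + jordan X ∘ₗ d := H3.hom_ext h1 h2
    exact LinearMap.congr_fun this Y
  intro X Y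
  refine hext X (fun i => swap _ _ (hext _ (fun j => ?_) (fun j x => heP i j x) X))
    (fun i x => swap _ _ (hext _ (fun j => swap _ _ (heP j i x)) (fun j y => ?_) X)) Y
  · obtain rfl | rfl | rfl := fin3_cases i j
    · exact hes _
    · exact hee _
    · have := hee (i + 2)
      rw [fin3_two_one] at this
      exact swap _ _ this
  · obtain rfl | rfl | rfl := fin3_cases i j
    · exact hPs _ _ _
    · exact hPP _ _ _
    · have := hPP (i + 2) y x
      rw [fin3_two_one] at this
      exact swap _ _ this

end Jordan

/-! ### Derivations of `H₃(K)` -/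

section JordanDer

variable {K : Type*} [NonAssocRing K] [Module ℝ K] [CompositionAlgebra K]

theorem jordan_e_e (i j : Fin 3) :
    jordan (H3.e K i) (H3.e K j) = if i = j then (2 : ℝ) • H3.e K i else 0 := by
  split_ifs with h
  · rw [← h, jordan_e_self]
  · exact jordan_e_ne h

theorem jordan_e_P (i j : Fin 3) (x : K) :
    jordan (H3.e K i) (H3.P K j x) = if i = j then 0 else H3.P K j x := by
  obtain ⟨n1, n2, -⟩ := fin3_ne j
  obtain rfl | rfl | rfl := fin3_cases j i
  · rw [jordan_e_P_self, if_pos rfl]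
  · rw [jordan_e_P_one, if_neg n1]
  · rw [jordan_e_P_two, if_neg n2]

theorem jordan_P_e (i j : Fin 3) (x : K) :
    jordan (H3.P K j x) (H3.e K i) = if i = j then 0 else H3.P K j x := by
  rw [jordan_comm, jordan_e_P]

theorem jordan_P_one_two (i : Fin 3) (x y : K) :
    jordan (H3.P K (i + 1) x) (H3.P K (i + 2) y) = H3.P K i (para K x y) := by
  have := jordan_P_one (i + 1) x y
  rwa [fin3_one_one, fin3_one_two] at this

theorem jordan_P_two_self (i : Fin 3) (x y : K) :
    jordan (H3.P K (i + 2) x) (H3.P K i y) = H3.P K (i + 1) (para K x y) := by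
  have := jordan_P_one (i + 2) x y
  rwa [fin3_two_one, fin3_two_two] at this

theorem jordan_P_one_self (i : Fin 3) (x y : K) :
    jordan (H3.P K (i + 1) x) (H3.P K i y) = H3.P K (i + 2) (para K y x) := by
  rw [jordan_comm, jordan_P_one]

theorem jordan_P_two_one (i : Fin 3) (x y : K) :
    jordan (H3.P K (i + 2) x) (H3.P K (i + 1) y) = H3.P K i (para K y x) := by
  rw [jordan_comm, jordan_P_one_two]

theorem jordan_P_two (i : Fin 3) (x y : K) :
    jordan (H3.P K i x) (H3.P K (i + 2) y) = H3.P K (i + 1) (para K y x) := by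
  rw [jordan_comm, jordan_P_two_self]

theorem commL_apply (X Y Z : H3 K) :
    commL X Y Z = jordan X (jordan Y Z) - jordan Y (jordan X Z) := rfl

variable (K) in
/-- The derivations `[L_{e_{i+1}}, L_{P_i(x)}]` of `H₃(K)`. -/
def offDer (i : Fin 3) : K →ₗ[ℝ] Module.End ℝ (H3 K) := commL (H3.e K (i + 1)) ∘ₗ H3.P K i

theorem offDer_apply (i : Fin 3) (x : K) (Z : H3 K) : offDer K i x Z
    = jordan (H3.e K (i + 1)) (jordan (H3.P K i x) Z)
      - jordan (H3.P K i x) (jordan (H3.e K (i + 1)) Z) := rfl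

theorem offDer_e_self (i : Fin 3) (x : K) : offDer K i x (H3.e K i) = 0 := by
  obtain ⟨n1, n2, n3, n4, n5, n6⟩ := fin3_ne i
  simp [offDer_apply, jordan_P_e, jordan_e_e, n1]

theorem offDer_e_one (i : Fin 3) (x : K) : offDer K i x (H3.e K (i + 1)) = -H3.P K i x := by
  obtain ⟨n1, n2, n3, n4, n5, n6⟩ := fin3_ne i
  simp [offDer_apply, jordan_P_e, jordan_e_P, jordan_e_e, n1, two_smul]

theorem offDer_e_two (i : Fin 3) (x : K) : offDer K i x (H3.e K (i + 2)) = H3.P K i x := by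
  obtain ⟨n1, n2, n3, n4, n5, n6⟩ := fin3_ne i
  simp [offDer_apply, jordan_P_e, jordan_e_P, jordan_e_e, n1, n2, n3]

theorem offDer_P_self (i : Fin 3) (x y : K) : offDer K i x (H3.P K i y)
    = (2 * ip K x y) • (H3.e K (i + 1) - H3.e K (i + 2)) := by
  obtain ⟨n1, n2, n3, n4, n5, n6⟩ := fin3_ne i
  simp only [offDer_apply, jordan_P_self, jordan_e_P, jordan_e_e, n1, n3, map_smul, map_add,
    if_true, if_false]
  module

theorem offDer_P_one (i : Fin 3) (x y : K) : offDer K i x (H3.P K (i + 1) y)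
    = H3.P K (i + 2) (para K x y) := by
  obtain ⟨n1, n2, n3, n4, n5, n6⟩ := fin3_ne i
  simp [offDer_apply, jordan_P_one, jordan_e_P, n3]

theorem offDer_P_two (i : Fin 3) (x y : K) : offDer K i x (H3.P K (i + 2) y)
    = -H3.P K (i + 1) (para K y x) := by
  obtain ⟨n1, n2, n3, n4, n5, n6⟩ := fin3_ne i
  simp [offDer_apply, jordan_P_two, jordan_e_P, n3]

variable (K) in
/-- The derivations of `H₃(K)` annihilating the diagonal. -/
def triDerH : Tri K →ₗ[ℝ] Module.End ℝ (H3 K) where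
  toFun T := ∑ i, H3.P K i ∘ₗ Tri.comp T i ∘ₗ H3.offCoord K i
  map_add' S T := by
    ext X : 1
    simp [Tri.comp_add, Finset.sum_add_distrib]
  map_smul' r T := by
    ext X : 1
    simp [Tri.comp_smul, Finset.smul_sum]

theorem triDerH_apply (T : Tri K) (X : H3 K) :
    triDerH K T X = ∑ i, H3.P K i (Tri.comp T i (H3.offCoord K i X)) := by
  simp [triDerH]

theorem triDerH_e (T : Tri K) (i : Fin 3) : triDerH K T (H3.e K i) = 0 := by
  simp [triDerH_apply, H3.offCoord_e]

theorem triDerH_P (T : Tri K) (i : Fin 3) (x : K) :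
    triDerH K T (H3.P K i x) = H3.P K i (Tri.comp T i x) := by
  rw [triDerH_apply, Finset.sum_eq_single i]
  · rw [H3.offCoord_P, if_pos rfl]
  · intro j _ hj
    rw [H3.offCoord_P, if_neg hj, map_zero, map_zero]
  · simp

/-- On products within one off-diagonal space this is skewness of T_i; on products of different ones
it is the triality relation. -/
theorem triDerH_mem (T : Tri K) : triDerH K T ∈ Der (jordan (K := K)) := by
  refine mem_der_jordan (fun i => ?_) (fun i => ?_) (fun i j x => ?_) (fun i x y => ?_)
    fun i x y => ?_
  · simp [jordan_e_self, triDerH_e]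
  · simp [jordan_e_ne, triDerH_e]
  · simp only [jordan_e_P, triDerH_e, triDerH_P, map_zero, LinearMap.zero_apply, zero_add]
    split_ifs
    · exact map_zero _
    · exact triDerH_P _ _ _
  · simp only [jordan_P_self, triDerH_e, triDerH_P, map_smul, map_add, smul_zero, add_zero,
      Tri.ip_comp, ← add_smul]
    rw [mul_neg, neg_add_cancel, zero_smul]
  · simp only [jordan_P_one, triDerH_P, ← map_add]
    rw [Tri.comp_para, fin3_two_one, fin3_two_two]

/-- Checked on generators with the composition identities for ∘, so that the Jordan identity is not
needed. -/
theorem offDer_mem (i : Fin 3) (z : K) : offDer K i z ∈ Der (jordan (K := K)) := by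
  obtain ⟨n1, n2, n3, n4, n5, n6⟩ := fin3_ne i
  refine mem_der_jordan (fun j => ?_) (fun j => ?_) (fun k j x => ?_) (fun j x y => ?_)
    fun j x y => ?_
  · obtain rfl | rfl | rfl := fin3_cases i j <;>
      simp [jordan_e_e, jordan_e_P, jordan_P_e, offDer_e_self, offDer_e_one, offDer_e_two, n1, n2,
        two_smul]
  · obtain rfl | rfl | rfl := fin3_cases i j <;>
      simp [jordan_e_e, jordan_e_P, jordan_P_e, offDer_e_self, offDer_e_one, offDer_e_two, n1, n2,
        n3, n4, fin3_one_one, fin3_two_one]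
  · have hk := fin3_cases i k
    obtain rfl | rfl | rfl := fin3_cases i j <;> obtain rfl | rfl | rfl := hk <;>
      simp only [jordan_e_e, jordan_e_P, offDer_e_self, offDer_e_one, offDer_e_two,
        offDer_P_self, offDer_P_one, offDer_P_two, n1, n2, jordan_P_self, jordan_P_one,
        jordan_P_two,
        n3, n4, n5, n6, map_zero, map_neg, map_smul, map_sub, LinearMap.zero_apply,
        LinearMap.neg_apply, if_true, if_false] <;>
      module
  · obtain rfl | rfl | rfl := fin3_cases i j
    · simp only [jordan_P_self, offDer_P_self, jordan_e_P, jordan_P_e, n1, n2, if_false, map_smul,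
        map_sub, map_add, LinearMap.smul_apply, LinearMap.sub_apply, offDer_e_one, offDer_e_two]
      module
    · simp only [jordan_P_self, offDer_P_one, jordan_P_two_one, jordan_P_one_two, map_smul,
        map_add, fin3_one_one, fin3_one_two, offDer_e_self, offDer_e_two]
      rw [← map_add, add_comm (para K y _), para_para_right, map_smul]
      module
    · simp only [jordan_P_self, offDer_P_two, jordan_P_two_one, jordan_P_one_two, map_smul,
        map_add, fin3_two_one, fin3_two_two, offDer_e_self, offDer_e_one, map_neg,
        LinearMap.neg_apply]
      rw [← neg_add, ← map_add, para_para_left,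
        map_smul]
      module
  · obtain rfl | rfl | rfl := fin3_cases i j
    · simp only [jordan_P_one, offDer_P_self, offDer_P_one, offDer_P_two, jordan_P_two,
        map_smul, map_sub, LinearMap.smul_apply, LinearMap.sub_apply, jordan_e_P, n6, if_true,
        if_false]
      have h := congrArg (H3.P K (j + 1)) (para_para_left x z y)
      rw [map_add, map_smul, ip_comm x] at h
      linear_combination (norm := module) -h
    · simp only [jordan_P_one_two, fin3_one_one, fin3_one_two, fin3_two_one, fin3_two_two, offDer_P_self, offDer_P_one,
        offDer_P_two, jordan_P_self, map_neg]
      rw [ip_para, ← ip_para x, ip_comm _ z]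
      module
    · simp only [jordan_P_two_self, fin3_two_one, offDer_P_self, offDer_P_one,
        offDer_P_two, map_smul, map_sub, jordan_P_e, map_neg,
        LinearMap.neg_apply, jordan_P_one_self, n3, if_true, if_false]
      have h := congrArg (H3.P K (i + 2)) (para_para_right z y x)
      rw [map_add, map_smul] at h
      linear_combination (norm := module) h

theorem triDerH_lie (S T : Tri K) : ⁅triDerH K S, triDerH K T⁆ = triDerH K ⁅S, T⁆ := by
  refine H3.hom_ext (fun i => ?_) fun i x => ?_
  · simp only [Ring.lie_def, LinearMap.sub_apply, Module.End.mul_apply, triDerH_e, map_zero,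
      sub_zero]
  · simp only [Ring.lie_def, LinearMap.sub_apply, Module.End.mul_apply, triDerH_P, Tri.comp_lie,
      map_sub]

theorem lie_triDerH_offDer (T : Tri K) (i : Fin 3) (x : K) :
    ⁅triDerH K T, offDer K i x⁆ = offDer K i (Tri.comp T i x) := by
  have key : ∀ X, triDerH K T (offDer K i x X) = offDer K i x (triDerH K T X)
      + offDer K i (Tri.comp T i x) X := fun X => by
    have h := triDerH_mem T
    rw [offDer_apply, offDer_apply, offDer_apply, map_sub, h, h, h, h, triDerH_e, triDerH_P]
    simp only [map_zero, map_add, LinearMap.zero_apply]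
    abel
  ext X : 1
  rw [Ring.lie_def, LinearMap.sub_apply, Module.End.mul_apply, Module.End.mul_apply, key,
    add_sub_cancel_left]

theorem lie_der_jordan {d : Module.End ℝ (H3 K)} (hd : d ∈ Der (jordan (K := K))) (X : H3 K) :
    ⁅d, (jordan X : Module.End ℝ (H3 K))⁆ = jordan (d X) := by
  ext Y : 1
  rw [Ring.lie_def, LinearMap.sub_apply, Module.End.mul_apply, Module.End.mul_apply, hd X Y,
    add_sub_cancel_right]

theorem lie_commL {d : Module.End ℝ (H3 K)} (hd : d ∈ Der (jordan (K := K))) (X Y : H3 K) :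
    ⁅d, commL X Y⁆ = commL (d X) Y + commL X (d Y) := by
  change ⁅d, ⁅(jordan X : Module.End ℝ (H3 K)), (jordan Y : Module.End ℝ (H3 K))⁆⁆
    = ⁅(jordan (d X) : Module.End ℝ (H3 K)), (jordan Y : Module.End ℝ (H3 K))⁆
      + ⁅(jordan X : Module.End ℝ (H3 K)), (jordan (d Y) : Module.End ℝ (H3 K))⁆
  rw [leibniz_lie, lie_der_jordan hd, lie_der_jordan hd]

/-! ### Commutators of multiplications by generators -/

theorem commL_e_e (i j : Fin 3) : commL (H3.e K i) (H3.e K j) = 0 := by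
  refine H3.hom_ext (fun k => ?_) fun k x => ?_ <;> by_cases hi : i = k <;> by_cases hj : j = k <;>
    simp [commL_apply, jordan_e_e, jordan_e_P, hi, hj]

theorem commL_e_P_self (i : Fin 3) (x : K) : commL (H3.e K i) (H3.P K i x) = 0 := by
  obtain ⟨n1, n2, n3, n4, n5, n6⟩ := fin3_ne i
  refine H3.hom_ext (fun j => ?_) fun j y => ?_ <;> obtain rfl | rfl | rfl := fin3_cases i j <;>
    simp [commL_apply, jordan_e_e, jordan_e_P, jordan_P_e, jordan_P_self, jordan_P_one,
      jordan_P_two, n1, n2, n4, n5]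

theorem commL_e_one_P (i : Fin 3) (x : K) :
    commL (H3.e K (i + 1)) (H3.P K i x) = offDer K i x := rfl

theorem commL_e_two_P (i : Fin 3) (x : K) :
    commL (H3.e K (i + 2)) (H3.P K i x) = -offDer K i x := by
  obtain ⟨n1, n2, n3, n4, n5, n6⟩ := fin3_ne i
  refine H3.hom_ext (fun j => ?_) fun j y => ?_ <;> obtain rfl | rfl | rfl := fin3_cases i j <;>
    simp [commL_apply, jordan_e_e, jordan_e_P, jordan_P_e, jordan_P_self, jordan_P_one,
      jordan_P_two, n1, n2, n6, offDer_e_self, offDer_e_one, offDer_e_two,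
      offDer_P_self, offDer_P_one, offDer_P_two]
  all_goals module

theorem commL_P_P_one (i : Fin 3) (x y : K) :
    commL (H3.P K i x) (H3.P K (i + 1) y) = -offDer K (i + 2) (para K x y) := by
  obtain ⟨n1, n2, n3, n4, n5, n6⟩ := fin3_ne i
  have h1 := offDer_e_one (i + 2) (para K x y)
  have h2 := offDer_e_two (i + 2) (para K x y)
  have h3 := fun z => offDer_P_one (i + 2) (para K x y) z
  have h4 := fun z => offDer_P_two (i + 2) (para K x y) z
  simp only [fin3_two_one, fin3_two_two] at h1 h2 h3 h4
  refine H3.hom_ext (fun j => ?_) fun j z => ?_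
  · obtain rfl | rfl | rfl := fin3_cases i j
    · simp only [commL_apply, jordan_P_e, n4, if_true, if_false, map_zero,
        LinearMap.neg_apply, h1, jordan_P_one]
      module
    · simp only [commL_apply, jordan_P_e, n1, if_true, if_false, map_zero,
        LinearMap.neg_apply, h2, jordan_P_one_self]
      module
    · simp only [commL_apply, jordan_P_e, n2, n6, if_false,
        LinearMap.neg_apply, offDer_e_self, jordan_P_one, jordan_P_one_self]
      module
  · obtain rfl | rfl | rfl := fin3_cases i j
    · simp only [commL_apply, jordan_P_self, jordan_P_one_self, map_smul, map_add, jordan_P_e,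
        jordan_P_two, n6, if_true, if_false, LinearMap.neg_apply, h3]
      have h := congrArg (H3.P K (j + 1)) (para_para_left x z y)
      rw [map_add, map_smul] at h
      linear_combination (norm := module) h
    · simp only [commL_apply, jordan_P_self, jordan_P_one, map_smul, map_add, jordan_P_e,
        jordan_P_one_two, fin3_one_one, fin3_one_two, n2, if_true, if_false,
        LinearMap.neg_apply, h4]
      have h := congrArg (H3.P K i) (para_para_right y z x)
      rw [map_add, map_smul] at h
      linear_combination (norm := module) -h
    · simp only [commL_apply, jordan_P_self, jordan_P_two, jordan_P_one_two, LinearMap.neg_apply, offDer_P_self, fin3_two_one, fin3_two_two]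
      rw [← ip_para x y z, ip_comm y, ip_para_cyclic z x y, fin3_one_one, fin3_one_two]
      module

theorem commL_P_P_self (i : Fin 3) (x y : K) :
    commL (H3.P K i x) (H3.P K i y) = -triDerH K (triTL K i x y) := by
  obtain ⟨n1, n2, n3, n4, n5, n6⟩ := fin3_ne i
  refine H3.hom_ext (fun j => ?_) fun j z => ?_
  · rw [LinearMap.neg_apply, triDerH_e, neg_zero]
    obtain rfl | rfl | rfl := fin3_cases i j <;>
      simp only [commL_apply, jordan_P_e, n1, n2, if_true, if_false, map_zero, sub_self,
        jordan_P_self, ip_comm y x]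
  · rw [LinearMap.neg_apply, triDerH_P]
    obtain rfl | rfl | rfl := fin3_cases i j
    · simp only [commL_apply, jordan_P_self, jordan_P_e, map_smul, map_add, map_sub, n1, n2,
        if_false, comp_triTL_self]
      module
    · simp only [commL_apply, jordan_P_one, jordan_P_two, comp_triTL_one, map_sub]
      abel
    · simp only [commL_apply, jordan_P_one, jordan_P_two, comp_triTL_two, map_sub]
      abel

/-- For a derivation δ, [δ, [L_e, L_P]] = [L_{δe}, L_P] + [L_e, L_{δP}]; both terms are already in
the table. The next lemma works in the same way. -/
theorem lie_offDer_offDer_one (i : Fin 3) (x y : K) :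
    ⁅offDer K i x, offDer K (i + 1) y⁆ = -offDer K (i + 2) (para K x y) := by
  rw [← commL_e_one_P (i + 1), lie_commL (offDer_mem i x), fin3_one_one, offDer_e_two,
    commL_P_P_one, offDer_P_one, commL_e_P_self, add_zero]

theorem lie_offDer_offDer_self (i : Fin 3) (x y : K) :
    ⁅offDer K i x, offDer K i y⁆ = triDerH K (triTL K i x y) := by
  rw [← commL_e_one_P i y, lie_commL (offDer_mem i x), offDer_e_one, offDer_P_self, map_smul,
    map_sub, commL_e_e, commL_e_e, map_neg, LinearMap.neg_apply, commL_P_P_self]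
  simp

/-! ### Determination of all derivations of H₃(K) -/

theorem H3.diagCoord_jordan_e (i j : Fin 3) (X : H3 K) :
    H3.diagCoord K i (jordan (H3.e K j) X) = if i = j then 2 * H3.diagCoord K i X else 0 := by
  have h : H3.diagCoord K i ∘ₗ jordan (H3.e K j)
      = (if i = j then (2 : ℝ) else 0) • H3.diagCoord K i := by
    refine H3.hom_ext (fun k => ?_) fun k x => ?_
    · simp only [LinearMap.comp_apply, LinearMap.smul_apply, jordan_e_e, H3.diagCoord_e]
      split_ifs <;> simp_all [H3.diagCoord_e]
    · simp only [LinearMap.comp_apply, LinearMap.smul_apply, jordan_e_P, H3.diagCoord_P]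
      split_ifs <;> simp [H3.diagCoord_P]
  have := LinearMap.congr_fun h X
  simp only [LinearMap.comp_apply, LinearMap.smul_apply, smul_eq_mul, ite_mul, zero_mul] at this
  exact this

theorem H3.offCoord_jordan_e (i j : Fin 3) (X : H3 K) :
    H3.offCoord K i (jordan (H3.e K j) X) = if i = j then 0 else H3.offCoord K i X := by
  have h : H3.offCoord K i ∘ₗ jordan (H3.e K j)
      = (if i = j then (0 : ℝ) else 1) • H3.offCoord K i := by
    refine H3.hom_ext (fun k => ?_) fun k x => ?_
    · simp only [LinearMap.comp_apply, LinearMap.smul_apply, jordan_e_e, H3.offCoord_e]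
      split_ifs <;> simp [H3.offCoord_e]
    · simp only [LinearMap.comp_apply, LinearMap.smul_apply, jordan_e_P, H3.offCoord_P]
      split_ifs <;> simp_all [H3.offCoord_P]
  have := LinearMap.congr_fun h X
  rw [LinearMap.comp_apply, LinearMap.smul_apply, ite_smul, zero_smul, one_smul] at this
  exact this

theorem H3.P_injective (i : Fin 3) : Function.Injective (H3.P K i) := fun x y h => by
  have := congrArg (H3.offCoord K i) h
  rwa [H3.offCoord_P, H3.offCoord_P, if_pos rfl, if_pos rfl] at this

/-- Such a d commutes with every L_{e_j}, hence preserves the off-diagonal spaces. Products inside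
one space force skewness, products of two force triality. -/
theorem exists_triDerH_eq {d : Module.End ℝ (H3 K)} (hd : d ∈ Der (jordan (K := K)))
    (he : ∀ i, d (H3.e K i) = 0) : ∃ T, d = triDerH K T := by
  have hP : ∀ i x, d (H3.P K i x) = H3.P K i (H3.offCoord K i (d (H3.P K i x))) := fun i x => by
    obtain ⟨n1, n2, n3, n4, n5, n6⟩ := fin3_ne i
    have h : ∀ j, jordan (H3.e K j) (d (H3.P K i x)) = if j = i then 0 else d (H3.P K i x) :=
      fun j => by
        have := hd (H3.e K j) (H3.P K i x)
        rw [he, map_zero, LinearMap.zero_apply, zero_add, jordan_e_P, apply_ite d, map_zero] at this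
        exact this.symm
    have d0 := congrArg (H3.diagCoord K i) (h i)
    have d1 := congrArg (H3.diagCoord K (i + 1)) (h (i + 1))
    have d2 := congrArg (H3.diagCoord K (i + 2)) (h (i + 2))
    have o1 := congrArg (H3.offCoord K (i + 1)) (h (i + 1))
    have o2 := congrArg (H3.offCoord K (i + 2)) (h (i + 2))
    simp only [H3.diagCoord_jordan_e, H3.offCoord_jordan_e, n1, n2, if_true, if_false,
      map_zero] at d0 d1 d2 o1 o2
    nth_rewrite 1 [H3.eq_sum (d (H3.P K i x))]
    rw [fin3_sum _ i, ← o1, ← o2, show H3.diagCoord K i (d (H3.P K i x)) = 0 by linarith,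
      show H3.diagCoord K (i + 1) (d (H3.P K i x)) = 0 by linarith,
      show H3.diagCoord K (i + 2) (d (H3.P K i x)) = 0 by linarith]
    simp
  let t : Fin 3 → Module.End ℝ K := fun i => H3.offCoord K i ∘ₗ d ∘ₗ H3.P K i
  have ht : ∀ i x, d (H3.P K i x) = H3.P K i (t i x) := hP
  have hs : ∀ i, t i ∈ so K := fun i => mem_so.2 fun x y => by
    have h := hd (H3.P K i x) (H3.P K i y)
    rw [ht, ht, jordan_P_self, jordan_P_self, jordan_P_self, map_smul, map_add, he, he] at h
    have h' := congrArg (H3.diagCoord K (i + 1)) h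
    simp only [map_add, map_smul, map_zero, H3.diagCoord_e, fin3_one_ne_two, if_true, if_false,
      smul_eq_mul] at h'
    linarith
  have h3 : ∀ x y, t 0 (para K x y) = para K (t 1 x) y + para K x (t 2 y) := fun x y => by
    have h := hd (H3.P K (0 + 1) x) (H3.P K (0 + 2) y)
    rw [ht, ht, jordan_P_one_two, jordan_P_one_two, jordan_P_one_two, ht, ← map_add] at h
    exact H3.P_injective _ h
  refine ⟨Tri.ofComp t hs h3, H3.hom_ext (fun i => ?_) fun i x => ?_⟩
  · rw [he, triDerH_e]
  · rw [ht, triDerH_P, Tri.comp_ofComp]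

/-- Differentiating e_i·e_i = 2e_i and e_i·e_{i+1} = 0 shows that d(e_i) is off-diagonal and that
the coordinates for different i match, so a sum of `offDer`s agrees with d on the idempotents. -/
theorem exists_offDer_add_triDerH {d : Module.End ℝ (H3 K)} (hd : d ∈ Der (jordan (K := K))) :
    ∃ (x : Fin 3 → K) (T : Tri K), d = ∑ i, offDer K i (x i) + triDerH K T := by
  -- Forced, since `offDer K i x` sends e_{i+2} to P_i(x) and the other two `offDer`s do not
  -- contribute to that coordinate.
  let x : Fin 3 → K := fun i => H3.offCoord K i (d (H3.e K (i + 2)))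
  have hx : ∀ i, d (H3.e K i) = H3.P K (i + 1) (x (i + 1)) - H3.P K (i + 2) (x (i + 2)) :=
    fun i => by
      obtain ⟨n1, n2, n3, n4, n5, n6⟩ := fin3_ne i
      have h := hd (H3.e K i) (H3.e K i)
      rw [jordan_comm (d (H3.e K i)), jordan_e_self, map_smul] at h
      have h' := hd (H3.e K i) (H3.e K (i + 1))
      rw [jordan_comm (d (H3.e K i)), jordan_e_ne n4, map_zero] at h'
      have d0 := congrArg (H3.diagCoord K i) h
      have d1 := congrArg (H3.diagCoord K (i + 1)) h
      have d2 := congrArg (H3.diagCoord K (i + 2)) h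
      have o0 := congrArg (H3.offCoord K i) h
      have o2 := congrArg (H3.offCoord K (i + 2)) h'
      simp only [H3.diagCoord_jordan_e, H3.offCoord_jordan_e, n1, n2, n6, if_true, if_false,
        map_zero, map_smul, map_add, smul_eq_mul, add_zero] at d0 d1 d2 o0 o2
      have o0' : H3.offCoord K i (d (H3.e K i)) = 0 :=
        (smul_eq_zero.mp o0).resolve_left two_ne_zero
      have o2' : x (i + 2) = -H3.offCoord K (i + 2) (d (H3.e K i)) := by
        change H3.offCoord K (i + 2) (d (H3.e K (i + 2 + 2))) = _
        rw [fin3_two_two]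
        exact (neg_eq_of_add_eq_zero_right o2.symm).symm
      have o1 : x (i + 1) = H3.offCoord K (i + 1) (d (H3.e K i)) := by
        change H3.offCoord K (i + 1) (d (H3.e K (i + 1 + 2))) = _
        rw [fin3_one_two]
      nth_rewrite 1 [H3.eq_sum (d (H3.e K i))]
      rw [fin3_sum _ i, o0', o1, o2', show H3.diagCoord K i (d (H3.e K i)) = 0 by linarith,
        show H3.diagCoord K (i + 1) (d (H3.e K i)) = 0 by linarith,
        show H3.diagCoord K (i + 2) (d (H3.e K i)) = 0 by linarith]
      simp
  have hd' : d - ∑ i, offDer K i (x i) ∈ Der (jordan (K := K)) :=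
    sub_mem hd (sum_mem fun i _ => offDer_mem i (x i))
  obtain ⟨T, hT⟩ := exists_triDerH_eq hd' fun i => by
    have h1 := offDer_e_two (i + 1) (x (i + 1))
    have h2 := offDer_e_one (i + 2) (x (i + 2))
    rw [fin3_one_two] at h1
    rw [fin3_two_one] at h2
    rw [fin3_sum _ i, LinearMap.sub_apply, hx]
    simp only [LinearMap.add_apply, offDer_e_self, h1, h2]
    abel
  exact ⟨x, T, by rw [← hT, add_sub_cancel]⟩

end JordanDer

/-! ### The isomorphism with the Tits algebra -/

/-! ### Real and imaginary parts -/

section Im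

variable {K : Type*} [NonAssocRing K] [Module ℝ K] [CompositionAlgebra K]

variable (K) in
/-- The projection to the imaginary part. -/
def imL : K →ₗ[ℝ] K := LinearMap.id - re.smulRight (1 : K)

theorem imL_apply (x : K) : imL K x = x - re x • (1 : K) := rfl

theorem re_imL (x : K) : re (imL K x) = 0 := by
  rw [imL_apply, map_sub, map_smul, re_one, smul_eq_mul, mul_one, sub_self]

theorem imL_of_re {x : K} (h : re x = 0) : imL K x = x := by
  rw [imL_apply, h, zero_smul, sub_zero]

theorem imL_one : imL K (1 : K) = 0 := by
  rw [imL_apply, re_one, one_smul, sub_self]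

theorem ip_imL (x y : K) : ip K (imL K x) (imL K y) = ip K x y - re x * re y := by
  simp only [imL_apply, map_sub, map_smul, LinearMap.sub_apply, LinearMap.smul_apply, ip_one,
    smul_eq_mul, re_apply, ip_comm 1 y]
  ring

theorem imL_comm (x y : K) : imL K x * imL K y - imL K y * imL K x = x * y - y * x := by
  simp only [imL_apply, mul_sub, sub_mul, mul_smul_comm, smul_mul_assoc, mul_one, one_mul]
  module

theorem re_mul (x y : K) : re (x * y) = 2 * (re x * re y) - ip K x y := by
  rw [re_apply, ip_mul_right, one_mul, conj_apply, map_sub, map_smul, ← re_apply, ← re_apply,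
    smul_eq_mul]
  ring

theorem derivD_imL (x y : K) : derivD (imL K x) (imL K y) = derivD x y := by
  ext z
  simp only [derivD_eq, imL_comm]
  simp only [imL_apply, mul_sub, sub_mul, mul_smul_comm, smul_mul_assoc, mul_one, one_mul]
  module

theorem imL_mul (x y : K) : imL K (x * y) = re x • imL K y + re y • imL K x
    + (1 / 2 : ℝ) • (x * y - y * x) := by
  have h := mul_add_mul_swap x y
  rw [imL_apply, imL_apply, imL_apply, re_mul]
  rw [add_comm] at h
  linear_combination (norm := module) (1 / 2 : ℝ) • h

theorem imL_conj (x : K) : imL K (conj x) = -imL K x := by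
  rw [imL_apply, imL_apply, re_conj, conj_apply, ← re_apply]
  module

theorem imL_comp (T : Tri K) (i : Fin 3) (x : K) : imL K (Tri.comp T i x)
    = triDer K T (imL K x) + re x • Tri.comp T i 1
      + (1 / 2 : ℝ) • ((triIm K (i + 1) T + triIm K (i + 2) T) * imL K x
        - imL K x * (triIm K (i + 1) T + triIm K (i + 2) T)) := by
  have hx : x = imL K x + re x • (1 : K) := by rw [imL_apply, sub_add_cancel]
  have hr := re_imL x
  generalize imL K x = z at *
  rw [hx, map_add, map_smul, map_add, map_smul, imL_of_re (Tri.re_comp_one T i), comp_eq_derComp,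
    map_sub, map_add, imL_mul, imL_mul, imL_of_re (re_der (triDer_mem T) z), re_triIm, re_triIm,
    hr, imL_of_re hr, map_add, map_smul, hr, re_one]
  simp only [add_mul, mul_add]
  module

theorem re_comp (T : Tri K) (i : Fin 3) (x : K) :
    re (Tri.comp T i x) = -ip K (Tri.comp T i 1) (imL K x) := by
  rw [imL_apply, map_sub, map_smul, ← re_apply, Tri.re_comp_one, re_apply, Tri.ip_comp, ip_comm]
  simp

end Im

/-! ### The product A * B on generators -/

section Star

variable {K : Type*} [NonAssocRing K] [Module ℝ K] [CompositionAlgebra K]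

theorem star_e_self (i : Fin 3) : star (H3.e K i) (H3.e K i)
    = (2 : ℝ) • H3.e K i - (2 / 3 : ℝ) • ∑ j, H3.e K j := by
  rw [star_apply, jordan_e_self, ipH_e_self, jordanOne_eq]
  module

theorem star_e_ne {i j : Fin 3} (h : i ≠ j) : star (H3.e K i) (H3.e K j) = 0 := by
  rw [star_apply, jordan_e_ne h, ipH_e_ne h, mul_zero, zero_smul, sub_zero]

theorem star_e_P (i j : Fin 3) (x : K) :
    star (H3.e K i) (H3.P K j x) = if i = j then 0 else H3.P K j x := by
  rw [star_apply, jordan_e_P, ipH_e_P, mul_zero, zero_smul, sub_zero]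

theorem star_P_self (i : Fin 3) (x y : K) : star (H3.P K i x) (H3.P K i y)
    = (2 * ip K x y) • (H3.e K (i + 1) + H3.e K (i + 2))
      - (4 / 3 * ip K x y) • ∑ j, H3.e K j := by
  rw [star_apply, jordan_P_self, ipH_P_self, jordanOne_eq]
  module

theorem star_P_one (i : Fin 3) (x y : K) : star (H3.P K i x) (H3.P K (i + 1) y)
    = H3.P K (i + 2) (para K x y) := by
  rw [star_apply, jordan_P_one, ipH_P_one, mul_zero, zero_smul, sub_zero]

end Star

/-! ### The map into the Tits algebra and its brackets -/

section TitsMap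

variable {K₁ K₂ : Type*} [NonAssocRing K₁] [Module ℝ K₁] [CompositionAlgebra K₁]
  [NonAssocRing K₂] [Module ℝ K₂] [CompositionAlgebra K₂]

variable (K₁ K₂) in
/-- The component of `Tri K₁` in `K₁' ⊗ H₃'(K₂)`. -/
def diagTensor : Tri K₁ →ₗ[ℝ] K₁ ⊗[ℝ] H3 K₂ :=
  ∑ j, (TensorProduct.mk ℝ K₁ (H3 K₂)).flip (H3.e K₂ j) ∘ₗ triIm K₁ j

theorem diagTensor_apply (T : Tri K₁) :
    diagTensor K₁ K₂ T = ∑ j, triIm K₁ j T ⊗ₜ[ℝ] H3.e K₂ j := by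
  simp [diagTensor]

variable (K₁ K₂) in
/-- The map `x₁ ⊗ x₂ ↦ Re x₁ [L_{e_{i+1}}, L_{P_i(x₂)}]`. -/
def offEnd (i : Fin 3) : K₁ ⊗[ℝ] K₂ →ₗ[ℝ] Module.End ℝ (H3 K₂) :=
  TensorProduct.lift ((re (K := K₁)).smulRight (offDer K₂ i))

theorem offEnd_tmul (i : Fin 3) (x : K₁) (y : K₂) :
    offEnd K₁ K₂ i (x ⊗ₜ y) = re x • offDer K₂ i y := by
  simp [offEnd]

variable (K₁ K₂) in
/-- The map `x₁ ⊗ x₂ ↦ Im x₁ ⊗ P_i(x₂)`. -/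
def offTensor (i : Fin 3) : K₁ ⊗[ℝ] K₂ →ₗ[ℝ] K₁ ⊗[ℝ] H3 K₂ :=
  TensorProduct.map (imL K₁) (H3.P K₂ i)

theorem offTensor_tmul (i : Fin 3) (x : K₁) (y : K₂) :
    offTensor K₁ K₂ i (x ⊗ₜ y) = imL K₁ x ⊗ₜ H3.P K₂ i y := rfl

variable (K₁ K₂) in
/-- The map from the triality construction to the Tits construction. -/
def titsMap : TrialitySpace K₁ K₂ →ₗ[ℝ] TitsAmbient K₁ K₂ where
  toFun u := (triDer K₁ u.1, triDerH K₂ u.2.1 - ∑ i, offEnd K₁ K₂ i (u.2.2 i),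
    diagTensor K₁ K₂ u.1 - ∑ i, offTensor K₁ K₂ i (u.2.2 i))
  map_add' u v := by
    refine Prod.ext ?_ (Prod.ext ?_ ?_)
    · exact map_add _ _ _
    · change _ = (_ - _) + (_ - _)
      simp only [Prod.snd_add, Prod.fst_add, Pi.add_apply, map_add, Finset.sum_add_distrib]
      abel
    · change _ = (_ - _) + (_ - _)
      simp only [Prod.snd_add, Prod.fst_add, Pi.add_apply, map_add, Finset.sum_add_distrib]
      abel
  map_smul' r u := by
    refine Prod.ext ?_ (Prod.ext ?_ ?_)
    · exact map_smul _ _ _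
    · change _ = r • (_ - _)
      simp only [Prod.smul_snd, Prod.smul_fst, Pi.smul_apply, map_smul, ← Finset.smul_sum, smul_sub]
    · change _ = r • (_ - _)
      simp only [Prod.smul_snd, Prod.smul_fst, Pi.smul_apply, map_smul, ← Finset.smul_sum, smul_sub]

theorem titsMap_apply (u : TrialitySpace K₁ K₂) : titsMap K₁ K₂ u
    = (triDer K₁ u.1, triDerH K₂ u.2.1 - ∑ i, offEnd K₁ K₂ i (u.2.2 i),
      diagTensor K₁ K₂ u.1 - ∑ i, offTensor K₁ K₂ i (u.2.2 i)) := rfl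

theorem titsMap_tri (S : Tri K₁) (T : Tri K₂) : titsMap K₁ K₂ (S, T, 0)
    = (triDer K₁ S, triDerH K₂ T, diagTensor K₁ K₂ S) := by
  rw [titsMap_apply]
  simp

theorem titsMap_F (i : Fin 3) (w : K₁ ⊗[ℝ] K₂) : titsMap K₁ K₂ (F i w)
    = (0, -offEnd K₁ K₂ i w, -offTensor K₁ K₂ i w) := by
  have h1 : ∑ j, offEnd K₁ K₂ j ((Pi.single i w : Fin 3 → K₁ ⊗[ℝ] K₂) j) = offEnd K₁ K₂ i w := by
    rw [Finset.sum_eq_single i (fun j _ hj => by rw [Pi.single_eq_of_ne hj, map_zero]) (by simp),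
      Pi.single_eq_same]
  have h2 : ∑ j, offTensor K₁ K₂ j ((Pi.single i w : Fin 3 → K₁ ⊗[ℝ] K₂) j)
      = offTensor K₁ K₂ i w := by
    rw [Finset.sum_eq_single i (fun j _ hj => by rw [Pi.single_eq_of_ne hj, map_zero]) (by simp),
      Pi.single_eq_same]
  rw [titsMap_apply, F, h1, h2, map_zero, map_zero, map_zero, zero_sub, zero_sub]

theorem titsMap_F_tmul (i : Fin 3) (x : K₁) (y : K₂) : titsMap K₁ K₂ (F i (x ⊗ₜ y))
    = (0, -(re x • offDer K₂ i y), -(imL K₁ x ⊗ₜ H3.P K₂ i y)) := by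
  rw [titsMap_F, offEnd_tmul, offTensor_tmul]

/-! #### Brackets -/

theorem titsBracket_tri_tri (S₁ T₁ : Tri K₁) (S₂ T₂ : Tri K₂) :
    titsBracket (titsMap K₁ K₂ (S₁, S₂, 0)) (titsMap K₁ K₂ (T₁, T₂, 0))
      = titsMap K₁ K₂ (⁅S₁, T₁⁆, ⁅S₂, T₂⁆, 0) := by
  rw [titsMap_tri, titsMap_tri, titsMap_tri, titsBracket_apply]
  refine Prod.ext ?_ (Prod.ext ?_ ?_)
  · simp only [diagTensor_apply, map_sum, LinearMap.sum_apply, titsDer_tmul]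
    rw [triDer_lie, Finset.smul_sum]
    congr 1
    refine Finset.sum_congr rfl fun j _ => ?_
    rw [Finset.sum_eq_single j (fun i _ h => by rw [ipH_e_ne h, mul_zero, zero_smul]) (by simp),
      ipH_e_self, mul_one]
  · have h0 : ∀ i j, (⁅(jordan (H3.e K₂ i) : Module.End ℝ (H3 K₂)),
        (jordan (H3.e K₂ j) : Module.End ℝ (H3 K₂))⁆ : Module.End ℝ (H3 K₂)) = 0 := commL_e_e
    simp only [diagTensor_apply, map_sum, LinearMap.sum_apply, titsJordan_tmul, h0, smul_zero,
      neg_zero, Finset.sum_const_zero, add_zero, triDerH_lie]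
  · have h3 : titsTensor (diagTensor K₁ K₂ S₁) (diagTensor K₁ K₂ T₁)
        = ∑ j, (triIm K₁ j S₁ * triIm K₁ j T₁ - triIm K₁ j T₁ * triIm K₁ j S₁) ⊗ₜ[ℝ] H3.e K₂ j
          - (1 / 3 : ℝ) • (∑ j, (triIm K₁ j S₁ * triIm K₁ j T₁ - triIm K₁ j T₁ * triIm K₁ j S₁))
            ⊗ₜ[ℝ] ∑ j, H3.e K₂ j := by
      simp only [diagTensor_apply, map_sum, LinearMap.sum_apply, titsTensor_tmul]
      rw [TensorProduct.sum_tmul, Finset.smul_sum, ← Finset.sum_sub_distrib]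
      refine Finset.sum_congr rfl fun j _ => ?_
      rw [Finset.sum_eq_single j
        (fun i _ h => by rw [star_e_ne h, TensorProduct.tmul_zero, smul_zero]) (by simp),
        star_e_self, TensorProduct.tmul_sub, TensorProduct.tmul_smul, TensorProduct.tmul_smul]
      module
    change _ + titsTensor (diagTensor K₁ K₂ S₁) (diagTensor K₁ K₂ T₁) = diagTensor K₁ K₂ ⁅S₁, T₁⁆
    rw [h3, TensorProduct.tmul_sum]
    simp only [diagTensor_apply, map_sum, LinearMap.rTensor_tmul, LinearMap.lTensor_tmul,
      triDerH_e, TensorProduct.tmul_zero, Finset.sum_const_zero, add_zero, triIm_lie,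
      TensorProduct.add_tmul, TensorProduct.sub_tmul, ← TensorProduct.smul_tmul',
      Finset.sum_add_distrib, Finset.sum_sub_distrib, ← Finset.smul_sum]

/-- Of the operators [L_{e_j}, L_{P_i}] only j = i+1 and j = i+2 survive, with opposite signs, so
b_{i+1} - b_{i+2} = T_i(1) appears, and Re(T_i x) = -⟨T_i(1), Im x⟩. The tensor part is `imL_comp`.
-/
theorem titsBracket_tri₁_F (T : Tri K₁) (i : Fin 3) (x₁ : K₁) (x₂ : K₂) :
    titsBracket (titsMap K₁ K₂ (T, 0, 0)) (titsMap K₁ K₂ (F i (x₁ ⊗ₜ x₂)))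
      = titsMap K₁ K₂ (F i (Tri.comp T i x₁ ⊗ₜ x₂)) := by
  obtain ⟨n1, n2, n3, n4, n5, n6⟩ := fin3_ne i
  rw [titsMap_tri, titsMap_F_tmul, titsMap_F_tmul, titsBracket_apply, diagTensor_apply, map_zero]
  refine Prod.ext ?_ (Prod.ext ?_ ?_)
  · simp only [map_sum, map_neg, LinearMap.sum_apply, titsDer_tmul, ipH_e_P, mul_zero,
      zero_smul, neg_zero, Finset.sum_const_zero, lie_zero, add_zero]
  · have h0 : (⁅(jordan (H3.e K₂ i) : Module.End ℝ (H3 K₂)), (jordan (H3.P K₂ i x₂))⁆ :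
        Module.End ℝ (H3 K₂)) = 0 := commL_e_P_self i x₂
    have h1 : (⁅(jordan (H3.e K₂ (i + 1)) : Module.End ℝ (H3 K₂)), (jordan (H3.P K₂ i x₂))⁆ :
        Module.End ℝ (H3 K₂)) = offDer K₂ i x₂ := commL_e_one_P i x₂
    have h2 : (⁅(jordan (H3.e K₂ (i + 2)) : Module.End ℝ (H3 K₂)), (jordan (H3.P K₂ i x₂))⁆ :
        Module.End ℝ (H3 K₂)) = -offDer K₂ i x₂ := commL_e_two_P i x₂
    simp only [map_sum, map_neg, LinearMap.sum_apply, titsJordan_tmul, zero_lie, zero_add]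
    rw [fin3_sum _ i, h0, h1, h2, re_comp, ← triIm_sub_triIm, map_sub, LinearMap.sub_apply]
    module
  · simp only [map_sum, map_neg, LinearMap.sum_apply, titsTensor_tmul, LinearMap.rTensor_tmul,
      LinearMap.lTensor_tmul, LinearMap.lTensor_neg, LinearMap.lTensor_smul, LinearMap.neg_apply,
      LinearMap.smul_apply, LinearMap.lTensor_zero, LinearMap.rTensor_zero, LinearMap.zero_apply,
      star_e_P]
    rw [fin3_sum _ i, fin3_sum _ i, fin3_sum _ i, imL_comp, ← triIm_sub_triIm, offDer_e_self, offDer_e_one,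
      offDer_e_two, if_pos rfl, if_neg n1, if_neg n2]
    simp only [TensorProduct.tmul_zero, TensorProduct.tmul_neg, TensorProduct.add_tmul,
      TensorProduct.sub_tmul, ← TensorProduct.smul_tmul', add_mul, mul_add]
    module

theorem titsBracket_tri₂_F (T : Tri K₂) (i : Fin 3) (x₁ : K₁) (x₂ : K₂) :
    titsBracket (titsMap K₁ K₂ (0, T, 0)) (titsMap K₁ K₂ (F i (x₁ ⊗ₜ x₂)))
      = titsMap K₁ K₂ (F i (x₁ ⊗ₜ Tri.comp T i x₂)) := by
  rw [titsMap_tri, titsMap_F_tmul, titsMap_F_tmul, titsBracket_apply, map_zero, map_zero]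
  refine Prod.ext ?_ (Prod.ext ?_ ?_)
  · simp
  · simp only [map_zero, LinearMap.zero_apply, add_zero]
    rw [lie_neg, lie_smul, lie_triDerH_offDer]
  · simp [triDerH_P]

/-- The derivation part combines Re x₁ Re y₁ from the commutator of `offDer`s with ⟨Im x₁, Im y₁⟩
from `commL`, giving Re(x₁y₁) = Re x₁ Re y₁ - ⟨Im x₁, Im y₁⟩. The tensor part is `imL_mul`. -/
theorem titsBracket_F_F (i : Fin 3) (x₁ y₁ : K₁) (x₂ y₂ : K₂) :
    titsBracket (titsMap K₁ K₂ (F i (x₁ ⊗ₜ x₂))) (titsMap K₁ K₂ (F (i + 1) (y₁ ⊗ₜ y₂)))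
      = titsMap K₁ K₂ (F (i + 2) ((conj y₁ * conj x₁) ⊗ₜ (conj y₂ * conj x₂))) := by
  rw [titsMap_F_tmul, titsMap_F_tmul, titsMap_F_tmul, titsBracket_apply]
  refine Prod.ext ?_ (Prod.ext ?_ ?_)
  · simp [titsDer_tmul, ipH_P_one]
  · have h : (⁅(jordan (H3.P K₂ i x₂) : Module.End ℝ (H3 K₂)), (jordan (H3.P K₂ (i + 1) y₂))⁆ :
        Module.End ℝ (H3 K₂)) = -offDer K₂ (i + 2) (para K₂ x₂ y₂) := commL_P_P_one i x₂ y₂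
    simp only [map_neg, LinearMap.neg_apply, titsJordan_tmul, h, neg_lie, lie_neg, neg_neg,
      smul_lie, lie_smul, lie_offDer_offDer_one, ← conj_mul, re_conj, ip_imL, re_mul,
      ← para_apply x₂ y₂]
    module
  · have h2 := offDer_P_two (i + 1) y₂ x₂
    rw [fin3_one_two, fin3_one_one] at h2
    simp only [map_neg, LinearMap.neg_apply, titsTensor_tmul, LinearMap.rTensor_zero,
      LinearMap.zero_apply, LinearMap.lTensor_neg, LinearMap.lTensor_smul, LinearMap.smul_apply,
      LinearMap.lTensor_tmul, offDer_P_one, h2, star_P_one, imL_comm, ← conj_mul, imL_conj,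
      imL_mul, ← para_apply x₂ y₂, TensorProduct.neg_tmul, TensorProduct.tmul_neg,
      TensorProduct.add_tmul, ← TensorProduct.smul_tmul']
    module

/-- Now the two contributions add up to Re x₁ Re y₁ + ⟨Im x₁, Im y₁⟩ = ⟨x₁, y₁⟩. On the K₁ side,
⅓·2⟨x₂,y₂⟩ is the coefficient 2/3 of `triDer_triTL`. -/
theorem titsBracket_F_F_self (i : Fin 3) (x₁ y₁ : K₁) (x₂ y₂ : K₂) :
    titsBracket (titsMap K₁ K₂ (F i (x₁ ⊗ₜ x₂))) (titsMap K₁ K₂ (F i (y₁ ⊗ₜ y₂)))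
      = titsMap K₁ K₂ (ip K₂ x₂ y₂ • triTL K₁ i x₁ y₁, ip K₁ x₁ y₁ • triTL K₂ i x₂ y₂, 0) := by
  rw [titsMap_F_tmul, titsMap_F_tmul, titsMap_tri, titsBracket_apply]
  refine Prod.ext ?_ (Prod.ext ?_ ?_)
  · simp only [map_neg, LinearMap.neg_apply, titsDer_tmul, ipH_P_self, derivD_imL, map_smul,
      triDer_triTL, lie_zero]
    module
  · have h : (⁅(jordan (H3.P K₂ i x₂) : Module.End ℝ (H3 K₂)), (jordan (H3.P K₂ i y₂))⁆ :
        Module.End ℝ (H3 K₂)) = -triDerH K₂ (triTL K₂ i x₂ y₂) := commL_P_P_self i x₂ y₂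
    simp only [map_neg, LinearMap.neg_apply, titsJordan_tmul, h, neg_lie, lie_neg, neg_neg,
      smul_lie, lie_smul, lie_offDer_offDer_self, ip_imL, map_smul]
    module
  · simp only [map_smul]
    rw [diagTensor_apply, fin3_sum _ i, triIm_triTL_self, triIm_triTL_one, triIm_triTL_two]
    simp only [map_neg, LinearMap.neg_apply, titsTensor_tmul, LinearMap.rTensor_zero,
      LinearMap.zero_apply, LinearMap.lTensor_neg, LinearMap.lTensor_smul, LinearMap.smul_apply,
      LinearMap.lTensor_tmul, offDer_P_self, star_P_self, imL_comm]
    rw [fin3_sum _ i, ip_comm y₂]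
    simp only [imL_apply, TensorProduct.sub_tmul,
      TensorProduct.add_tmul, TensorProduct.tmul_add, TensorProduct.tmul_sub,
      ← TensorProduct.smul_tmul', TensorProduct.tmul_smul]
    module

end TitsMap

/-! ### Image and bijectivity of the map -/

section TitsEquiv

variable {K₁ K₂ : Type*} [NonAssocRing K₁] [Module ℝ K₁] [CompositionAlgebra K₁]
  [NonAssocRing K₂] [Module ℝ K₂] [CompositionAlgebra K₂]

theorem tmul_mem_range_mapIncl {a : K₁} {A : H3 K₂} (ha : re a = 0) (hA : A ∈ H3' K₂) :
    a ⊗ₜ[ℝ] A ∈ LinearMap.range (TensorProduct.mapIncl (im K₁) (H3' K₂)) :=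
  ⟨(⟨a, ha⟩ : im K₁) ⊗ₜ (⟨A, hA⟩ : H3' K₂), rfl⟩

theorem H3.e_sub_e_mem (i j : Fin 3) : H3.e K₂ i - H3.e K₂ j ∈ H3' K₂ := by
  rw [mem_H3']
  simp [H3.diagCoord_e]

theorem H3.P_mem (i : Fin 3) (x : K₂) : H3.P K₂ i x ∈ H3' K₂ := by
  rw [mem_H3']
  simp [H3.diagCoord_P]

theorem diagTensor_mem (T : Tri K₁) :
    diagTensor K₁ K₂ T ∈ LinearMap.range (TensorProduct.mapIncl (im K₁) (H3' K₂)) := by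
  -- Eliminating b_0 = -b_1 - b_2 leaves trace-free diagonal matrices.
  have h : diagTensor K₁ K₂ T = triIm K₁ 1 T ⊗ₜ[ℝ] (H3.e K₂ 1 - H3.e K₂ 0)
      + triIm K₁ 2 T ⊗ₜ[ℝ] (H3.e K₂ 2 - H3.e K₂ 0) := by
    have h0 : triIm K₁ 0 T = -triIm K₁ 1 T - triIm K₁ 2 T := by
      linear_combination (norm := abel) sum_triIm T
    rw [diagTensor_apply, Fin.sum_univ_three, h0, TensorProduct.tmul_sub, TensorProduct.tmul_sub,
      TensorProduct.sub_tmul, TensorProduct.neg_tmul]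
    abel
  rw [h]
  exact add_mem (tmul_mem_range_mapIncl (re_triIm _ _) (H3.e_sub_e_mem _ _))
    (tmul_mem_range_mapIncl (re_triIm _ _) (H3.e_sub_e_mem _ _))

theorem offTensor_mem (i : Fin 3) (w : K₁ ⊗[ℝ] K₂) :
    offTensor K₁ K₂ i w ∈ LinearMap.range (TensorProduct.mapIncl (im K₁) (H3' K₂)) := by
  induction w with
  | zero => rw [map_zero]; exact zero_mem _
  | tmul x y => exact tmul_mem_range_mapIncl (re_imL x) (H3.P_mem i y)
  | add v w hv hw => rw [map_add]; exact add_mem hv hw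

theorem offEnd_mem (i : Fin 3) (w : K₁ ⊗[ℝ] K₂) :
    offEnd K₁ K₂ i w ∈ (Der (jordan (K := K₂))).toSubmodule := by
  induction w with
  | zero => rw [map_zero]; exact zero_mem _
  | tmul x y => rw [offEnd_tmul]; exact Submodule.smul_mem _ _ (offDer_mem i y)
  | add v w hv hw => rw [map_add]; exact add_mem hv hw

theorem titsMap_mem (u : TrialitySpace K₁ K₂) : titsMap K₁ K₂ u ∈ L₃ K₁ K₂ :=
  ⟨triDer_mem u.1,
    sub_mem (triDerH_mem u.2.1 : _ ∈ (Der (jordan (K := K₂))).toSubmodule)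
      (sum_mem fun i _ => offEnd_mem i _),
    sub_mem (diagTensor_mem u.1) (sum_mem fun i _ => offTensor_mem i _)⟩

/-! #### Injectivity -/

theorem offEnd_e_two (i j : Fin 3) (w : K₁ ⊗[ℝ] K₂) :
    H3.offCoord K₂ i (offEnd K₁ K₂ j w (H3.e K₂ (i + 2)))
      = if i = j then TensorProduct.lid ℝ K₂ ((re (K := K₁)).rTensor K₂ w) else 0 := by
  obtain ⟨n1, n2, n3, n4, n5, n6⟩ := fin3_ne i
  have h1 := fun y : K₂ => offDer_e_one (i + 1) y
  have h2 := fun y : K₂ => offDer_e_self (i + 2) y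
  simp only [fin3_one_one] at h1
  induction w with
  | zero => simp
  | add v w hv hw =>
    simp only [map_add, LinearMap.add_apply, hv, hw]
    split_ifs <;> simp
  | tmul x y =>
    rw [offEnd_tmul, LinearMap.smul_apply, map_smul, LinearMap.rTensor_tmul,
      TensorProduct.lid_tmul]
    obtain rfl | rfl | rfl := fin3_cases i j
    · rw [offDer_e_two, H3.offCoord_P, if_pos rfl, if_pos rfl]
    · rw [h1, if_neg n4, map_neg, H3.offCoord_P, if_neg n4, neg_zero, smul_zero]
    · rw [h2, if_neg n5, map_zero, smul_zero]

/-- A tensor is recovered from its imaginary part, seen in the K₁ ⊗ H₃(K₂) component, and its real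
part, seen in the derivation component through `offEnd_e_two`. -/
theorem rTensor_imL_add {V : Type*} [AddCommGroup V] [Module ℝ V] (w : K₁ ⊗[ℝ] V) :
    (imL K₁).rTensor V w
      + (1 : K₁) ⊗ₜ[ℝ] TensorProduct.lid ℝ V ((re (K := K₁)).rTensor V w) = w := by
  induction w with
  | zero => simp
  | add v w hv hw =>
    nth_rewrite 3 [← hv]
    nth_rewrite 3 [← hw]
    simp only [map_add, TensorProduct.tmul_add]
    abel
  | tmul x y =>
    rw [LinearMap.rTensor_tmul, LinearMap.rTensor_tmul, TensorProduct.lid_tmul, imL_apply,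
      TensorProduct.tmul_smul, TensorProduct.sub_tmul, TensorProduct.smul_tmul',
      sub_add_cancel]

theorem lTensor_offCoord_offTensor (i j : Fin 3) (w : K₁ ⊗[ℝ] K₂) :
    (H3.offCoord K₂ i).lTensor K₁ (offTensor K₁ K₂ j w)
      = if i = j then (imL K₁).rTensor K₂ w else 0 := by
  induction w with
  | zero => simp
  | add v w hv hw =>
    simp only [map_add, hv, hw]
    split_ifs <;> simp
  | tmul x y =>
    rw [offTensor_tmul, LinearMap.lTensor_tmul, H3.offCoord_P, LinearMap.rTensor_tmul]
    split_ifs <;> simp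

theorem lTensor_offCoord_diagTensor (i : Fin 3) (T : Tri K₁) :
    (H3.offCoord K₂ i).lTensor K₁ (diagTensor K₁ K₂ T) = 0 := by
  simp [diagTensor_apply, H3.offCoord_e]

theorem lTensor_diagCoord_offTensor (i j : Fin 3) (w : K₁ ⊗[ℝ] K₂) :
    (H3.diagCoord K₂ i).lTensor K₁ (offTensor K₁ K₂ j w) = 0 := by
  induction w with
  | zero => simp
  | add v w hv hw => rw [map_add, map_add, hv, hw, add_zero]
  | tmul x y =>
    rw [offTensor_tmul, LinearMap.lTensor_tmul, H3.diagCoord_P, TensorProduct.tmul_zero]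

theorem lTensor_diagCoord_diagTensor (i : Fin 3) (T : Tri K₁) :
    TensorProduct.rid ℝ K₁ ((H3.diagCoord K₂ i).lTensor K₁ (diagTensor K₁ K₂ T))
      = triIm K₁ i T := by
  simp [diagTensor_apply, H3.diagCoord_e]

theorem triDerH_injective : Function.Injective (triDerH K₂) := fun S T h =>
  Tri.ext_comp fun i => LinearMap.ext fun x => H3.P_injective i (by
    rw [← triDerH_P, ← triDerH_P, h])

theorem titsMap_injective : Function.Injective (titsMap K₁ K₂) := by
  refine (injective_iff_map_eq_zero _).2 fun u hu => ?_
  rw [titsMap_apply] at hu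
  have h1 : triDer K₁ u.1 = 0 := congrArg Prod.fst hu
  have h2 : triDerH K₂ u.2.1 - ∑ i, offEnd K₁ K₂ i (u.2.2 i) = 0 :=
    congrArg (fun p => p.2.1) hu
  have h3 : diagTensor K₁ K₂ u.1 - ∑ i, offTensor K₁ K₂ i (u.2.2 i) = 0 :=
    congrArg (fun p => p.2.2) hu
  have hb : ∀ i, triIm K₁ i u.1 = 0 := fun i => by
    have h := congrArg (fun t => TensorProduct.rid ℝ K₁ ((H3.diagCoord K₂ i).lTensor K₁ t)) h3
    simpa only [map_sub, map_sum, lTensor_diagCoord_offTensor, lTensor_diagCoord_diagTensor,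
      map_zero, Finset.sum_const_zero, sub_zero] using h
  have hw : ∀ i, u.2.2 i = 0 := fun i => by
    have h := congrArg ((H3.offCoord K₂ i).lTensor K₁) h3
    have h' := congrArg (fun d : Module.End ℝ (H3 K₂) => H3.offCoord K₂ i (d (H3.e K₂ (i + 2)))) h2
    simp only [map_sub, map_sum, lTensor_offCoord_offTensor, lTensor_offCoord_diagTensor,
      map_zero, zero_sub, neg_eq_zero, Finset.sum_ite_eq, Finset.mem_univ, if_true] at h
    simp only [LinearMap.sub_apply, LinearMap.sum_apply, map_sum, triDerH_e, offEnd_e_two,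
      map_zero, zero_sub, map_neg, neg_eq_zero, Finset.sum_ite_eq, Finset.mem_univ, if_true,
      LinearMap.zero_apply] at h'
    rw [← rTensor_imL_add (u.2.2 i), h, h', TensorProduct.tmul_zero, add_zero]
  have hT : u.1 = 0 := Tri.ext_comp fun i => LinearMap.ext fun x => by
    have h0 : Tri.comp (0 : Tri K₁) i = 0 := (compL K₁ i).map_zero
    rw [comp_eq_derComp, h1, hb, hb, h0]
    simp
  have hS : u.2.1 = 0 := triDerH_injective (by
    simpa only [hw, map_zero, Finset.sum_const_zero, sub_zero] using h2)
  exact Prod.ext hT (Prod.ext hS (funext hw))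

/-! #### Surjectivity -/

theorem fst_mem_range_titsMap {D : Module.End ℝ K₁} (hD : D ∈ Der (LinearMap.mul ℝ K₁)) :
    ((D, 0, 0) : TitsAmbient K₁ K₂) ∈ LinearMap.range (titsMap K₁ K₂) := by
  have hb : ∀ i : Fin 3, re ((fun _ => 0 : Fin 3 → K₁) i) = 0 := fun _ => map_zero _
  have hs : (fun _ => 0 : Fin 3 → K₁) 0 + (fun _ => 0 : Fin 3 → K₁) 1
      + (fun _ => 0 : Fin 3 → K₁) 2 = 0 := by simp
  refine ⟨(triOfDer hD hb hs, 0, 0), ?_⟩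
  rw [titsMap_tri, diagTensor_apply, map_zero, triDer_eq (der_one hD) hs (comp_triOfDer hD hb hs)]
  simp only [triIm_eq (der_one hD) hs (comp_triOfDer hD hb hs), TensorProduct.zero_tmul,
    Finset.sum_const_zero]

theorem snd_mem_range_titsMap {d : Module.End ℝ (H3 K₂)} (hd : d ∈ Der (jordan (K := K₂))) :
    ((0, d, 0) : TitsAmbient K₁ K₂) ∈ LinearMap.range (titsMap K₁ K₂) := by
  obtain ⟨x, T, rfl⟩ := exists_offDer_add_triDerH hd
  have h : ((0, ∑ i, offDer K₂ i (x i) + triDerH K₂ T, 0) : TitsAmbient K₁ K₂)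
      -- In F_i(1 ⊗ x) the imaginary part vanishes, so only the derivation `offDer` remains.
      = titsMap K₁ K₂ (0, T, 0) - ∑ i, titsMap K₁ K₂ (F i ((1 : K₁) ⊗ₜ x i)) := by
    rw [titsMap_tri, map_zero, map_zero]
    simp only [titsMap_F_tmul, re_one, one_smul, imL_one, TensorProduct.zero_tmul, neg_zero]
    rw [Fin.sum_univ_three, Fin.sum_univ_three]
    refine Prod.ext ?_ (Prod.ext ?_ ?_)
    · simp
    · simp only [Prod.mk_add_mk, Prod.mk_sub_mk]
      abel
    · simp
  rw [h]
  exact sub_mem ⟨_, rfl⟩ (sum_mem fun i _ => ⟨_, rfl⟩)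

theorem tmul_mem_range_titsMap {a : K₁} {A : H3 K₂} (ha : re a = 0) (hA : A ∈ H3' K₂) :
    ((0, 0, a ⊗ₜ[ℝ] A) : TitsAmbient K₁ K₂) ∈ LinearMap.range (titsMap K₁ K₂) := by
  have hD : (0 : Module.End ℝ K₁) ∈ Der (LinearMap.mul ℝ K₁) := zero_mem _
  -- The diagonal of A comes from the triality element without derivation part and with these
  -- imaginary parts, of sum zero because A has trace zero; the off-diagonal entries come from F_i,
  -- with no derivation term as Re a = 0.
  let b : Fin 3 → K₁ := fun i => H3.diagCoord K₂ i A • a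
  have hb : ∀ i : Fin 3, re (b i) = 0 := fun i => by
    rw [map_smul, ha, smul_zero]
  have hs : b 0 + b 1 + b 2 = 0 := by
    rw [← add_smul, ← add_smul, ← Fin.sum_univ_three (fun i => H3.diagCoord K₂ i A),
      mem_H3'.1 hA, zero_smul]
  have h : ((0, 0, a ⊗ₜ[ℝ] A) : TitsAmbient K₁ K₂) = titsMap K₁ K₂ (triOfDer hD hb hs, 0, 0)
      - ∑ i, titsMap K₁ K₂ (F i (a ⊗ₜ H3.offCoord K₂ i A)) := by
    rw [titsMap_tri, diagTensor_apply, map_zero,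
      triDer_eq (der_one hD) hs (comp_triOfDer hD hb hs)]
    simp only [triIm_eq (der_one hD) hs (comp_triOfDer hD hb hs), titsMap_F_tmul, ha, zero_smul,
      imL_of_re ha, neg_zero]
    nth_rewrite 1 [H3.eq_sum A]
    rw [Fin.sum_univ_three, Fin.sum_univ_three, Fin.sum_univ_three]
    refine Prod.ext ?_ (Prod.ext ?_ ?_)
    · simp
    · simp
    · simp only [Prod.mk_add_mk, Prod.mk_sub_mk, TensorProduct.tmul_add, TensorProduct.tmul_smul, b,
        TensorProduct.smul_tmul']
      abel
  rw [h]
  exact sub_mem ⟨_, rfl⟩ (sum_mem fun i _ => ⟨_, rfl⟩)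

theorem mem_range_titsMap {u : TitsAmbient K₁ K₂} (hu : u ∈ L₃ K₁ K₂) :
    u ∈ LinearMap.range (titsMap K₁ K₂) := by
  have h3 : ∀ s, ((0, 0, TensorProduct.mapIncl (im K₁) (H3' K₂) s) : TitsAmbient K₁ K₂)
      ∈ LinearMap.range (titsMap K₁ K₂) := fun s => by
    induction s with
    | zero => rw [map_zero]; exact zero_mem _
    | tmul a A => exact tmul_mem_range_titsMap a.2 A.2
    | add s t hs ht =>
      have := add_mem hs ht
      rw [Prod.mk_add_mk, Prod.mk_add_mk, add_zero, add_zero, ← map_add] at this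
      exact this
  obtain ⟨D, d, t⟩ := u
  obtain ⟨hD, hd, s, rfl⟩ := hu
  have := add_mem (add_mem (fst_mem_range_titsMap (K₂ := K₂) hD)
    (snd_mem_range_titsMap (K₁ := K₁) hd)) (h3 s)
  simpa only [Prod.mk_add_mk, add_zero, zero_add] using this

/-! ### The isomorphism, the Lie algebra structure and the symmetry -/

variable (K₁ K₂) in
/-- The isomorphism of the triality construction with the Tits construction. -/
def titsEquiv : TrialitySpace K₁ K₂ ≃ₗ[ℝ] L₃ K₁ K₂ :=
  LinearEquiv.ofBijective ((titsMap K₁ K₂).codRestrict _ titsMap_mem)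
    ⟨fun _ _ h => titsMap_injective (congrArg Subtype.val h), fun v => by
      obtain ⟨u, hu⟩ := mem_range_titsMap v.2
      exact ⟨u, Subtype.ext hu⟩⟩

theorem isTrialityDecomposition_titsEquiv : IsTrialityDecomposition (titsEquiv K₁ K₂) where
  tri_tri S₁ T₁ S₂ T₂ := titsBracket_tri_tri S₁ T₁ S₂ T₂
  tri₁_F := titsBracket_tri₁_F
  tri₂_F := titsBracket_tri₂_F
  F_F i j k hj hk x₁ y₁ x₂ y₂ := by
    subst hj hk
    exact titsBracket_F_F i x₁ y₁ x₂ y₂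
  F_F_self := titsBracket_F_F_self

/-- Closure and Jacobi are transported from the triality bracket along the isomorphism; no separate
verification on the Tits side is made. -/
theorem isLieBracketOn_L₃ : IsLieBracketOn titsBracket (L₃ K₁ K₂) := by
  have h := (isTrialityDecomposition_titsEquiv (K₁ := K₁) (K₂ := K₂)).titsBracket_eq
  refine ⟨fun u hu v hv => ?_, fun u hu => ?_, fun u hu v hv w hw => ?_⟩
  · obtain ⟨x, hx⟩ := (titsEquiv K₁ K₂).surjective ⟨u, hu⟩
    obtain ⟨y, hy⟩ := (titsEquiv K₁ K₂).surjective ⟨v, hv⟩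
    have := h x y
    rw [hx, hy] at this
    change titsBracket u v = _ at this
    rw [this]
    exact Subtype.property _
  · exact eq_zero_of_eq_neg_self (eq_neg_of_add_eq_zero_left (titsBracket_swap u u))
  · obtain ⟨x, hx⟩ := (titsEquiv K₁ K₂).surjective ⟨u, hu⟩
    obtain ⟨y, hy⟩ := (titsEquiv K₁ K₂).surjective ⟨v, hv⟩
    obtain ⟨z, hz⟩ := (titsEquiv K₁ K₂).surjective ⟨w, hw⟩
    have hx' : u = (titsEquiv K₁ K₂ x).1 := by rw [hx]
    have hy' : v = (titsEquiv K₁ K₂ y).1 := by rw [hy]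
    have hz' : w = (titsEquiv K₁ K₂ z).1 := by rw [hz]
    rw [hx', hy', hz', h, h, h, h, h, h]
    have := congrArg (fun t => (titsEquiv K₁ K₂ t).1) (trialityBracket_jacobi x y z)
    simpa only [map_add, map_zero, Submodule.coe_add, Submodule.coe_zero] using this

theorem titsBracket_interchange {Φ : TrialitySpace K₁ K₂ ≃ₗ[ℝ] L₃ K₁ K₂}
    {Φ' : TrialitySpace K₂ K₁ ≃ₗ[ℝ] L₃ K₂ K₁} (hΦ : IsTrialityDecomposition Φ)
    (hΦ' : IsTrialityDecomposition Φ') {u v w : TrialitySpace K₁ K₂}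
    (h : titsBracket (Φ u).1 (Φ v).1 = (Φ w).1) :
    titsBracket (Φ' (interchange K₁ K₂ u)).1 (Φ' (interchange K₁ K₂ v)).1
      = (Φ' (interchange K₁ K₂ w)).1 := by
  rw [hΦ.titsBracket_eq] at h
  rw [hΦ'.titsBracket_eq, trialityBracket_interchange, Φ.injective (Subtype.ext h)]

end TitsEquiv

end MagicSquare

end

open MagicSquare in
theorem theorem4p4 (K₁ K₂ : Type*)
    [NonAssocRing K₁] [Module ℝ K₁] [CompositionAlgebra K₁]
    [NonAssocRing K₂] [Module ℝ K₂] [CompositionAlgebra K₂] :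
    IsLieBracketOn titsBracket (L₃ K₁ K₂) ∧
    (∃ Φ : TrialitySpace K₁ K₂ ≃ₗ[ℝ] L₃ K₁ K₂, IsTrialityDecomposition Φ) ∧
    (∀ (Φ : TrialitySpace K₁ K₂ ≃ₗ[ℝ] L₃ K₁ K₂) (Φ' : TrialitySpace K₂ K₁ ≃ₗ[ℝ] L₃ K₂ K₁),
      IsTrialityDecomposition Φ → IsTrialityDecomposition Φ' →
      ∀ u v w : TrialitySpace K₁ K₂,
        titsBracket (Φ u).1 (Φ v).1 = (Φ w).1 →
        titsBracket (Φ' (interchange K₁ K₂ u)).1 (Φ' (interchange K₁ K₂ v)).1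
          = (Φ' (interchange K₁ K₂ w)).1) :=
  ⟨isLieBracketOn_L₃, ⟨titsEquiv K₁ K₂, isTrialityDecomposition_titsEquiv⟩,
    fun _ _ hΦ hΦ' _ _ _ => titsBracket_interchange hΦ hΦ'⟩
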